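/- **Setting.** Let $G=(V,E)$ be a finite graph with a root $\rho$ and node weights $c\colon V\to\mathbb R_{\ge 0}$, $c(\rho)=0$. A *solution* is a set $T\ni\rho$ of nodes that induces a connected subgraph, and $c(T)=\sum_{v\in T}c(v)$. NW-$k$-MST asks for a solution with at least $k$ nodes of minimum cost $\mathrm{OPT}$. NW-PC-ST with uniform penalty $\lambda\ge 0$ asks for a solution $T$ minimizing $c(T)+\lambda(|V|-|T|)$. **The moat-growing algorithm** with uniform penalty $\lambda$. Put $p_v=\min(c(v),\lambda)$ and let $c'(v)=c(v)-p_v$, $\pi'(v)=\lambda-p_v$ be the reduced costs and penalties; nodes with $c'(v)=0$ are terminals and are bought at time $0$. Moats are the connected components of the graph induced by the bought nodes. The potential of a moat $M$ is $\sum_{v\in M}\pi'(v)-\sum_{X\subseteq M}y_X$, where the dual variables $y_X$ start at $0$. A moat is active if its potential is positive and it does not contain $\rho$. The variables $y_M$ of all active moats are raised simultaneously at unit speed. When the potential of a moat not containing $\rho$ reaches $0$, its unmarked terminals are marked with the current time. When a node $v$ that is not bought goes tight, that is $\sum_{S:\,v\in\Gamma(S)}y_S=c'(v)$ with $\Gamma(S)$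 the set of neighbours of $S$ outside $S$, the node is bought and the neighbouring moats merge with it. If both kinds of events happen at the same time, the moats that ran out of potential are handled first; other ties are broken arbitrarily. Growing ends when no moat is active. Then the bought nodes are considered in reverse order of buying, and $v\neq\rho$ is deleted unless its removal would disconnect from $\rho$ an unmarked terminal or a terminal marked later than the buying time of $v$. The remaining set $T^\lambda$ is returned. The algorithm *has ratio $r$* on $(G,\rho,c)$ if for every $\lambda\ge0$ it terminates with an output, and every possible output $T^\lambda$ is a solution satisfying, for every solution $T'$, $$c(T^\lambda)+r\lambda\,(|V|-|T^\lambda|)\le r\bigl(c(T')+\lambda(|V|-|T'|)\bigr).$$ **Statement.** For every real $r>1$ there is an infinite sequence of rooted node-weighted graphs $G_i$ with strictly increasing numbers of nodes, and of targets $k_i$ with NW-$k_i$-MST optimum $\mathrm{OPT}_i>0$, such that for every $\varepsilon>0$ and all sufficiently large $i$ every node of $G_i$ can be connected to the root by a path of node weight at most $\varepsilon\,\mathrm{OPT}_i$ (not counting the root), and such that for every $i$: 1. the moat-growing algorithm has ratio $r$ on $G_i$; 2. there are $\lambda_0>0$, $\delta>0$ and solutions $T_A,T_B$ with $|T_A|<k_i<|T_B|$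 such that, however ties are broken, the algorithm returns $T_A$ for every $\lambda\ge 0$ with $\lambda_0-\delta\le\lambda\le\lambda_0$ and returns $T_B$ for every $\lambda$ with $\lambda_0<\lambda\le\lambda_0+\delta$; moreover every output $T^\lambda$ satisfies $|T^\lambda|<k_i$ for all $0\le\lambda\le\lambda_0$ and $|T^\lambda|>k_i$ for all $\lambda>\lambda_0$; 3. every feasible NW-$k_i$-MST solution $T\subseteq T_A\cup T_B$ has cost $c(T)\ge\frac43\,r\cdot\mathrm{OPT}_i$. -/

import Mathlib

/-- A rooted node-weighted graph.  The root has to be part of every solution, so its weight is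
normalised to `0`. -/
structure RootedGraph (V : Type*) where
  graph : SimpleGraph V
  root : V
  cost : V → ℝ
  cost_nonneg : ∀ v, 0 ≤ cost v
  cost_root : cost root = 0

/-- A state of the GROW phase of the moat-growing algorithm: the bought nodes (most recently bought
first), their buying times, the times at which terminals were marked (`none` for unmarked), the
dual variables `y_S`, and the current time. -/
structure MoatState (V : Type*) where
  bought : List V
  buyTime : V → ℝ
  markTime : V → Option ℝ
  dual : Finset V → ℝ
  time : ℝ

namespace RootedGraph

/-! ### The problems NW-`k`-MST and NW-PC-ST -/

/-- The total node weight of `T`. -/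
def totalCost {V : Type*} (I : RootedGraph V) (T : Finset V) : ℝ := ∑ v ∈ T, I.cost v

/-- A connected set of nodes that contains the root. -/
def IsSolution {V : Type*} (I : RootedGraph V) (T : Finset V) : Prop :=
  I.root ∈ T ∧ (I.graph.induce (T : Set V)).Connected

/-- Feasibility for NW-`k`-MST: a connected set with the root and at least `k` nodes. -/
def IsFeasible {V : Type*} (I : RootedGraph V) (k : ℕ) (T : Finset V) : Prop :=
  I.IsSolution T ∧ k ≤ T.card

/-- `opt` is the optimum value of NW-`k`-MST. -/
def IsOptimum {V : Type*} (I : RootedGraph V) (k : ℕ) (opt : ℝ) : Prop :=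
  IsLeast {x | ∃ T, I.IsFeasible k T ∧ x = I.totalCost T} opt

/-- `v` can be connected to the root by a path whose node weight, not counting the root, is at
most `d`. -/
def IsWithin {V : Type*} (I : RootedGraph V) (d : ℝ) (v : V) : Prop :=
  ∃ p : I.graph.Walk v I.root, p.IsPath ∧ (p.support.dropLast.map I.cost).sum ≤ d

/-! ### The moat-growing algorithm for NW-PC-ST with the same penalty `lam` at every node -/

/-- The cost that remains after the dual variable `p_v = min (cost v) lam` is paid. -/
noncomputable def reducedCost {V : Type*} (I : RootedGraph V) (lam : ℝ) (v : V) : ℝ :=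
  I.cost v - min (I.cost v) lam

/-- The penalty that remains after the dual variable `p_v = min (cost v) lam` is paid. -/
noncomputable def reducedPenalty {V : Type*} (I : RootedGraph V) (lam : ℝ) (v : V) : ℝ :=
  lam - min (I.cost v) lam

/-- Terminals have no reduced cost (the other nodes, the Steiner nodes, have no reduced penalty). -/
def IsTerminal {V : Type*} (I : RootedGraph V) (lam : ℝ) (v : V) : Prop :=
  I.reducedCost lam v = 0

/-- `Γ(S)`: the nodes outside `S` that have a neighbour in `S`. -/
def boundary {V : Type*} (I : RootedGraph V) (S : Finset V) : Set V :=
  {v | v ∉ S ∧ ∃ u ∈ S, I.graph.Adj u v}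

open Classical in
/-- The left-hand side `∑_{S : v ∈ Γ(S)} y_S` of the dual constraint of `v`. -/
noncomputable def load {V : Type*} [Fintype V] (I : RootedGraph V) (y : Finset V → ℝ) (v : V) : ℝ :=
  ∑ S : Finset V, if v ∈ I.boundary S then y S else 0

/-- The potential of `M`: the penalties inside `M` minus the dual variables of subsets of `M`. -/
noncomputable def potential {V : Type*} (I : RootedGraph V) (lam : ℝ) (y : Finset V → ℝ)
    (M : Finset V) : ℝ :=
  ∑ v ∈ M, I.reducedPenalty lam v - ∑ X ∈ M.powerset, y X

/-- The moats: the connected components of the subgraph induced by the bought nodes. -/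
def IsMoat {V : Type*} (I : RootedGraph V) (s : MoatState V) (M : Finset V) : Prop :=
  (∀ v ∈ M, v ∈ s.bought) ∧ (I.graph.induce (M : Set V)).Connected ∧
    ∀ u ∈ M, ∀ v ∈ s.bought, I.graph.Adj u v → v ∈ M

/-- Active moats: those with positive potential, except that of the root. -/
def IsActive {V : Type*} (I : RootedGraph V) (lam : ℝ) (s : MoatState V) (M : Finset V) : Prop :=
  I.IsMoat s M ∧ I.root ∉ M ∧ 0 < I.potential lam s.dual M

/-- A moat that has run out of potential and whose terminals have not all been marked yet. -/
def IsExhausted {V : Type*} (I : RootedGraph V) (lam : ℝ) (s : MoatState V) (M : Finset V) : Prop :=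
  I.IsMoat s M ∧ I.root ∉ M ∧ I.potential lam s.dual M = 0 ∧
    ∃ v ∈ M, I.IsTerminal lam v ∧ s.markTime v = none

/-- A node that is not bought yet and whose dual constraint holds with equality. -/
def IsTight {V : Type*} [Fintype V] (I : RootedGraph V) (lam : ℝ) (s : MoatState V) (v : V) :
    Prop :=
  v ∉ s.bought ∧ I.load s.dual v = I.reducedCost lam v

open Classical in
/-- The dual variables after those of all active moats are raised by `d`. -/
noncomputable def raise {V : Type*} (I : RootedGraph V) (lam : ℝ) (s : MoatState V) (d : ℝ) :
    Finset V → ℝ :=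
  fun S => if I.IsActive lam s S then s.dual S + d else s.dual S

open Classical in
/-- Marking with the current time all unmarked terminals in a moat. -/
noncomputable def markMoat {V : Type*} (I : RootedGraph V) (lam : ℝ) (s : MoatState V)
    (M : Finset V) : MoatState V :=
  { s with markTime := fun v =>
      if v ∈ M ∧ I.IsTerminal lam v ∧ s.markTime v = none then some s.time else s.markTime v }

open Classical in
/-- Buying a node at the current time. -/
noncomputable def buyNode {V : Type*} (s : MoatState V) (v : V) : MoatState V :=
  { s with bought := v :: s.bought, buyTime := Function.update s.buyTime v s.time }

/-- One step of the GROW phase.  Simultaneous events of the same kind are handled in any order;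
if a moat runs out of potential at the moment at which a node goes tight, then the moat is
deactivated first. -/
inductive GrowStep {V : Type*} [Fintype V] (I : RootedGraph V) (lam : ℝ) :
    MoatState V → MoatState V → Prop
  | deactivate (s : MoatState V) (M : Finset V) (hM : I.IsExhausted lam s M) :
      GrowStep I lam s (I.markMoat lam s M)
  | buy (s : MoatState V) (v : V) (h_mark : ∀ M, ¬ I.IsExhausted lam s M)
      (h_active : ∃ M, I.IsActive lam s M) (hv : I.IsTight lam s v) :
      GrowStep I lam s (buyNode s v)
  /- All active moats are raised at unit speed until the next event. -/
  | grow (s : MoatState V) (d : ℝ) (h_mark : ∀ M, ¬ I.IsExhausted lam s M)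
      (h_active : ∃ M, I.IsActive lam s M) (h_tight : ∀ v, ¬ I.IsTight lam s v) (hd : 0 < d)
      (h_cost : ∀ v, v ∉ s.bought → I.load (I.raise lam s d) v ≤ I.reducedCost lam v)
      (h_penalty : ∀ M, I.IsActive lam s M → 0 ≤ I.potential lam (I.raise lam s d) M)
      (h_event : (∃ v, v ∉ s.bought ∧ I.load (I.raise lam s d) v = I.reducedCost lam v) ∨
        ∃ M, I.IsActive lam s M ∧ I.potential lam (I.raise lam s d) M = 0) :
      GrowStep I lam s { s with dual := I.raise lam s d, time := s.time + d }

/-- The start of the GROW phase, at time `0`: exactly the terminals (among them the root) are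
bought, in any order; nothing is marked; all dual variables vanish. -/
def IsInitial {V : Type*} (I : RootedGraph V) (lam : ℝ) (s : MoatState V) : Prop :=
  s.bought.Nodup ∧ (∀ v, v ∈ s.bought ↔ v = I.root ∨ I.IsTerminal lam v) ∧
    s.buyTime = (fun _ => 0) ∧ s.markTime = (fun _ => none) ∧ s.dual = (fun _ => 0) ∧ s.time = 0

/-- The end of the GROW phase: there are no active moats (and all marks have been set). -/
def IsFinal {V : Type*} (I : RootedGraph V) (lam : ℝ) (s : MoatState V) : Prop :=
  (∀ M, ¬ I.IsExhausted lam s M) ∧ ∀ M, ¬ I.IsActive lam s M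

/-- `u` is connected to the root inside `F`. -/
def ConnectedToRoot {V : Type*} (I : RootedGraph V) (F : Finset V) (u : V) : Prop :=
  ∃ p : I.graph.Walk u I.root, ∀ w ∈ p.support, w ∈ F

open Classical in
/-- One step of the pruning phase: `v` is deleted unless this disconnects (from the root) the root,
an unmarked terminal, or a terminal that was marked after `v` was bought. -/
noncomputable def pruneNode {V : Type*} (I : RootedGraph V) (lam : ℝ) (s : MoatState V)
    (F : Finset V) (v : V) : Finset V :=
  if v ≠ I.root ∧ ∀ u ∈ F, I.IsTerminal lam u →
      (s.markTime u = none ∨ ∃ t, s.markTime u = some t ∧ s.buyTime v < t) →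
      I.ConnectedToRoot F u → I.ConnectedToRoot (F.erase v) u
  then F.erase v else F

open Classical in
/-- The pruning phase: the bought nodes are considered in the reverse order of buying. -/
noncomputable def prune {V : Type*} (I : RootedGraph V) (lam : ℝ) (s : MoatState V) : Finset V :=
  s.bought.foldl (I.pruneNode lam s) s.bought.toFinset

/-- `T` is an output of the moat-growing algorithm with penalty `lam` at every node. -/
def Returns {V : Type*} [Fintype V] (I : RootedGraph V) (lam : ℝ) (T : Finset V) : Prop :=
  ∃ s₀ s, I.IsInitial lam s₀ ∧ Relation.ReflTransGen (I.GrowStep lam) s₀ s ∧ I.IsFinal lam s ∧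
    T = I.prune lam s

/-- The moat-growing algorithm has (Lagrangian multiplier preserving) ratio `r` on `I`: for every
penalty `lam ≥ 0` it produces an output, and each output `T` is a solution whose cost plus `r`
times its total penalty is at most `r` times the optimum of NW-PC-ST. -/
def MoatGrowingHasRatio {V : Type*} [Fintype V] (I : RootedGraph V) (r : ℝ) : Prop :=
  ∀ lam : ℝ, 0 ≤ lam → (∃ T, I.Returns lam T) ∧
    ∀ T, I.Returns lam T → I.IsSolution T ∧ ∀ T', I.IsSolution T' →
      I.totalCost T + r * (lam * ((Fintype.card V : ℝ) - T.card)) ≤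
        r * (I.totalCost T' + lam * ((Fintype.card V : ℝ) - T'.card))

end RootedGraph

/-! ### Lump graphs

A lump graph consists of a root, of lumps (cliques of nodes of weight `0`) and of Steiner nodes of
positive weight.  Every Steiner node is adjacent to the root and to the lumps it is incident to. -/

/-! Two expensive covers, one by rows and one by columns, are what the algorithm returns just below
and just above a critical penalty, while a much cheaper third cover never goes tight. Put `q = N *
t`. There are `q` rows, `2 * q` columns and `N` cheap nodes. The core consists of the grid lumps,
each incident to one row and one column, and of the shared lumps, each incident to all rows and
columns; every core lump is also incident to exactly one cheap node. Core lumps are so large (size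
`s`) that a feasible set has to touch all of them. The remaining nodes of the target are supplied by
the column lumps of size `g`.

The jump. Prices are tuned to penalty `1`: rows go tight at time `g - 1`, which stops the core
lumps, and columns would go tight at time `g`, exactly when the column lumps run out of potential.
Running out is handled first, so only rows are bought. For a slightly larger penalty the columns are
bought too. They touch every core lump, and reverse deletion then discards the rows. The output thus
jumps from all rows to all columns.

The gap. A feasible set without cheap nodes either contains all columns, or misses one; in the
latter case the grid lumps force all rows and the target forces `q` columns. Both cost at least `q *
(cA + cB)`. The cheap nodes cover the core and about half of the column lumps, which is just enough.

The numbers. Let `F = N * v` be the number of shared lumps, with `F ≈ 2 * (r - 1) * q * m` and `p ≈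
q * m`. Shared lumps load every row and column but count only once in the dual, so they push the
cost of the output up to `r` times its dual. In units of `q^2 * m * g`, all rows cost about `2 * r`
against duals `2`, all columns `4 * r` against duals `4`, so the ratio is `r`. Half of the columns
together with all rows cost `4 * r`, the cheap nodes about `3`; this is the factor `4/3 * r`. With
`N = t = n` large, a single price is an `O(1/n)` fraction of the optimum.

Every Steiner node is adjacent to the root, so a moat without the root is a single lump, and a run
is described by one number per lump. `Schedule` is a certificate for such a run, `Inv.step` shows
that no run leaves it, and `Schedule.returns_iff` determines the output. The ratio follows from
`dual_le` and `Schedule.ratio`, the gap from `gap_le_totalCost` and `gap_coeff`. -/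

/-- The kinds of nodes of a lump graph. -/
inductive NodeClass (L S : Type*)
  | root
  | lump (ℓ : L)
  | steiner (σ : S)

/-- A lump graph with node set `V`, lumps `L` and Steiner nodes `S`. -/
structure LumpGraph (V L S : Type*) where
  cls : V → NodeClass L S
  rt : V
  st : S → V
  cls_eq_root : ∀ v, cls v = .root ↔ v = rt
  cls_eq_steiner : ∀ v σ, cls v = .steiner σ ↔ v = st σ
  exists_lump : ∀ ℓ, ∃ v, cls v = .lump ℓ
  inc : L → S → Prop
  price : S → ℝ
  price_pos : ∀ σ, 0 < price σ

namespace LumpGraph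

section basic

variable {V L S : Type*}

/-- Adjacency of distinct nodes in terms of their classes. -/
def classAdj (X : LumpGraph V L S) : NodeClass L S → NodeClass L S → Prop
  | .lump ℓ, .lump ℓ' => ℓ = ℓ'
  | .lump ℓ, .steiner σ => X.inc ℓ σ
  | .steiner σ, .lump ℓ => X.inc ℓ σ
  | .steiner _, .root => True
  | .root, .steiner _ => True
  | _, _ => False

theorem classAdj_symm (X : LumpGraph V L S) (a b : NodeClass L S) (h : X.classAdj a b) :
    X.classAdj b a := by
  cases a <;> cases b <;> simp_all [classAdj]

/-- The weight of a node in terms of its class. -/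
def classCost (X : LumpGraph V L S) : NodeClass L S → ℝ
  | .steiner σ => X.price σ
  | _ => 0

/-- The rooted node-weighted graph of a lump graph. -/
def rooted (X : LumpGraph V L S) : RootedGraph V where
  graph :=
    { Adj := fun u v => u ≠ v ∧ X.classAdj (X.cls u) (X.cls v)
      symm := ⟨fun _ _ h => ⟨h.1.symm, X.classAdj_symm _ _ h.2⟩⟩
      loopless := ⟨fun _ h => h.1 rfl⟩ }
  root := X.rt
  cost := fun v => X.classCost (X.cls v)
  cost_nonneg := fun v => by
    cases h : X.cls v with
    | steiner σ => exact (X.price_pos σ).le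
    | _ => exact le_refl _
  cost_root := by rw [(X.cls_eq_root X.rt).2 rfl]; rfl

variable (X : LumpGraph V L S)

@[simp] theorem rooted_root : X.rooted.root = X.rt := rfl

theorem adj_iff (u v : V) :
    X.rooted.graph.Adj u v ↔ u ≠ v ∧ X.classAdj (X.cls u) (X.cls v) := Iff.rfl

theorem cost_eq (v : V) : X.rooted.cost v = X.classCost (X.cls v) := rfl

@[simp] theorem cls_rt : X.cls X.rt = .root := (X.cls_eq_root _).2 rfl

@[simp] theorem cls_st (σ : S) : X.cls (X.st σ) = .steiner σ := (X.cls_eq_steiner _ _).2 rfl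

theorem st_injective : Function.Injective X.st := fun σ τ h => by
  have := X.cls_st σ
  rw [h, X.cls_st] at this
  cases this; rfl

theorem st_ne_rt (σ : S) : X.st σ ≠ X.rt := fun h => by
  have := X.cls_st σ
  rw [h, X.cls_rt] at this
  cases this

/-- Every node is the root, belongs to a lump or is a Steiner node. -/
theorem node_cases (v : V) : v = X.rt ∨ (∃ ℓ, X.cls v = .lump ℓ) ∨ ∃ σ, v = X.st σ := by
  cases h : X.cls v with
  | root => exact Or.inl ((X.cls_eq_root v).1 h)
  | lump ℓ => exact Or.inr (Or.inl ⟨ℓ, rfl⟩)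
  | steiner σ => exact Or.inr (Or.inr ⟨σ, (X.cls_eq_steiner v σ).1 h⟩)

theorem adj_st_rt (σ : S) : X.rooted.graph.Adj (X.st σ) X.rt := by
  rw [adj_iff]
  exact ⟨X.st_ne_rt σ, by simp [classAdj]⟩

theorem adj_lump_st {v : V} {ℓ : L} (hv : X.cls v = .lump ℓ) (σ : S) :
    X.rooted.graph.Adj v (X.st σ) ↔ X.inc ℓ σ := by
  rw [adj_iff]
  constructor
  · rintro ⟨-, h⟩
    simpa [hv, classAdj] using h
  · intro h
    refine ⟨?_, by simpa [hv, classAdj] using h⟩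
    rintro rfl
    simp at hv

theorem cost_lump {v : V} {ℓ : L} (hv : X.cls v = .lump ℓ) : X.rooted.cost v = 0 := by
  rw [cost_eq, hv]; rfl

@[simp] theorem cost_rt : X.rooted.cost X.rt = 0 := X.rooted.cost_root

@[simp] theorem cost_st (σ : S) : X.rooted.cost (X.st σ) = X.price σ := by
  rw [cost_eq, cls_st]; rfl

/-- A walk that avoids the Steiner nodes does not leave the lump in which it starts. -/
theorem cls_of_walk {u v : V} {ℓ : L} (p : X.rooted.graph.Walk u v) (hu : X.cls u = .lump ℓ)
    (hp : ∀ σ, X.inc ℓ σ → X.st σ ∉ p.support) : X.cls v = .lump ℓ := by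
  induction p with
  | nil => exact hu
  | @cons u w v h p ih =>
    have hw : X.cls w = .lump ℓ := by
      rw [adj_iff, hu] at h
      rcases X.node_cases w with rfl | ⟨ℓ', hℓ⟩ | ⟨σ, rfl⟩
      · simp [classAdj] at h
      · rw [hℓ] at h ⊢
        rw [show ℓ = ℓ' from h.2]
      · exfalso
        refine hp σ (by simpa [classAdj] using h.2) ?_
        simp
    exact ih hw fun σ hσ hmem => hp σ hσ (by simp [hmem])

theorem connectedToRoot_rt {F : Finset V} (h : X.rt ∈ F) : X.rooted.ConnectedToRoot F X.rt :=
  ⟨.nil, by simpa using h⟩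

theorem connectedToRoot_st {F : Finset V} (h : X.rt ∈ F) {σ : S} (hσ : X.st σ ∈ F) :
    X.rooted.ConnectedToRoot F (X.st σ) :=
  ⟨.cons (X.adj_st_rt σ) .nil, by simp [h, hσ]⟩

theorem connectedToRoot_lump {F : Finset V} (h : X.rt ∈ F) {v : V} (hv : v ∈ F) {ℓ : L}
    (hℓ : X.cls v = .lump ℓ) {σ : S} (hσ : X.st σ ∈ F) (hi : X.inc ℓ σ) :
    X.rooted.ConnectedToRoot F v :=
  ⟨.cons ((X.adj_lump_st hℓ σ).2 hi) (.cons (X.adj_st_rt σ) .nil), by simp [h, hσ, hv]⟩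

theorem exists_steiner_of_connectedToRoot {F : Finset V} {v : V} {ℓ : L} (hℓ : X.cls v = .lump ℓ)
    (h : X.rooted.ConnectedToRoot F v) : ∃ σ, X.inc ℓ σ ∧ X.st σ ∈ F := by
  obtain ⟨p, hp⟩ := h
  by_contra! hne
  have := X.cls_of_walk p hℓ fun σ hσ hmem => hne σ hσ (hp _ hmem)
  simp at this

theorem connectedToRoot_mem {I : RootedGraph V} {F : Finset V} {v : V}
    (h : I.ConnectedToRoot F v) : v ∈ F := by
  obtain ⟨p, hp⟩ := h
  exact hp _ p.start_mem_support

theorem connectedToRoot_mono {I : RootedGraph V} {F F' : Finset V} (hF : F ⊆ F') {v : V}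
    (h : I.ConnectedToRoot F v) : I.ConnectedToRoot F' v := by
  obtain ⟨p, hp⟩ := h
  exact ⟨p, fun w hw => hF (hp w hw)⟩

theorem reducedPenalty_lump {lam : ℝ} (hlam : 0 ≤ lam) {v : V} {ℓ : L} (hv : X.cls v = .lump ℓ) :
    X.rooted.reducedPenalty lam v = lam := by
  simp [RootedGraph.reducedPenalty, X.cost_lump hv, hlam]

theorem isTerminal_lump {lam : ℝ} (hlam : 0 ≤ lam) {v : V} {ℓ : L} (hv : X.cls v = .lump ℓ) :
    X.rooted.IsTerminal lam v := by
  simp [RootedGraph.IsTerminal, RootedGraph.reducedCost, X.cost_lump hv, hlam]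

theorem isTerminal_st {lam : ℝ} (σ : S) : X.rooted.IsTerminal lam (X.st σ) ↔ X.price σ ≤ lam := by
  simp only [RootedGraph.IsTerminal, RootedGraph.reducedCost, cost_st, sub_eq_zero]
  constructor
  · intro h; rw [h]; exact min_le_right _ _
  · intro h; rw [min_eq_left h]

/-- Nodes that are connected inside `T` are joined by a walk inside `T`. -/
theorem exists_walk_of_reachable_induce {G : SimpleGraph V} {T : Set V} {a b : T}
    (h : (G.induce T).Reachable a b) : ∃ p : G.Walk a.1 b.1, ∀ w ∈ p.support, w ∈ T := by
  obtain ⟨p⟩ := h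
  induction p with
  | @nil a => exact ⟨.nil, by simp⟩
  | @cons a c b hac p ih =>
    obtain ⟨q, hq⟩ := ih
    have hac' : G.Adj a.1 c.1 := hac
    refine ⟨.cons hac' q, fun w hw => ?_⟩
    rcases List.mem_cons.1 hw with rfl | hw
    · exact a.2
    · exact hq w hw

/-- A set of nodes is a solution as soon as each of its nodes is connected to the root inside it. -/
theorem isSolution_iff {I : RootedGraph V} {T : Finset V} :
    I.IsSolution T ↔ I.root ∈ T ∧ ∀ v ∈ T, I.ConnectedToRoot T v := by
  constructor
  · rintro ⟨h, hc⟩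
    refine ⟨h, fun v hv => ?_⟩
    exact exists_walk_of_reachable_induce (hc.preconnected ⟨v, hv⟩ ⟨I.root, h⟩)
  · rintro ⟨h, hc⟩
    refine ⟨h, ?_⟩
    have key : ∀ v (hv : v ∈ T),
        (I.graph.induce (T : Set V)).Reachable ⟨v, hv⟩ ⟨I.root, h⟩ := by
      intro v hv
      obtain ⟨p, hp⟩ := hc v hv
      exact ⟨p.induce (T : Set V) hp⟩
    have : Nonempty (T : Set V) := ⟨⟨I.root, h⟩⟩
    exact ⟨fun u v => (key u.1 u.2).trans (key v.1 v.2).symm⟩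

end basic

/-! ### Moats, loads and potentials in lump graphs -/

section finite

variable {V L S : Type*} [Fintype V] (X : LumpGraph V L S)

open Classical in
/-- The nodes of a lump. -/
noncomputable def lumpSet (ℓ : L) : Finset V := Finset.univ.filter fun v => X.cls v = .lump ℓ

@[simp] theorem mem_lumpSet {v : V} {ℓ : L} : v ∈ X.lumpSet ℓ ↔ X.cls v = .lump ℓ := by
  simp [lumpSet]

theorem lumpSet_nonempty (ℓ : L) : (X.lumpSet ℓ).Nonempty := by
  obtain ⟨v, hv⟩ := X.exists_lump ℓ
  exact ⟨v, by simpa using hv⟩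

theorem eq_of_lumpSet_subset {ℓ ℓ' : L} (h : X.lumpSet ℓ ⊆ X.lumpSet ℓ') : ℓ = ℓ' := by
  obtain ⟨v, hv⟩ := X.lumpSet_nonempty ℓ
  have h1 := X.mem_lumpSet.1 hv
  have h2 := X.mem_lumpSet.1 (h hv)
  rw [h1] at h2
  cases h2; rfl

theorem lumpSet_injective : Function.Injective X.lumpSet := fun _ _ h =>
  X.eq_of_lumpSet_subset h.subset

theorem rt_notMem_lumpSet (ℓ : L) : X.rt ∉ X.lumpSet ℓ := by simp

/-- The number of nodes of a lump, as a real number. -/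
noncomputable def size (ℓ : L) : ℝ := (X.lumpSet ℓ).card

theorem size_pos (ℓ : L) : 0 < X.size ℓ := by
  have := (X.lumpSet_nonempty ℓ).card_pos
  unfold size
  exact_mod_cast this

theorem st_mem_boundary_lumpSet (σ : S) (ℓ : L) :
    X.st σ ∈ X.rooted.boundary (X.lumpSet ℓ) ↔ X.inc ℓ σ := by
  constructor
  · rintro ⟨-, u, hu, h⟩
    exact (X.adj_lump_st (X.mem_lumpSet.1 hu) σ).1 h
  · intro h
    refine ⟨by simp, ?_⟩
    obtain ⟨u, hu⟩ := X.lumpSet_nonempty ℓ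
    exact ⟨u, hu, (X.adj_lump_st (X.mem_lumpSet.1 hu) σ).2 h⟩

/-- If all nodes but Steiner nodes are bought, then a moat without the root is a lump that is not
incident to any bought Steiner node. -/
theorem isMoat_iff {s : MoatState V} (hb : ∀ v, (∀ σ, v ≠ X.st σ) → v ∈ s.bought) (M : Finset V) :
    (X.rooted.IsMoat s M ∧ X.rt ∉ M) ↔
      ∃ ℓ, M = X.lumpSet ℓ ∧ ∀ σ, X.inc ℓ σ → X.st σ ∉ s.bought := by
  have hlump : ∀ v ℓ, X.cls v = .lump ℓ → v ∈ s.bought := fun v ℓ hv => hb v fun σ h => by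
    subst h; simp at hv
  constructor
  · rintro ⟨⟨hM1, hM2, hM3⟩, hr⟩
    have hst : ∀ σ, X.st σ ∉ M := fun σ hσ =>
      hr (hM3 _ hσ _ (hb _ fun τ h => X.st_ne_rt τ h.symm) (X.adj_st_rt σ))
    obtain ⟨⟨v, hv⟩⟩ := hM2.nonempty
    have hv' : v ∈ M := hv
    obtain ⟨ℓ, hℓ⟩ : ∃ ℓ, X.cls v = .lump ℓ := by
      rcases X.node_cases v with rfl | h | ⟨σ, rfl⟩
      · exact absurd hv' hr
      · exact h
      · exact absurd hv' (hst σ)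
    refine ⟨ℓ, ?_, fun σ hσ hbt => hst σ (hM3 _ hv' _ hbt ((X.adj_lump_st hℓ σ).2 hσ))⟩
    ext w
    rw [mem_lumpSet]
    constructor
    · intro hw
      obtain ⟨p, hp⟩ := exists_walk_of_reachable_induce (hM2.preconnected ⟨v, hv⟩ ⟨w, hw⟩)
      exact X.cls_of_walk p hℓ fun σ _ hmem => hst σ (hp _ hmem)
    · intro hw
      by_cases hvw : v = w
      · exact hvw ▸ hv'
      · refine hM3 _ hv' _ (hlump w ℓ hw) ?_
        rw [adj_iff]
        exact ⟨hvw, by simp [hℓ, hw, classAdj]⟩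
  · rintro ⟨ℓ, rfl, hℓ⟩
    refine ⟨⟨fun v hv => hlump v ℓ (by simpa using hv), ?_, ?_⟩, X.rt_notMem_lumpSet ℓ⟩
    · obtain ⟨v, hv⟩ := X.lumpSet_nonempty ℓ
      have : Nonempty ((X.lumpSet ℓ : Finset V) : Set V) := ⟨⟨v, hv⟩⟩
      refine ⟨fun a b => ?_⟩
      by_cases hab : a = b
      · rw [hab]
      · refine SimpleGraph.Adj.reachable ?_
        rw [SimpleGraph.comap_adj]
        show X.rooted.graph.Adj a.1 b.1
        rw [adj_iff]
        have ha := X.mem_lumpSet.1 a.2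
        have hb := X.mem_lumpSet.1 b.2
        exact ⟨fun h => hab (Subtype.ext h), by simp [ha, hb, classAdj]⟩
    · intro u hu v hv huv
      rw [mem_lumpSet] at hu ⊢
      refine X.cls_of_walk (.cons huv .nil) hu fun σ hσ hmem => ?_
      simp only [SimpleGraph.Walk.support_cons, SimpleGraph.Walk.support_nil, List.mem_cons,
        List.not_mem_nil, or_false] at hmem
      rcases hmem with h | h
      · rw [← h] at hu; simp at hu
      · exact hℓ σ hσ (h ▸ hv)

/-- The dual variables of a family that lives on the lumps only. -/
def DualOn (y : Finset V → ℝ) (z : L → ℝ) : Prop :=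
  (∀ ℓ, y (X.lumpSet ℓ) = z ℓ) ∧ ∀ A, (∀ ℓ, A ≠ X.lumpSet ℓ) → y A = 0

variable {X}

section load

variable [Fintype L]

open Classical in
theorem load_eq {y : Finset V → ℝ} {z : L → ℝ} (h : X.DualOn y z) (σ : S) :
    X.rooted.load y (X.st σ) = ∑ ℓ with X.inc ℓ σ, z ℓ := by
  unfold RootedGraph.load
  rw [← Finset.sum_filter, ← Finset.sum_subset (s₁ := (Finset.univ.filter fun ℓ => X.inc ℓ σ).image
    X.lumpSet)]
  · rw [Finset.sum_image fun a _ b _ hab => X.lumpSet_injective hab]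
    exact Finset.sum_congr rfl fun ℓ _ => h.1 ℓ
  · intro A hA
    obtain ⟨ℓ, hℓ, rfl⟩ := Finset.mem_image.1 hA
    simp only [Finset.mem_filter, Finset.mem_univ, true_and] at hℓ ⊢
    exact (X.st_mem_boundary_lumpSet σ ℓ).2 hℓ
  · intro A hA hA'
    refine h.2 A fun ℓ hℓ => hA' ?_
    subst hℓ
    simp only [Finset.mem_filter, Finset.mem_univ, true_and] at hA
    exact Finset.mem_image.2 ⟨ℓ, by simpa using (X.st_mem_boundary_lumpSet σ ℓ).1 hA, rfl⟩

end load

theorem potential_lumpSet {lam : ℝ} (hlam : 0 ≤ lam) {y : Finset V → ℝ} {z : L → ℝ}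
    (h : X.DualOn y z) (ℓ : L) :
    X.rooted.potential lam y (X.lumpSet ℓ) = X.size ℓ * lam - z ℓ := by
  unfold RootedGraph.potential
  congr 1
  · rw [Finset.sum_congr rfl fun v hv => X.reducedPenalty_lump hlam (X.mem_lumpSet.1 hv)]
    simp [size]
  · rw [Finset.sum_eq_single (X.lumpSet ℓ)]
    · exact h.1 ℓ
    · intro A hA hne
      refine h.2 A fun ℓ' hℓ' => hne ?_
      subst hℓ'
      rw [X.eq_of_lumpSet_subset (Finset.mem_powerset.1 hA)]
    · intro hn
      simp at hn

end finite

end LumpGraph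

/-! ### Schedules: certificates for the course of the GROW phase -/

namespace LumpGraph

variable {V L S : Type*} [Fintype V] [Fintype L]

theorem reducedCost_st {V L S : Type*} (X : LumpGraph V L S) (lam : ℝ) (σ : S) :
    X.rooted.reducedCost lam (X.st σ) = X.price σ - min (X.price σ) lam := by
  simp [RootedGraph.reducedCost]

open Classical in
/-- The course of the moat-growing algorithm on a lump graph: `Buy` are the Steiner nodes that are
bought, `time` are their buying times and `y` are the final dual variables of the lumps.  The
conditions make this the only possible course, up to the order of simultaneous events. -/
structure Schedule (X : LumpGraph V L S) (lam : ℝ) where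
  Buy : Finset S
  time : S → ℝ
  y : L → ℝ
  terminal_mem : ∀ σ, X.price σ ≤ lam → σ ∈ Buy
  terminal_time : ∀ σ, X.price σ ≤ lam → time σ = 0
  time_pos : ∀ σ ∈ Buy, lam < X.price σ → 0 < time σ
  y_nonneg : ∀ ℓ, 0 ≤ y ℓ
  y_le_time : ∀ ℓ, ∀ σ ∈ Buy, X.inc ℓ σ → y ℓ ≤ time σ
  -- A lump stops growing either with its potential used up, untouched by bought nodes, or with
  -- potential left when the first incident node is bought.
  lump_cases : ∀ ℓ, (y ℓ = X.size ℓ * lam ∧ ∀ σ ∈ Buy, ¬ X.inc ℓ σ) ∨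
    (y ℓ < X.size ℓ * lam ∧ ∃ σ ∈ Buy, X.inc ℓ σ ∧ time σ = y ℓ)
  tight : ∀ σ ∈ Buy, ∑ ℓ with X.inc ℓ σ, y ℓ = X.price σ - min (X.price σ) lam
  -- The witness lump has potential left and no other bought node reaches it as early, so it stays
  -- active, and growing cannot end, until `σ` is bought.
  exists_witness : ∀ σ ∈ Buy, lam < X.price σ → ∃ ℓ, X.inc ℓ σ ∧ y ℓ = time σ ∧
    y ℓ < X.size ℓ * lam ∧ ∀ τ ∈ Buy, X.inc ℓ τ → τ ≠ σ → time σ < time τ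
  load_le : ∀ σ, σ ∉ Buy → ∑ ℓ with X.inc ℓ σ, y ℓ ≤ X.price σ - min (X.price σ) lam
  -- A node outside `Buy` may reach its reduced cost only when one of its lumps attains the largest
  -- dual of all and every lump with that dual has just run out of potential. Deactivation comes
  -- first, no active moat is left, and the node is not bought. The columns at penalty `1` are in
  -- this situation.
  load_lt : ∀ σ, σ ∉ Buy → ∑ ℓ with X.inc ℓ σ, y ℓ < X.price σ - min (X.price σ) lam ∨
    ∃ ℓ, X.inc ℓ σ ∧ ∀ ℓ', y ℓ' < y ℓ ∨ (y ℓ' = y ℓ ∧ y ℓ' = X.size ℓ' * lam)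

namespace Schedule

variable {X : LumpGraph V L S} {lam : ℝ} (sch : Schedule X lam)

/-- The states that occur in the course of the algorithm. -/
structure Inv (s : MoatState V) : Prop where
  time_nonneg : 0 ≤ s.time
  base : ∀ v, (∀ σ, v ≠ X.st σ) → v ∈ s.bought
  mem_buy : ∀ σ, X.st σ ∈ s.bought → σ ∈ sch.Buy
  time_le : ∀ σ, X.st σ ∈ s.bought → sch.time σ ≤ s.time
  -- The inequality is strict: a node whose buying time is the current time may or may not have been
  -- bought yet, which leaves the order of simultaneous purchases open.
  bought_of_lt : ∀ σ ∈ sch.Buy, sch.time σ < s.time → X.st σ ∈ s.bought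
  terminal : ∀ σ, X.price σ ≤ lam → X.st σ ∈ s.bought
  dual : X.DualOn s.dual fun ℓ => min s.time (sch.y ℓ)
  mark : ∀ v, s.markTime v ≠ none →
    ∃ ℓ, X.cls v = .lump ℓ ∧ sch.y ℓ = X.size ℓ * lam ∧ sch.y ℓ ≤ s.time

variable {sch}

theorem Inv.of_isInitial (hlam : 0 ≤ lam) {s : MoatState V} (h : X.rooted.IsInitial lam s) :
    sch.Inv s := by
  obtain ⟨-, hb, -, hm, hd, ht⟩ := h
  have hterm : ∀ σ, X.st σ ∈ s.bought ↔ X.price σ ≤ lam := fun σ => by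
    rw [hb, ← X.isTerminal_st]
    simp [X.st_ne_rt σ]
  refine ⟨ht.ge, fun v hv => ?_, fun σ h => sch.terminal_mem σ ((hterm σ).1 h), fun σ h => ?_,
    fun σ hσ h => ?_, fun σ h => (hterm σ).2 h, ⟨fun ℓ => ?_, fun A _ => by rw [hd]⟩,
    fun v hv => by simp [hm] at hv⟩
  · rw [hb]
    rcases X.node_cases v with rfl | ⟨ℓ, hℓ⟩ | ⟨σ, rfl⟩
    · exact Or.inl rfl
    · exact Or.inr (X.isTerminal_lump hlam hℓ)
    · exact absurd rfl (hv σ)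
  · rw [sch.terminal_time σ ((hterm σ).1 h), ht]
  · rw [hterm]
    by_contra! hlt
    have := sch.time_pos σ hσ hlt
    linarith
  · rw [hd, ht]
    exact (min_eq_left (sch.y_nonneg ℓ)).symm

/-- The lump is not incident to a bought Steiner node. -/
def _root_.LumpGraph.IsFree (X : LumpGraph V L S) (s : MoatState V) (ℓ : L) : Prop :=
  ∀ σ, X.inc ℓ σ → X.st σ ∉ s.bought

theorem Inv.isActive_iff (hlam : 0 ≤ lam) {s : MoatState V} (h : sch.Inv s) (M : Finset V) :
    X.rooted.IsActive lam s M ↔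
      ∃ ℓ, M = X.lumpSet ℓ ∧ X.IsFree s ℓ ∧ min s.time (sch.y ℓ) < X.size ℓ * lam := by
  unfold RootedGraph.IsActive
  rw [rooted_root, ← and_assoc, X.isMoat_iff h.base]
  constructor
  · rintro ⟨⟨ℓ, rfl, hf⟩, hp⟩
    rw [potential_lumpSet hlam h.dual] at hp
    exact ⟨ℓ, rfl, hf, by linarith⟩
  · rintro ⟨ℓ, rfl, hf, hp⟩
    refine ⟨⟨ℓ, rfl, hf⟩, ?_⟩
    rw [potential_lumpSet hlam h.dual]
    linarith

theorem Inv.isActive_lumpSet_iff (hlam : 0 ≤ lam) {s : MoatState V} (h : sch.Inv s) (ℓ : L) :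
    X.rooted.IsActive lam s (X.lumpSet ℓ) ↔
      X.IsFree s ℓ ∧ min s.time (sch.y ℓ) < X.size ℓ * lam := by
  rw [h.isActive_iff hlam]
  constructor
  · rintro ⟨ℓ', he, hℓ⟩
    rwa [X.lumpSet_injective he]
  · exact fun hℓ => ⟨ℓ, rfl, hℓ⟩

theorem Inv.isFree_of_lt {s : MoatState V} (h : sch.Inv s) {ℓ : L} (hℓ : s.time < sch.y ℓ) :
    X.IsFree s ℓ := fun σ hσ hb => by
  have := sch.y_le_time ℓ σ (h.mem_buy σ hb) hσ
  have := h.time_le σ hb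
  linarith

theorem y_le_size (sch : Schedule X lam) (ℓ : L) : sch.y ℓ ≤ X.size ℓ * lam := by
  rcases sch.lump_cases ℓ with h | h
  · exact h.1.le
  · exact h.1.le

/-- A stopping node whose time has passed would be bought, so the lump would not be free. Time can
equal the final dual only between the moment when the stopping node goes tight and its purchase. -/
theorem Inv.lt_or_of_active {s : MoatState V} (h : sch.Inv s) {ℓ : L} (hf : X.IsFree s ℓ)
    (hm : min s.time (sch.y ℓ) < X.size ℓ * lam) :
    s.time < sch.y ℓ ∨ (s.time ≤ sch.y ℓ ∧ sch.y ℓ < X.size ℓ * lam) := by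
  rcases sch.lump_cases ℓ with ⟨hy, -⟩ | ⟨hy, σ, hσ, hi, hT⟩
  · left
    rw [← hy] at hm
    rcases min_lt_iff.1 hm with h | h
    · exact h
    · exact absurd h (lt_irrefl _)
  · right
    refine ⟨?_, hy⟩
    by_contra! hlt
    exact hf σ hi (h.bought_of_lt σ hσ (by rw [hT]; exact hlt))

open Classical in
theorem Inv.load_eq {s : MoatState V} (h : sch.Inv s) (σ : S) :
    X.rooted.load s.dual (X.st σ) = ∑ ℓ with X.inc ℓ σ, min s.time (sch.y ℓ) :=
  LumpGraph.load_eq h.dual σ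

open Classical in
theorem sum_min_lt_of_mem_buy (sch : Schedule X lam) {σ : S} (hσ : σ ∈ sch.Buy)
    (hp : lam < X.price σ) {t : ℝ} (ht : t < sch.time σ) :
    ∑ ℓ with X.inc ℓ σ, min t (sch.y ℓ) < X.price σ - min (X.price σ) lam := by
  rw [← sch.tight σ hσ]
  obtain ⟨ℓ, hi, hy, -⟩ := sch.exists_witness σ hσ hp
  refine Finset.sum_lt_sum (fun _ _ => min_le_right _ _) ⟨ℓ, by simpa using hi, ?_⟩
  exact lt_of_le_of_lt (min_le_left _ _) (hy ▸ ht)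

open Classical in
theorem sum_min_eq_of_mem_buy (sch : Schedule X lam) {σ : S} (hσ : σ ∈ sch.Buy) {t : ℝ}
    (ht : sch.time σ ≤ t) :
    ∑ ℓ with X.inc ℓ σ, min t (sch.y ℓ) = X.price σ - min (X.price σ) lam := by
  rw [← sch.tight σ hσ]
  refine Finset.sum_congr rfl fun ℓ hℓ => min_eq_right ?_
  exact (sch.y_le_time ℓ σ hσ (by simpa using hℓ)).trans ht

open Classical in
-- In the tie case of `load_lt`, an active moat has not passed its final dual and is not exhausted,
-- so the dominating lump at the node is still short of its own final dual. This is the place where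
-- deactivating before buying pays off.
theorem Inv.sum_min_lt_of_notMem_buy (hlam : 0 ≤ lam) {s : MoatState V} (h : sch.Inv s) {σ : S}
    (hσ : σ ∉ sch.Buy) (ha : ∃ M, X.rooted.IsActive lam s M) :
    ∑ ℓ with X.inc ℓ σ, min s.time (sch.y ℓ) < X.price σ - min (X.price σ) lam := by
  rcases sch.load_lt σ hσ with hlt | ⟨ℓ, hi, hdom⟩
  · exact lt_of_le_of_lt (Finset.sum_le_sum fun _ _ => min_le_right _ _) hlt
  · refine lt_of_lt_of_le ?_ (sch.load_le σ hσ)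
    obtain ⟨M, hM⟩ := ha
    obtain ⟨ℓ', rfl, hf, hm⟩ := (h.isActive_iff hlam M).1 hM
    refine Finset.sum_lt_sum (fun _ _ => min_le_right _ _) ⟨ℓ, by simpa using hi, ?_⟩
    refine lt_of_le_of_lt (min_le_left _ _) ?_
    rcases h.lt_or_of_active hf hm with h1 | ⟨h1, h2⟩ <;> rcases hdom ℓ' with h3 | ⟨h3, h4⟩ <;>
      linarith

/-- A node that goes tight while there is an active moat is bought at its scheduled time. -/
theorem Inv.of_isTight (hlam : 0 ≤ lam) {s : MoatState V} (h : sch.Inv s)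
    (ha : ∃ M, X.rooted.IsActive lam s M) {v : V} (hv : X.rooted.IsTight lam s v) :
    ∃ σ ∈ sch.Buy, v = X.st σ ∧ sch.time σ = s.time := by
  obtain ⟨hnb, hload⟩ := hv
  have : ∃ σ, v = X.st σ := by
    by_contra! hne
    exact hnb (h.base v hne)
  obtain ⟨σ, rfl⟩ := this
  rw [h.load_eq, reducedCost_st] at hload
  have hσ : σ ∈ sch.Buy := by
    by_contra hσ
    exact (h.sum_min_lt_of_notMem_buy hlam hσ ha).ne hload
  refine ⟨σ, hσ, rfl, le_antisymm ?_ ?_⟩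
  · by_contra! hlt
    have hp : lam < X.price σ := by
      by_contra! hp
      exact hnb (h.terminal σ hp)
    exact (sch.sum_min_lt_of_mem_buy hσ hp hlt).ne hload
  · by_contra! hlt
    exact hnb (h.bought_of_lt σ hσ hlt)

/-- Without tight nodes, a scheduled node that is not bought yet is bought strictly later. -/
theorem Inv.time_lt {s : MoatState V} (h : sch.Inv s) (htight : ∀ v, ¬ X.rooted.IsTight lam s v)
    {σ : S} (hσ : σ ∈ sch.Buy) (hnb : X.st σ ∉ s.bought) : s.time < sch.time σ := by
  by_contra! hle
  refine htight (X.st σ) ⟨hnb, ?_⟩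
  rw [h.load_eq, reducedCost_st]
  exact sch.sum_min_eq_of_mem_buy hσ hle

open Classical in
theorem Inv.raise_dualOn (hlam : 0 ≤ lam) {s : MoatState V} (h : sch.Inv s) (d : ℝ) :
    X.DualOn (X.rooted.raise lam s d) fun ℓ => min s.time (sch.y ℓ) +
      if X.IsFree s ℓ ∧ min s.time (sch.y ℓ) < X.size ℓ * lam then d else 0 := by
  constructor
  · intro ℓ
    unfold RootedGraph.raise
    by_cases hc : X.IsFree s ℓ ∧ min s.time (sch.y ℓ) < X.size ℓ * lam
    · rw [if_pos ((h.isActive_lumpSet_iff hlam ℓ).2 hc), h.dual.1 ℓ]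
      simp only [if_pos hc]
    · rw [if_neg (mt (h.isActive_lumpSet_iff hlam ℓ).1 hc), h.dual.1 ℓ]
      simp only [if_neg hc, add_zero]
  · intro A hA
    unfold RootedGraph.raise
    rw [if_neg, h.dual.2 A hA]
    intro hact
    obtain ⟨ℓ, he, -⟩ := (h.isActive_iff hlam A).1 hact
    exact hA ℓ he

/-- A grow step must not jump over a scheduled event. It cannot pass a buying time: all lumps at
that node would have at least their final duals and the witness strictly more, so the load would
exceed the reduced cost. It cannot pass an exhaustion because potentials stay nonnegative. -/
theorem Inv.grow (hlam : 0 ≤ lam) {s : MoatState V} (h : sch.Inv s) {d : ℝ} (hd : 0 < d)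
    (htight : ∀ v, ¬ X.rooted.IsTight lam s v)
    (hcost : ∀ v, v ∉ s.bought →
      X.rooted.load (X.rooted.raise lam s d) v ≤ X.rooted.reducedCost lam v)
    (hpen : ∀ M, X.rooted.IsActive lam s M →
      0 ≤ X.rooted.potential lam (X.rooted.raise lam s d) M) :
    sch.Inv { s with dual := X.rooted.raise lam s d, time := s.time + d } := by
  classical
  have hlater : ∀ σ ∈ sch.Buy, sch.time σ < s.time + d → X.st σ ∈ s.bought := by
    intro σ hσ hlt
    by_contra hnb
    have ht := h.time_lt htight hσ hnb
    have hp : lam < X.price σ := by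
      by_contra! hp
      exact hnb (h.terminal σ hp)
    have hc := hcost _ hnb
    rw [LumpGraph.load_eq (h.raise_dualOn hlam d), reducedCost_st, ← sch.tight σ hσ] at hc
    obtain ⟨ℓ₀, hi, hy, hsz, -⟩ := sch.exists_witness σ hσ hp
    refine absurd hc (not_le.2 (Finset.sum_lt_sum (fun ℓ hℓ => ?_) ⟨ℓ₀, by simpa using hi, ?_⟩))
    · have hyT := sch.y_le_time ℓ σ hσ (by simpa using hℓ)
      by_cases hlt' : s.time < sch.y ℓ
      · rw [if_pos ⟨h.isFree_of_lt hlt', lt_of_lt_of_le (by simpa using hlt') (sch.y_le_size ℓ)⟩,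
          min_eq_left hlt'.le]
        linarith
      · rw [min_eq_right (not_lt.1 hlt')]
        split_ifs <;> linarith
    · have hlt' : s.time < sch.y ℓ₀ := by rw [hy]; exact ht
      rw [if_pos ⟨h.isFree_of_lt hlt', lt_of_lt_of_le (by simpa using hlt') (sch.y_le_size ℓ₀)⟩,
        min_eq_left hlt'.le]
      linarith
  refine ⟨by have := h.time_nonneg; simp only; linarith, h.base, h.mem_buy,
    fun σ hσ => by have := h.time_le σ hσ; simp only; linarith, hlater, h.terminal, ?_, ?_⟩
  · have hr := h.raise_dualOn hlam d
    refine ⟨fun ℓ => ?_, hr.2⟩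
    refine (hr.1 ℓ).trans ?_
    simp only
    split_ifs with hact
    · obtain ⟨hf, hm⟩ := hact
      have hle : s.time ≤ sch.y ℓ := by
        rcases h.lt_or_of_active hf hm with h1 | h1
        · exact h1.le
        · exact h1.1
      have hle' : s.time + d ≤ sch.y ℓ := by
        rcases sch.lump_cases ℓ with ⟨hy, -⟩ | ⟨-, σ, hσ, hi, hT⟩
        · have := hpen _ ((h.isActive_lumpSet_iff hlam ℓ).2 ⟨hf, hm⟩)
          rw [potential_lumpSet hlam hr, if_pos ⟨hf, hm⟩, min_eq_left hle] at this
          linarith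
        · by_contra! hlt
          exact hf σ hi (hlater σ hσ (by rw [hT]; exact hlt))
      rw [min_eq_left hle, min_eq_left hle']
    · have hle : sch.y ℓ ≤ s.time := by
        by_contra! hlt
        exact hact ⟨h.isFree_of_lt hlt, lt_of_lt_of_le (by simpa using hlt) (sch.y_le_size ℓ)⟩
      rw [min_eq_right hle, min_eq_right (by linarith), add_zero]
  · intro v hv
    obtain ⟨ℓ, h1, h2, h3⟩ := h.mark v hv
    exact ⟨ℓ, h1, h2, by simp only; linarith⟩

theorem Inv.deactivate (hlam : 0 ≤ lam) {s : MoatState V} (h : sch.Inv s) {M : Finset V}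
    (hM : X.rooted.IsExhausted lam s M) : sch.Inv (X.rooted.markMoat lam s M) := by
  obtain ⟨hmoat, hr, hpot, -⟩ := hM
  obtain ⟨ℓ, rfl, hf⟩ := (X.isMoat_iff h.base M).1 ⟨hmoat, hr⟩
  rw [potential_lumpSet hlam h.dual] at hpot
  refine ⟨h.time_nonneg, h.base, h.mem_buy, h.time_le, h.bought_of_lt, h.terminal, h.dual, ?_⟩
  intro v hv
  simp only [RootedGraph.markMoat] at hv ⊢
  split_ifs at hv with hc
  · refine ⟨ℓ, X.mem_lumpSet.1 hc.1, ?_, ?_⟩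
    · refine le_antisymm (sch.y_le_size ℓ) ?_
      have := min_le_right s.time (sch.y ℓ)
      linarith
    · have := sch.y_le_size ℓ
      have := min_le_left s.time (sch.y ℓ)
      linarith
  · exact h.mark v hv

theorem Inv.buy (hlam : 0 ≤ lam) {s : MoatState V} (h : sch.Inv s)
    (ha : ∃ M, X.rooted.IsActive lam s M) {v : V} (hv : X.rooted.IsTight lam s v) :
    sch.Inv (RootedGraph.buyNode s v) := by
  obtain ⟨σ, hσ, rfl, hT⟩ := h.of_isTight hlam ha hv
  refine ⟨h.time_nonneg, fun w hw => List.mem_cons_of_mem _ (h.base w hw), fun τ hτ => ?_,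
    fun τ hτ => ?_, fun τ hτ hlt => List.mem_cons_of_mem _ (h.bought_of_lt τ hτ hlt),
    fun τ hτ => List.mem_cons_of_mem _ (h.terminal τ hτ), h.dual, h.mark⟩
  · rcases List.mem_cons.1 hτ with he | hτ
    · rw [X.st_injective he]; exact hσ
    · exact h.mem_buy τ hτ
  · rcases List.mem_cons.1 hτ with he | hτ
    · rw [X.st_injective he]; exact hT.le
    · exact h.time_le τ hτ

theorem Inv.step (hlam : 0 ≤ lam) {s s' : MoatState V} (h : sch.Inv s)
    (hs : X.rooted.GrowStep lam s s') : sch.Inv s' := by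
  cases hs with
  | deactivate M hM => exact h.deactivate hlam hM
  | buy v _ ha hv => exact h.buy hlam ha hv
  | grow d _ _ htight hd hcost hpen _ => exact h.grow hlam hd htight hcost hpen

theorem Inv.reach (hlam : 0 ≤ lam) {s s' : MoatState V} (h : sch.Inv s)
    (hs : Relation.ReflTransGen (X.rooted.GrowStep lam) s s') : sch.Inv s' := by
  induction hs with
  | refl => exact h
  | tail _ hs ih => exact ih.step hlam hs

/-- At the end of the GROW phase exactly the scheduled Steiner nodes are bought. -/
theorem Inv.bought_iff (hlam : 0 ≤ lam) {s : MoatState V} (h : sch.Inv s)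
    (hf : X.rooted.IsFinal lam s) (σ : S) : X.st σ ∈ s.bought ↔ σ ∈ sch.Buy := by
  refine ⟨h.mem_buy σ, fun hσ => ?_⟩
  by_contra hnb
  have hp : lam < X.price σ := by
    by_contra! hp
    exact hnb (h.terminal σ hp)
  have ht : s.time ≤ sch.time σ := by
    by_contra! hlt
    exact hnb (h.bought_of_lt σ hσ hlt)
  obtain ⟨ℓ, hi, hy, hsz, hw⟩ := sch.exists_witness σ hσ hp
  refine hf.2 (X.lumpSet ℓ) ((h.isActive_lumpSet_iff hlam ℓ).2 ⟨fun τ hτ hb => ?_, ?_⟩)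
  · by_cases hτσ : τ = σ
    · exact hnb (hτσ ▸ hb)
    · have := hw τ (h.mem_buy τ hb) hτ hτσ
      have := h.time_le τ hb
      linarith
  · exact lt_of_le_of_lt (min_le_right _ _) hsz

/-! ### Termination of the GROW phase -/

/-- As long as there are active moats, the dual variables can be raised until the next event. -/
theorem Inv.exists_grow (hlam : 0 ≤ lam) {s : MoatState V} (h : sch.Inv s)
    (hmark : ∀ M, ¬ X.rooted.IsExhausted lam s M) (ha : ∃ M, X.rooted.IsActive lam s M)
    (htight : ∀ v, ¬ X.rooted.IsTight lam s v) :
    ∃ s', X.rooted.GrowStep lam s s' ∧ s'.bought = s.bought ∧ s'.markTime = s.markTime ∧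
      ((∃ v, X.rooted.IsTight lam s' v) ∨ ∃ M, X.rooted.IsExhausted lam s' M) := by
  classical
  have hact : ∀ ℓ, (X.IsFree s ℓ ∧ min s.time (sch.y ℓ) < X.size ℓ * lam) ↔ s.time < sch.y ℓ := by
    intro ℓ
    constructor
    · rintro ⟨hf, hm⟩
      rcases h.lt_or_of_active hf hm with h1 | ⟨h1, h2⟩
      · exact h1
      · rcases sch.lump_cases ℓ with ⟨hy, -⟩ | ⟨-, σ, hσ, hi, hT⟩
        · exact absurd hy h2.ne
        · rw [← hT]
          exact h.time_lt htight hσ (hf σ hi)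
    · exact fun hlt => ⟨h.isFree_of_lt hlt,
        lt_of_lt_of_le (by simpa using hlt) (sch.y_le_size ℓ)⟩
  obtain ⟨ℓ₀, hℓ₀, hmin⟩ : ∃ ℓ₀, s.time < sch.y ℓ₀ ∧
      ∀ ℓ, s.time < sch.y ℓ → sch.y ℓ₀ ≤ sch.y ℓ := by
    obtain ⟨M, hM⟩ := ha
    obtain ⟨ℓ, rfl, hℓ⟩ := (h.isActive_iff hlam M).1 hM
    obtain ⟨ℓ₀, h1, h2⟩ := Finset.exists_min_image (Finset.univ.filter fun ℓ => s.time < sch.y ℓ)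
      sch.y ⟨ℓ, by simpa using (hact ℓ).1 hℓ⟩
    exact ⟨ℓ₀, by simpa using h1, fun ℓ' hℓ' => h2 ℓ' (by simpa using hℓ')⟩
  -- The next event happens when the first of the still growing lumps reaches its final dual.
  set d := sch.y ℓ₀ - s.time with hd
  have hdpos : 0 < d := by rw [hd]; linarith
  have hr : X.DualOn (X.rooted.raise lam s d) fun ℓ => min (sch.y ℓ₀) (sch.y ℓ) := by
    have hr := h.raise_dualOn hlam d
    refine ⟨fun ℓ => ?_, hr.2⟩
    rw [hr.1 ℓ]
    simp only [hact]
    split_ifs with hlt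
    · rw [min_eq_left hlt.le, min_eq_left (hmin ℓ hlt), hd]; ring
    · rw [min_eq_right (not_lt.1 hlt), min_eq_right (by linarith), add_zero]
  have hcost : ∀ v, v ∉ s.bought →
      X.rooted.load (X.rooted.raise lam s d) v ≤ X.rooted.reducedCost lam v := by
    intro v hv
    have : ∃ σ, v = X.st σ := by
      by_contra! hne
      exact hv (h.base v hne)
    obtain ⟨σ, rfl⟩ := this
    rw [LumpGraph.load_eq hr, reducedCost_st]
    refine (Finset.sum_le_sum fun ℓ _ => min_le_right _ _).trans ?_
    by_cases hσ : σ ∈ sch.Buy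
    · exact (sch.tight σ hσ).le
    · exact sch.load_le σ hσ
  have hpen : ∀ M, X.rooted.IsActive lam s M →
      0 ≤ X.rooted.potential lam (X.rooted.raise lam s d) M := by
    intro M hM
    obtain ⟨ℓ, rfl, -⟩ := (h.isActive_iff hlam M).1 hM
    rw [potential_lumpSet hlam hr]
    have := min_le_right (sch.y ℓ₀) (sch.y ℓ)
    have := sch.y_le_size ℓ
    linarith
  have hfree := h.isFree_of_lt hℓ₀
  have hactive : X.rooted.IsActive lam s (X.lumpSet ℓ₀) :=
    (h.isActive_lumpSet_iff hlam ℓ₀).2 ((hact ℓ₀).2 hℓ₀)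
  rcases sch.lump_cases ℓ₀ with ⟨hy, -⟩ | ⟨-, σ, hσ, hi, hT⟩
  · have hpot : X.rooted.potential lam (X.rooted.raise lam s d) (X.lumpSet ℓ₀) = 0 := by
      rw [potential_lumpSet hlam hr, min_self, hy, sub_self]
    refine ⟨_, .grow s d hmark ha htight hdpos hcost hpen (Or.inr ⟨_, hactive, hpot⟩), rfl, rfl,
      Or.inr ⟨X.lumpSet ℓ₀, hactive.1, hactive.2.1, hpot, ?_⟩⟩
    obtain ⟨v, hv⟩ := X.lumpSet_nonempty ℓ₀
    refine ⟨v, hv, X.isTerminal_lump hlam (X.mem_lumpSet.1 hv), ?_⟩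
    by_contra hne
    obtain ⟨ℓ, h1, -, h3⟩ := h.mark v hne
    rw [X.mem_lumpSet.1 hv] at h1
    cases h1
    linarith
  · have hnb := hfree σ hi
    have hload : X.rooted.load (X.rooted.raise lam s d) (X.st σ) =
        X.rooted.reducedCost lam (X.st σ) := by
      rw [LumpGraph.load_eq hr, reducedCost_st]
      exact sch.sum_min_eq_of_mem_buy hσ hT.le
    exact ⟨_, .grow s d hmark ha htight hdpos hcost hpen (Or.inl ⟨_, hnb, hload⟩), rfl, rfl,
      Or.inl ⟨_, hnb, hload⟩⟩

open Classical in
/-- The number of nodes that are not bought plus the number of nodes that are not marked. -/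
noncomputable def _root_.MoatState.rest (s : MoatState V) : ℕ :=
  (Finset.univ.filter fun v => v ∉ s.bought).card +
    (Finset.univ.filter fun v => s.markTime v = none).card

theorem rest_buyNode_lt (s : MoatState V) {v : V} (hv : v ∉ s.bought) :
    (RootedGraph.buyNode s v).rest < s.rest := by
  classical
  refine Nat.add_lt_add_right (Finset.card_lt_card ?_) _
  refine (Finset.ssubset_iff_of_subset fun w hw => ?_).2 ⟨v, by simpa using hv, ?_⟩
  · simp only [RootedGraph.buyNode, Finset.mem_filter, List.mem_cons, not_or] at hw ⊢
    exact ⟨hw.1, hw.2.2⟩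
  · simp [RootedGraph.buyNode]

theorem rest_markMoat_lt (I : RootedGraph V) (s : MoatState V) {M : Finset V}
    (hM : I.IsExhausted lam s M) : (I.markMoat lam s M).rest < s.rest := by
  classical
  obtain ⟨-, -, -, v, hv, ht, hm⟩ := hM
  refine Nat.add_lt_add_left (Finset.card_lt_card ?_) _
  refine (Finset.ssubset_iff_of_subset fun w hw => ?_).2 ⟨v, by simpa using hm, ?_⟩
  · have hw' := (Finset.mem_filter.1 hw).2
    simp only [RootedGraph.markMoat] at hw'
    split_ifs at hw'
    exact Finset.mem_filter.2 ⟨Finset.mem_univ _, hw'⟩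
  · intro hv'
    have hv' := (Finset.mem_filter.1 hv').2
    simp [RootedGraph.markMoat, hv, ht, hm] at hv'

/-- Buying and marking decrease `rest`, raising the duals leaves it unchanged. But a raise ends with
an event, so a purchase or a marking follows unless the phase is over. -/
theorem Inv.exists_final (hlam : 0 ≤ lam) {s : MoatState V} (h : sch.Inv s) :
    ∃ s', Relation.ReflTransGen (X.rooted.GrowStep lam) s s' ∧ X.rooted.IsFinal lam s' := by
  have main : ∀ n, ∀ s : MoatState V, sch.Inv s → s.rest = n →
      ∃ s', Relation.ReflTransGen (X.rooted.GrowStep lam) s s' ∧ X.rooted.IsFinal lam s' := by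
    intro n
    induction n using Nat.strong_induction_on with
    | _ n ih =>
    have easy : ∀ s : MoatState V, sch.Inv s → s.rest = n → (∃ M, X.rooted.IsActive lam s M) →
        ((∃ v, X.rooted.IsTight lam s v) ∨ ∃ M, X.rooted.IsExhausted lam s M) →
        ∃ s', Relation.ReflTransGen (X.rooted.GrowStep lam) s s' ∧ X.rooted.IsFinal lam s' := by
      intro s h hn ha hev
      by_cases hex : ∃ M, X.rooted.IsExhausted lam s M
      · obtain ⟨M, hM⟩ := hex
        obtain ⟨s', h1, h2⟩ := ih _ (hn ▸ rest_markMoat_lt _ s hM) _ (h.deactivate hlam hM) rfl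
        exact ⟨s', .head (.deactivate s M hM) h1, h2⟩
      · obtain ⟨v, hv⟩ := hev.resolve_right hex
        obtain ⟨s', h1, h2⟩ := ih _ (hn ▸ rest_buyNode_lt s hv.1) _ (h.buy hlam ha hv) rfl
        exact ⟨s', .head (.buy s v (fun M hM => hex ⟨M, hM⟩) ha hv) h1, h2⟩
    intro s h hn
    by_cases hex : ∃ M, X.rooted.IsExhausted lam s M
    · obtain ⟨M, hM⟩ := hex
      obtain ⟨s', h1, h2⟩ := ih _ (hn ▸ rest_markMoat_lt _ s hM) _ (h.deactivate hlam hM) rfl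
      exact ⟨s', .head (.deactivate s M hM) h1, h2⟩
    push Not at hex
    by_cases ha : ∃ M, X.rooted.IsActive lam s M
    · by_cases ht : ∃ v, X.rooted.IsTight lam s v
      · exact easy s h hn ha (Or.inl ht)
      · push Not at ht
        obtain ⟨s₁, hs, hb, hm, hev⟩ := h.exists_grow hlam hex ha ht
        have h₁ := h.step hlam hs
        have hn₁ : s₁.rest = n := by rw [← hn]; unfold MoatState.rest; rw [hb, hm]
        by_cases ha₁ : ∃ M, X.rooted.IsActive lam s₁ M
        · obtain ⟨s', h1, h2⟩ := easy s₁ h₁ hn₁ ha₁ hev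
          exact ⟨s', .head hs h1, h2⟩
        · by_cases hex₁ : ∃ M, X.rooted.IsExhausted lam s₁ M
          · obtain ⟨M, hM⟩ := hex₁
            obtain ⟨s', h1, h2⟩ :=
              ih _ (hn₁ ▸ rest_markMoat_lt _ s₁ hM) _ (h₁.deactivate hlam hM) rfl
            exact ⟨s', .head hs (.head (.deactivate s₁ M hM) h1), h2⟩
          · push Not at ha₁ hex₁
            exact ⟨s₁, .single hs, hex₁, ha₁⟩
    · push Not at ha
      exact ⟨s, .refl, hex, ha⟩
  exact main _ s h rfl

end Schedule

end LumpGraph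

/-! ### The pruning phase -/

section prune

open Classical in
/-- The result of the pruning phase does not depend on the order in which nodes were bought if a
set `K` of nodes is connected and contains the terminals that are connected to the root, and if
each of its nodes separates an unmarked terminal from the root. -/
theorem RootedGraph.prune_eq {V : Type*} {I : RootedGraph V} {lam : ℝ} {s : MoatState V}
    {K : Finset V} (hsub : K ⊆ s.bought.toFinset) (hroot : I.root ∈ K)
    (hconn : ∀ u ∈ K, I.ConnectedToRoot K u)
    (hterm : ∀ u ∈ s.bought, I.IsTerminal lam u → I.ConnectedToRoot s.bought.toFinset u → u ∈ K)
    (hneed : ∀ v ∈ K, v ≠ I.root → ∃ u ∈ K, I.IsTerminal lam u ∧ s.markTime u = none ∧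
      ¬ I.ConnectedToRoot (s.bought.toFinset.erase v) u) :
    I.prune lam s = K := by
  -- While `K` survives, a node of `K` is kept because of its unmarked terminal, and any other node
  -- is deleted because `K` alone connects all terminals that are connected to the root at all.
  have step : ∀ F v, K ⊆ F → F ⊆ s.bought.toFinset →
      I.pruneNode lam s F v = if v ∈ K then F else F.erase v := by
    intro F v hKF hF
    unfold RootedGraph.pruneNode
    by_cases hv : v ∈ K
    · rw [if_pos hv, if_neg]
      rintro ⟨hne, hall⟩
      obtain ⟨u, hu, ht, hm, hc⟩ := hneed v hv hne
      refine hc (LumpGraph.connectedToRoot_mono (Finset.erase_subset_erase v hF)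
        (hall u (hKF hu) ht (Or.inl hm) ?_))
      exact LumpGraph.connectedToRoot_mono hKF (hconn u hu)
    · rw [if_neg hv, if_pos]
      refine ⟨fun he => hv (he ▸ hroot), fun u hu ht _ hc => ?_⟩
      have huK := hterm u (by simpa using hF hu) ht (LumpGraph.connectedToRoot_mono hF hc)
      refine LumpGraph.connectedToRoot_mono (fun w hw => ?_) (hconn u huK)
      exact Finset.mem_erase.2 ⟨fun he => hv (he ▸ hw), hKF hw⟩
  have main : ∀ (l : List V) (F : Finset V), K ⊆ F → F ⊆ s.bought.toFinset →
      l.foldl (I.pruneNode lam s) F = F.filter fun v => v ∈ K ∨ v ∉ l := by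
    intro l
    induction l with
    | nil => intro F _ _; simp
    | cons v l ih =>
      intro F hKF hF
      rw [List.foldl_cons, step F v hKF hF]
      by_cases hv : v ∈ K
      · rw [if_pos hv, ih F hKF hF]
        refine Finset.filter_congr fun w _ => ?_
        by_cases hw : w = v
        · simp [hw, hv]
        · simp [hw]
      · rw [if_neg hv, ih (F.erase v) (fun w hw =>
          Finset.mem_erase.2 ⟨fun he => hv (he ▸ hw), hKF hw⟩) ((Finset.erase_subset _ _).trans hF)]
        ext w
        by_cases hw : w = v
        · simp [hw, hv]
        · simp [hw]
  unfold RootedGraph.prune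
  have := main s.bought s.bought.toFinset hsub (Finset.Subset.refl _)
  convert this using 1
  ext w
  simp only [Finset.mem_filter, List.mem_toFinset]
  constructor
  · exact fun hw => ⟨by simpa using hsub hw, Or.inl hw⟩
  · rintro ⟨hw, h | h⟩
    · exact h
    · exact absurd hw h

end prune

namespace LumpGraph

variable {V L S : Type*} [Fintype V]

open Classical in
/-- The root, the Steiner nodes in `R` and the lumps that are incident to them. -/
noncomputable def span (X : LumpGraph V L S) (R : Finset S) : Finset V :=
  Finset.univ.filter fun v => v = X.rt ∨ (∃ σ ∈ R, v = X.st σ) ∨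
    ∃ ℓ, X.cls v = .lump ℓ ∧ ∃ σ ∈ R, X.inc ℓ σ

variable (X : LumpGraph V L S)

theorem rt_mem_span (R : Finset S) : X.rt ∈ X.span R := by simp [span]

theorem st_mem_span {R : Finset S} {σ : S} : X.st σ ∈ X.span R ↔ σ ∈ R := by
  simp only [span, Finset.mem_filter, Finset.mem_univ, true_and, X.st_ne_rt, false_or, cls_st,
    reduceCtorEq, false_and, exists_false, or_false]
  constructor
  · rintro ⟨τ, hτ, he⟩
    rwa [X.st_injective he]
  · exact fun h => ⟨σ, h, rfl⟩

theorem lump_mem_span {R : Finset S} {v : V} {ℓ : L} (hv : X.cls v = .lump ℓ) :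
    v ∈ X.span R ↔ ∃ σ ∈ R, X.inc ℓ σ := by
  have h1 : v ≠ X.rt := by rintro rfl; simp at hv
  have h2 : ∀ σ, v ≠ X.st σ := by rintro σ rfl; simp at hv
  simp only [span, Finset.mem_filter, Finset.mem_univ, true_and, h1, h2, and_false, exists_false,
    false_or, hv, NodeClass.lump.injEq, exists_eq_left']

theorem connectedToRoot_span {R : Finset S} {v : V} (hv : v ∈ X.span R) :
    X.rooted.ConnectedToRoot (X.span R) v := by
  rcases X.node_cases v with rfl | ⟨ℓ, hℓ⟩ | ⟨σ, rfl⟩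
  · exact X.connectedToRoot_rt hv
  · obtain ⟨σ, hσ, hi⟩ := (X.lump_mem_span hℓ).1 hv
    exact X.connectedToRoot_lump (X.rt_mem_span R) hv hℓ (X.st_mem_span.2 hσ) hi
  · exact X.connectedToRoot_st (X.rt_mem_span R) hv

theorem isSolution_span (R : Finset S) : X.rooted.IsSolution (X.span R) :=
  isSolution_iff.2 ⟨X.rt_mem_span R, fun _ hv => X.connectedToRoot_span hv⟩

namespace Schedule

variable {X} [Fintype L] {lam : ℝ} (sch : Schedule X lam)

/-- The scheduled nodes that survive the pruning phase. -/
structure IsKept (R : Finset S) : Prop where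
  subset : R ⊆ sch.Buy
  terminal : ∀ σ, X.price σ ≤ lam → σ ∈ R
  cover : ∀ ℓ, ∀ σ ∈ sch.Buy, X.inc ℓ σ → ∃ τ ∈ R, X.inc ℓ τ
  needed : ∀ σ ∈ R, lam < X.price σ → ∃ ℓ, X.inc ℓ σ ∧ ∀ τ ∈ sch.Buy, X.inc ℓ τ → τ = σ

variable {sch}

/-- A kept terminal is needed for its own sake; any other kept Steiner node is needed by a lump that
no other bought node touches. Nothing in the span is marked, because marked lumps are exhausted and
touched by no bought node. -/
theorem Inv.prune_eq (hlam : 0 ≤ lam) {s : MoatState V} (h : sch.Inv s)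
    (hf : X.rooted.IsFinal lam s) {R : Finset S} (hR : sch.IsKept R) :
    X.rooted.prune lam s = X.span R := by
  classical
  have hb := h.bought_iff hlam hf
  have hlump : ∀ v ℓ, X.cls v = .lump ℓ → v ∈ s.bought := fun v ℓ hv => h.base v fun σ he => by
    subst he; simp at hv
  have hunmarked : ∀ v ∈ X.span R, s.markTime v = none := by
    intro v hv
    by_contra hne
    obtain ⟨ℓ, hℓ, hy, -⟩ := h.mark v hne
    obtain ⟨σ, hσ, hi⟩ := (X.lump_mem_span hℓ).1 hv
    rcases sch.lump_cases ℓ with ⟨-, h1⟩ | ⟨h1, -⟩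
    · exact h1 σ (hR.subset hσ) hi
    · exact h1.ne hy
  have hself : ∀ v ∈ X.span R, X.rooted.IsTerminal lam v →
      ∃ u ∈ X.span R, X.rooted.IsTerminal lam u ∧ s.markTime u = none ∧
        ¬ X.rooted.ConnectedToRoot (s.bought.toFinset.erase v) u := fun v hv ht =>
    ⟨v, hv, ht, hunmarked v hv, fun hc => by simpa using connectedToRoot_mem hc⟩
  refine RootedGraph.prune_eq (fun v hv => ?_) (X.rt_mem_span R)
    (fun u hu => X.connectedToRoot_span hu) (fun u hu ht hc => ?_) (fun v hv hne => ?_)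
  · rw [List.mem_toFinset]
    rcases X.node_cases v with rfl | ⟨ℓ, hℓ⟩ | ⟨σ, rfl⟩
    · exact h.base _ fun σ he => X.st_ne_rt σ he.symm
    · exact hlump v ℓ hℓ
    · exact (hb σ).2 (hR.subset (X.st_mem_span.1 hv))
  · rcases X.node_cases u with rfl | ⟨ℓ, hℓ⟩ | ⟨σ, rfl⟩
    · exact X.rt_mem_span R
    · obtain ⟨σ, hi, hσ⟩ := X.exists_steiner_of_connectedToRoot hℓ hc
      exact (X.lump_mem_span hℓ).2 (hR.cover ℓ σ ((hb σ).1 (by simpa using hσ)) hi)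
    · exact X.st_mem_span.2 (hR.terminal σ ((X.isTerminal_st σ).1 ht))
  · rcases X.node_cases v with rfl | ⟨ℓ, hℓ⟩ | ⟨σ, rfl⟩
    · exact absurd rfl hne
    · exact hself v hv (X.isTerminal_lump hlam hℓ)
    · by_cases hp : X.price σ ≤ lam
      · exact hself _ hv ((X.isTerminal_st σ).2 hp)
      · have hσ := X.st_mem_span.1 hv
        obtain ⟨ℓ, hi, hℓ⟩ := hR.needed σ hσ (not_le.1 hp)
        obtain ⟨u, hu⟩ := X.exists_lump ℓ
        have huR := (X.lump_mem_span hu).2 ⟨σ, hσ, hi⟩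
        refine ⟨u, huR, X.isTerminal_lump hlam hu, hunmarked u huR, fun hc => ?_⟩
        obtain ⟨τ, hτi, hτ⟩ := X.exists_steiner_of_connectedToRoot hu hc
        rw [Finset.mem_erase, List.mem_toFinset, hb] at hτ
        exact hτ.1 (by rw [hℓ τ hτ.2 hτi])

/-- On a lump graph with a schedule the algorithm has exactly one output. -/
theorem returns_iff (hlam : 0 ≤ lam) {R : Finset S} (hR : sch.IsKept R) (T : Finset V) :
    X.rooted.Returns lam T ↔ T = X.span R := by
  classical
  constructor
  · rintro ⟨s₀, s, hi, hs, hf, rfl⟩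
    exact ((Inv.of_isInitial (sch := sch) hlam hi).reach hlam hs).prune_eq hlam hf hR
  · rintro rfl
    let s₀ : MoatState V :=
      { bought := (Finset.univ.filter fun v => v = X.rooted.root ∨ X.rooted.IsTerminal lam v).toList
        buyTime := fun _ => 0
        markTime := fun _ => none
        dual := fun _ => 0
        time := 0 }
    have hi : X.rooted.IsInitial lam s₀ :=
      ⟨Finset.nodup_toList _, fun v => by
        rw [Finset.mem_toList, Finset.mem_filter, and_iff_right (Finset.mem_univ v)],
        rfl, rfl, rfl, rfl⟩
    have h₀ := Inv.of_isInitial (sch := sch) hlam hi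
    obtain ⟨s, hs, hf⟩ := h₀.exists_final hlam
    exact ⟨s₀, s, hi, hs, hf, ((h₀.reach hlam hs).prune_eq hlam hf hR).symm⟩

end Schedule

/-! ### Sizes and costs -/

theorem sum_univ_eq {V L S : Type*} [Fintype V] [Fintype L] [Fintype S] (X : LumpGraph V L S)
    {A : Type*} [AddCommMonoid A] (f : V → A) :
    ∑ v, f v = f X.rt + ∑ σ, f (X.st σ) + ∑ ℓ, ∑ v ∈ X.lumpSet ℓ, f v := by
  classical
  have huniv : (Finset.univ : Finset V) =
      ({X.rt} ∪ Finset.univ.image X.st) ∪ Finset.univ.biUnion X.lumpSet := by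
    ext v
    rcases X.node_cases v with rfl | ⟨ℓ, hℓ⟩ | ⟨σ, rfl⟩
    · simp
    · simp [hℓ]
    · simp
  rw [huniv, Finset.sum_union, Finset.sum_union, Finset.sum_singleton,
    Finset.sum_image fun a _ b _ hab => X.st_injective hab, Finset.sum_biUnion]
  · intro ℓ _ ℓ' _ hne
    refine Finset.disjoint_left.2 fun v h1 h2 => hne ?_
    rw [mem_lumpSet] at h1 h2
    rw [h1] at h2
    cases h2; rfl
  · refine Finset.disjoint_left.2 fun v h1 h2 => ?_
    obtain ⟨σ, -, rfl⟩ := Finset.mem_image.1 h2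
    exact X.st_ne_rt σ (Finset.mem_singleton.1 h1)
  · refine Finset.disjoint_left.2 fun v h1 h2 => ?_
    obtain ⟨ℓ, -, h2⟩ := Finset.mem_biUnion.1 h2
    rw [mem_lumpSet] at h2
    rcases Finset.mem_union.1 h1 with h1 | h1
    · rw [Finset.mem_singleton.1 h1] at h2; simp at h2
    · obtain ⟨σ, -, rfl⟩ := Finset.mem_image.1 h1
      simp at h2

open Classical in
theorem sum_eq {V L S : Type*} [Fintype V] [Fintype L] [Fintype S] (X : LumpGraph V L S)
    {A : Type*} [AddCommMonoid A] (T : Finset V) (f : V → A) :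
    ∑ v ∈ T, f v = (if X.rt ∈ T then f X.rt else 0) + (∑ σ with X.st σ ∈ T, f (X.st σ)) +
      ∑ ℓ, ∑ v ∈ X.lumpSet ℓ, if v ∈ T then f v else 0 := by
  have h1 : ∑ v ∈ T, f v = ∑ v, if v ∈ T then f v else 0 := by
    rw [← Finset.sum_filter]; simp
  rw [h1, X.sum_univ_eq, Finset.sum_filter]

variable [Fintype L] [Fintype S]

open Classical in
theorem totalCost_eq (T : Finset V) : X.rooted.totalCost T = ∑ σ with X.st σ ∈ T, X.price σ := by
  unfold RootedGraph.totalCost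
  rw [X.sum_eq]
  have h : ∀ ℓ, ∑ v ∈ X.lumpSet ℓ, (if v ∈ T then X.rooted.cost v else 0) = 0 := fun ℓ =>
    Finset.sum_eq_zero fun v hv => by
      rw [X.cost_lump (X.mem_lumpSet.1 hv), ite_self]
  simp [h]

theorem totalCost_span (R : Finset S) : X.rooted.totalCost (X.span R) = ∑ σ ∈ R, X.price σ := by
  classical
  rw [totalCost_eq]
  refine Finset.sum_congr ?_ fun _ _ => rfl
  ext σ
  simp [X.st_mem_span]

open Classical in
theorem card_span (R : Finset S) : (X.span R).card =
    1 + R.card + ∑ ℓ with (∃ σ ∈ R, X.inc ℓ σ), (X.lumpSet ℓ).card := by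
  rw [Finset.card_eq_sum_ones, X.sum_eq, if_pos (X.rt_mem_span R)]
  congr 1
  · rw [← Finset.card_eq_sum_ones]
    congr 2
    ext σ
    simp [X.st_mem_span]
  · rw [Finset.sum_filter]
    refine Finset.sum_congr rfl fun ℓ _ => ?_
    have hmem := fun v (hv : v ∈ X.lumpSet ℓ) =>
      X.lump_mem_span (R := R) (X.mem_lumpSet.1 hv)
    split_ifs with hq
    · rw [Finset.card_eq_sum_ones]
      exact Finset.sum_congr rfl fun v hv => if_pos ((hmem v hv).2 hq)
    · exact Finset.sum_eq_zero fun v hv => if_neg (mt (hmem v hv).1 hq)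

theorem card_univ_eq : Fintype.card V = 1 + Fintype.card S + ∑ ℓ, (X.lumpSet ℓ).card := by
  rw [← Finset.card_univ, Finset.card_eq_sum_ones, X.sum_univ_eq]
  simp

open Classical in
/-- Weak duality for NW-PC-ST. -/
theorem dual_le {lam : ℝ} {y : L → ℝ} (hy : ∀ ℓ, 0 ≤ y ℓ)
    (hsize : ∀ ℓ, y ℓ ≤ X.size ℓ * lam)
    (hload : ∀ σ, ∑ ℓ with X.inc ℓ σ, y ℓ ≤ X.price σ - min (X.price σ) lam) {T : Finset V}
    (hT : X.rooted.IsSolution T) :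
    ∑ ℓ, y ℓ + ∑ σ, min (X.price σ) lam ≤
      X.rooted.totalCost T + lam * ((Fintype.card V : ℝ) - T.card) := by
  obtain ⟨hr, hconn⟩ := isSolution_iff.1 hT
  have hrhs : X.rooted.totalCost T + lam * ((Fintype.card V : ℝ) - T.card) =
      ∑ σ, (if X.st σ ∈ T then X.price σ else lam) +
        ∑ ℓ, ∑ v ∈ X.lumpSet ℓ, if v ∈ T then 0 else lam := by
    have h1 : lam * ((Fintype.card V : ℝ) - T.card) = ∑ v, if v ∈ T then 0 else lam := by
      have h2 : ((Fintype.card V : ℝ) - T.card) = (Tᶜ).card := by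
        rw [Finset.card_compl, Nat.cast_sub (Finset.card_le_univ T)]
      have h3 : (Finset.univ.filter fun v => v ∉ T) = Tᶜ := by ext; simp
      rw [h2, ← h3, mul_comm, ← nsmul_eq_mul, ← Finset.sum_const, Finset.sum_filter]
      exact Finset.sum_congr rfl fun v _ => by by_cases hv : v ∈ T <;> simp [hv]
    rw [h1, X.totalCost_eq, X.sum_univ_eq, Finset.sum_filter, ← add_assoc]
    congr 1
    rw [if_pos (show X.rt ∈ T from hr), zero_add, ← Finset.sum_add_distrib]
    exact Finset.sum_congr rfl fun σ _ => by by_cases hσ : X.st σ ∈ T <;> simp [hσ]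
  rw [hrhs]
  -- A lump met by `T` reaches the root through an incident Steiner node of `T`, whose price pays
  -- its dual; a missed lump pays with its penalties.
  have hlump : ∀ ℓ, y ℓ ≤ (∑ σ, if X.st σ ∈ T ∧ X.inc ℓ σ then y ℓ else 0) +
      ∑ v ∈ X.lumpSet ℓ, (if v ∈ T then 0 else lam) := by
    intro ℓ
    have hnn : 0 ≤ lam := by
      have h1 := (hy ℓ).trans (hsize ℓ)
      have h2 := X.size_pos ℓ
      by_contra! h3
      nlinarith
    by_cases hex : ∃ v ∈ X.lumpSet ℓ, v ∈ T
    · obtain ⟨v, hv, hvT⟩ := hex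
      obtain ⟨σ, hi, hσ⟩ :=
        X.exists_steiner_of_connectedToRoot (X.mem_lumpSet.1 hv) (hconn v hvT)
      have h1 : y ℓ ≤ ∑ σ, if X.st σ ∈ T ∧ X.inc ℓ σ then y ℓ else 0 := by
        refine le_trans ?_ (Finset.single_le_sum (f := fun σ => if X.st σ ∈ T ∧ X.inc ℓ σ then y ℓ
          else 0) (fun τ _ => ?_) (Finset.mem_univ σ))
        · simp [hσ, hi]
        · split_ifs
          · exact hy ℓ
          · exact le_refl _
      have h2 : 0 ≤ ∑ v ∈ X.lumpSet ℓ, (if v ∈ T then 0 else lam) :=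
        Finset.sum_nonneg fun v _ => by split_ifs <;> simp [hnn]
      linarith
    · push Not at hex
      have h1 : ∑ v ∈ X.lumpSet ℓ, (if v ∈ T then 0 else lam) = X.size ℓ * lam := by
        rw [Finset.sum_congr rfl fun v hv => if_neg (hex v hv)]
        simp [size]
      have h2 : 0 ≤ ∑ σ, if X.st σ ∈ T ∧ X.inc ℓ σ then y ℓ else 0 :=
        Finset.sum_nonneg fun σ _ => by split_ifs <;> simp [hy]
      rw [h1]
      linarith [hsize ℓ]
  have hsum := Finset.sum_le_sum fun ℓ (_ : ℓ ∈ Finset.univ) => hlump ℓ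
  rw [Finset.sum_add_distrib, Finset.sum_comm] at hsum
  have hst : (∑ σ, ∑ ℓ, if X.st σ ∈ T ∧ X.inc ℓ σ then y ℓ else 0) +
      ∑ σ, min (X.price σ) lam ≤ ∑ σ, (if X.st σ ∈ T then X.price σ else lam) := by
    rw [← Finset.sum_add_distrib]
    refine Finset.sum_le_sum fun σ _ => ?_
    by_cases hσ : X.st σ ∈ T
    · have := hload σ
      rw [Finset.sum_filter] at this
      simp only [hσ, true_and, if_true]
      linarith
    · simp [hσ]
  linarith

/-- The ratio of the output of a schedule, in terms of its dual variables. -/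
theorem Schedule.ratio {X : LumpGraph V L S} {lam r : ℝ} (hr : 0 ≤ r) (sch : Schedule X lam)
    {R : Finset S} (hR : sch.IsKept R) {z : ℝ}
    (hz : ∀ q : L → Prop, [DecidablePred q] → (∀ ℓ, q ℓ ↔ ∃ σ ∈ R, X.inc ℓ σ) →
      z ≤ ∑ ℓ with q ℓ, sch.y ℓ)
    (hcost : ∑ σ ∈ R, (X.price σ - r * min (X.price σ) lam) ≤ r * z) {T : Finset V}
    (hT : X.rooted.IsSolution T) :
    X.rooted.totalCost (X.span R) + r * (lam * ((Fintype.card V : ℝ) - (X.span R).card)) ≤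
      r * (X.rooted.totalCost T + lam * ((Fintype.card V : ℝ) - T.card)) := by
  classical
  have hdual := X.dual_le sch.y_nonneg sch.y_le_size (fun σ => by
    by_cases hσ : σ ∈ sch.Buy
    · exact (sch.tight σ hσ).le
    · exact sch.load_le σ hσ) hT
  refine le_trans ?_ (mul_le_mul_of_nonneg_left hdual hr)
  have hz' := hz (fun ℓ => ∃ σ ∈ R, X.inc ℓ σ) fun _ => Iff.rfl
  have hy := Finset.sum_filter_add_sum_filter_not Finset.univ (fun ℓ => ∃ σ ∈ R, X.inc ℓ σ) sch.y
  -- Lumps outside the span are exhausted, so their duals equal their penalties; this allows the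
  -- factor `r` in front of the penalty of the output.
  have hy' : ∑ ℓ with ¬ ∃ σ ∈ R, X.inc ℓ σ, sch.y ℓ =
      (∑ ℓ with ¬ ∃ σ ∈ R, X.inc ℓ σ, X.size ℓ) * lam := by
    rw [Finset.sum_mul]
    refine Finset.sum_congr rfl fun ℓ hℓ => ?_
    rcases sch.lump_cases ℓ with ⟨h, -⟩ | ⟨-, σ, hσ, hi, -⟩
    · exact h
    · exact absurd (hR.cover ℓ σ hσ hi) (Finset.mem_filter.1 hℓ).2
  have hn : ((Fintype.card V : ℝ) - (X.span R).card) =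
      (Rᶜ.card : ℝ) + ∑ ℓ with ¬ ∃ σ ∈ R, X.inc ℓ σ, X.size ℓ := by
    rw [X.card_univ_eq, X.card_span, Finset.card_compl]
    have h1 := Finset.sum_filter_add_sum_filter_not Finset.univ (fun ℓ => ∃ σ ∈ R, X.inc ℓ σ)
      X.size
    have h2 : R.card ≤ Fintype.card S := Finset.card_le_univ R
    push_cast [Nat.cast_sub h2]
    unfold size at h1 ⊢
    linarith
  have hmin : ∑ σ, min (X.price σ) lam = ∑ σ ∈ R, min (X.price σ) lam + Rᶜ.card * lam := by
    rw [← Finset.sum_add_sum_compl R]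
    congr 1
    rw [← nsmul_eq_mul, ← Finset.sum_const]
    refine Finset.sum_congr rfl fun σ hσ => min_eq_right ?_
    by_contra! hlt
    exact Finset.mem_compl.1 hσ (hR.terminal σ hlt.le)
  rw [Finset.sum_sub_distrib, ← Finset.mul_sum] at hcost
  rw [X.totalCost_span, hn, hmin, ← hy, hy']
  nlinarith [mul_le_mul_of_nonneg_left hz' hr]

open Classical in
/-- A dual lower bound for the cost of node sets that meet all lumps in the support of `w`. -/
theorem sum_le_totalCost {w : L → ℝ} (hw : ∀ ℓ, 0 ≤ w ℓ)
    (hload : ∀ σ, ∑ ℓ with X.inc ℓ σ, w ℓ ≤ X.price σ) {T : Finset V}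
    (hmeet : ∀ ℓ, w ℓ ≠ 0 → ∃ σ, X.inc ℓ σ ∧ X.st σ ∈ T) :
    ∑ ℓ, w ℓ ≤ X.rooted.totalCost T := by
  rw [X.totalCost_eq]
  calc ∑ ℓ, w ℓ ≤ ∑ ℓ, ∑ σ with X.st σ ∈ T, if X.inc ℓ σ then w ℓ else 0 := by
        refine Finset.sum_le_sum fun ℓ _ => ?_
        have hnn : ∀ σ, 0 ≤ if X.inc ℓ σ then w ℓ else 0 := fun σ => by
          split_ifs <;> simp [hw]
        by_cases h0 : w ℓ = 0
        · rw [h0]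
          exact Finset.sum_nonneg fun σ _ => by simp
        · obtain ⟨σ, hi, hσ⟩ := hmeet ℓ h0
          refine le_trans ?_ (Finset.single_le_sum (f := fun σ => if X.inc ℓ σ then w ℓ else 0)
            (fun τ _ => hnn τ) (by simpa using hσ : σ ∈ _))
          simp [hi]
    _ = ∑ σ with X.st σ ∈ T, ∑ ℓ with X.inc ℓ σ, w ℓ := by
        rw [Finset.sum_comm]
        exact Finset.sum_congr rfl fun σ _ => (Finset.sum_filter _ _).symm
    _ ≤ ∑ σ with X.st σ ∈ T, X.price σ := Finset.sum_le_sum fun σ _ => hload σ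

end LumpGraph

namespace LumpGraph

/-- The lump graph with lumps of given sizes, on a node set that is identified by `e` with the
disjoint union of the root, the Steiner nodes and the lumps. -/
def ofEquiv {V L S : Type*} {sz : L → ℕ} (hsz : ∀ ℓ, 0 < sz ℓ)
    (e : V ≃ Unit ⊕ S ⊕ Σ ℓ, Fin (sz ℓ)) (inc : L → S → Prop) (price : S → ℝ)
    (hprice : ∀ σ, 0 < price σ) : LumpGraph V L S where
  cls v := match e v with
    | .inl _ => .root
    | .inr (.inl σ) => .steiner σ
    | .inr (.inr x) => .lump x.1
  rt := e.symm (.inl ())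
  st σ := e.symm (.inr (.inl σ))
  cls_eq_root v := by
    rw [e.eq_symm_apply]
    rcases e v with x | σ | x <;> simp
  cls_eq_steiner v τ := by
    rw [e.eq_symm_apply]
    rcases e v with x | σ | x <;> simp
  exists_lump ℓ := ⟨e.symm (.inr (.inr ⟨ℓ, ⟨0, hsz ℓ⟩⟩)), by simp⟩
  inc := inc
  price := price
  price_pos := hprice

theorem card_lumpSet_ofEquiv {V L S : Type*} [Fintype V] {sz : L → ℕ} (hsz : ∀ ℓ, 0 < sz ℓ)
    (e : V ≃ Unit ⊕ S ⊕ Σ ℓ, Fin (sz ℓ)) (inc : L → S → Prop) (price : S → ℝ)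
    (hprice : ∀ σ, 0 < price σ) (ℓ : L) :
    ((ofEquiv hsz e inc price hprice).lumpSet ℓ).card = sz ℓ := by
  rw [← Fintype.card_fin (sz ℓ), ← Finset.card_univ]
  symm
  refine Finset.card_bij (fun i _ => e.symm (.inr (.inr ⟨ℓ, i⟩))) (fun i _ => ?_)
    (fun i _ j _ hij => ?_) (fun v hv => ?_)
  · simp [ofEquiv]
  · simpa using hij
  · rw [mem_lumpSet] at hv
    simp only [ofEquiv] at hv
    rcases hx : e v with x | σ | ⟨ℓ', i⟩
    · simp [hx] at hv
    · simp [hx] at hv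
    · simp only [hx, NodeClass.lump.injEq] at hv
      subst hv
      exact ⟨i, Finset.mem_univ _, by rw [← hx, e.symm_apply_apply]⟩

end LumpGraph

/-! ### Nets

The `N * t` row nodes and the `2 * N * t` column nodes of a net form a grid, with `m` lumps for
each row and column; `N * v` further lumps are shared by all rows and columns, and each column has
`p` lumps of its own.  There are `N` cheap nodes that together cover the shared lumps, the lumps of
the grid, and `h` of the `p` lumps of each column. -/

/-- The parameters of a net. -/
structure Net where
  (N t m v p h s g : ℕ)
  (cA cB cO : ℝ)
  N_pos : 0 < N
  t_pos : 0 < t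
  m_pos : 0 < m
  p_pos : 0 < p
  h_le : h ≤ p
  s_pos : 0 < s
  g_pos : 0 < g
  cA_pos : 0 < cA
  cA_lt : cA < cB
  cB_lt : cB < cO

namespace Net

variable (P : Net)

abbrev Row : Type := Fin P.N × Fin P.t

abbrev Col : Type := Fin P.N × Fin (2 * P.t)

/-- The lumps: those of the grid, the shared ones, and those of the columns. -/
abbrev Lump : Type := (P.Row × P.Col × Fin P.m) ⊕ (Fin P.N × Fin P.v) ⊕ (P.Col × Fin P.p)

/-- The Steiner nodes: rows, columns and cheap nodes. -/
abbrev Steiner : Type := P.Row ⊕ P.Col ⊕ Fin P.N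

/-- The incidences of lumps and Steiner nodes. -/
def inc : P.Lump → P.Steiner → Prop
  | .inl x, .inl i => x.1 = i
  | .inl x, .inr (.inl j) => x.2.1 = j
  | .inl x, .inr (.inr l) => x.1.1 = l
  | .inr (.inl _), .inl _ => True
  | .inr (.inl _), .inr (.inl _) => True
  | .inr (.inl x), .inr (.inr l) => x.1 = l
  | .inr (.inr _), .inl _ => False
  | .inr (.inr x), .inr (.inl j) => x.1 = j
  | .inr (.inr x), .inr (.inr l) => x.1.1 = l ∧ x.2.1 < P.h

/-- The sizes of the lumps. -/
def sz : P.Lump → ℕ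
  | .inl _ => P.s
  | .inr (.inl _) => P.s
  | .inr (.inr _) => P.g

theorem sz_pos (ℓ : P.Lump) : 0 < P.sz ℓ := by
  rcases ℓ with x | x | x
  · exact P.s_pos
  · exact P.s_pos
  · exact P.g_pos

theorem cB_pos : 0 < P.cB := P.cA_pos.trans P.cA_lt

theorem cO_pos : 0 < P.cO := P.cB_pos.trans P.cB_lt

/-- The weights of the Steiner nodes. -/
def price : P.Steiner → ℝ
  | .inl _ => P.cA
  | .inr (.inl _) => P.cB
  | .inr (.inr _) => P.cO

theorem price_pos (σ : P.Steiner) : 0 < P.price σ := by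
  rcases σ with x | x | x
  · exact P.cA_pos
  · exact P.cB_pos
  · exact P.cO_pos

/-- The nodes of a net. -/
abbrev Node : Type := Unit ⊕ P.Steiner ⊕ Σ ℓ : P.Lump, Fin (P.sz ℓ)

/-- The number of nodes of a net. -/
def card : ℕ := Fintype.card P.Node

/-- The lump graph of a net. -/
noncomputable def lumpGraph : LumpGraph (Fin P.card) P.Lump P.Steiner :=
  LumpGraph.ofEquiv P.sz_pos (Fintype.equivFin P.Node).symm P.inc P.price P.price_pos

theorem card_lumpSet (ℓ : P.Lump) : (P.lumpGraph.lumpSet ℓ).card = P.sz ℓ :=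
  LumpGraph.card_lumpSet_ofEquiv _ _ _ _ _ ℓ

theorem size_eq (ℓ : P.Lump) : P.lumpGraph.size ℓ = P.sz ℓ := by
  unfold LumpGraph.size
  rw [P.card_lumpSet]

/-- A family with one value on the lumps of the grid and the shared lumps, and another value on the
lumps of the columns. -/
def two {A : Type*} (x y : A) : P.Lump → A
  | .inl _ => x
  | .inr (.inl _) => x
  | .inr (.inr _) => y

/-- The numbers of lumps of the first kind that are incident to a row, to a column and to a cheap
node. -/
def dA : ℕ := 2 * P.N * P.t * P.m + P.N * P.v

def dB : ℕ := P.N * P.t * P.m + P.N * P.v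

def dO : ℕ := P.t * (2 * P.N * P.t) * P.m + P.v

/-- The number of lumps of a cheap node that belong to columns. -/
def eO : ℕ := 2 * P.t * P.h

/-- The number of lumps of the first kind. -/
def core : ℕ := P.N * P.t * (2 * P.N * P.t) * P.m + P.N * P.v

section sums

variable {A : Type*} [AddCommMonoid A]

open Classical in
theorem sum_inc_eq (x y : A) (σ : P.Steiner) (q₁ : P.Row × P.Col × Fin P.m → Prop)
    (q₂ : Fin P.N × Fin P.v → Prop) (q₃ : P.Col × Fin P.p → Prop) [DecidablePred q₁]
    [DecidablePred q₂] [DecidablePred q₃] (h₁ : ∀ a, P.inc (.inl a) σ ↔ q₁ a)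
    (h₂ : ∀ a, P.inc (.inr (.inl a)) σ ↔ q₂ a) (h₃ : ∀ a, P.inc (.inr (.inr a)) σ ↔ q₃ a) :
    ∑ ℓ with P.inc ℓ σ, P.two x y ℓ =
      ((∑ a, if q₁ a then 1 else 0) + ∑ a, if q₂ a then 1 else 0) • x +
        (∑ a, if q₃ a then 1 else 0) • y := by
  rw [Finset.sum_filter, Fintype.sum_sum_type, Fintype.sum_sum_type, ← add_assoc, add_smul]
  simp only [Finset.sum_smul, ite_smul, one_smul, zero_smul]
  exact congrArg₂ _ (congrArg₂ _ (Finset.sum_congr rfl fun a _ => if_congr (h₁ a) rfl rfl)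
    (Finset.sum_congr rfl fun a _ => if_congr (h₂ a) rfl rfl))
    (Finset.sum_congr rfl fun a _ => if_congr (h₃ a) rfl rfl)

theorem sum_fst_eq {α β : Type*} [Fintype α] [Fintype β] [DecidableEq α] (i : α) :
    (∑ a : α × β, if a.1 = i then 1 else 0) = Fintype.card β := by
  rw [Fintype.sum_prod_type_right]
  simp

open Classical in
theorem sum_inc_row (x y : A) (i : P.Row) :
    ∑ ℓ with P.inc ℓ (.inl i), P.two x y ℓ = P.dA • x := by
  rw [P.sum_inc_eq x y _ (fun a => a.1 = i) (fun _ => True) (fun _ => False) (fun _ => Iff.rfl)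
    (fun _ => Iff.rfl) fun _ => Iff.rfl, sum_fst_eq]
  simp only [if_true, if_false, Finset.sum_const, Finset.card_univ, Fintype.card_prod,
    Fintype.card_fin, mul_zero, zero_smul, add_zero, smul_eq_mul, mul_one]
  congr 1
  unfold dA; ring

open Classical in
theorem sum_inc_col (x y : A) (j : P.Col) :
    ∑ ℓ with P.inc ℓ (.inr (.inl j)), P.two x y ℓ = P.dB • x + P.p • y := by
  rw [P.sum_inc_eq x y _ (fun a => a.2.1 = j) (fun _ => True) (fun a => a.1 = j)
    (fun _ => Iff.rfl) (fun _ => Iff.rfl) fun _ => Iff.rfl, sum_fst_eq, Fintype.sum_prod_type]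
  simp only [sum_fst_eq, if_true, Finset.sum_const, Finset.card_univ, Fintype.card_prod,
    Fintype.card_fin, smul_eq_mul, mul_one]
  rfl

open Classical in
theorem sum_inc_cheap (x y : A) (l : Fin P.N) :
    ∑ ℓ with P.inc ℓ (.inr (.inr l)), P.two x y ℓ = P.dO • x + P.eO • y := by
  rw [P.sum_inc_eq x y _ (fun a => a.1.1 = l) (fun a => a.1 = l)
    (fun a => a.1.1 = l ∧ a.2.1 < P.h)
    (fun _ => Iff.rfl) (fun _ => Iff.rfl) fun _ => Iff.rfl, sum_fst_eq]
  congr 2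
  · rw [Fintype.sum_prod_type_right]
    simp only [sum_fst_eq, Finset.sum_const, Finset.card_univ, Fintype.card_prod,
      Fintype.card_fin, smul_eq_mul]
    unfold dO; ring
  · rw [Fintype.sum_prod_type_right]
    have h1 : ∀ k : Fin P.p, (∑ j : P.Col, if j.1 = l ∧ k.1 < P.h then 1 else 0) =
        if k.1 < P.h then 2 * P.t else 0 := by
      intro k
      by_cases hk : k.1 < P.h
      · simp only [hk, and_true, if_true, sum_fst_eq, Fintype.card_fin]
      · simp [hk]
    simp only [h1]
    rw [← Finset.sum_filter, Finset.sum_const, smul_eq_mul, Fin.card_filter_val_lt,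
      min_eq_right P.h_le]
    unfold eO; ring

/-- Used over the reals to add up duals and over the naturals to count nodes. -/
theorem sum_two (x y : A) :
    ∑ ℓ, P.two x y ℓ = P.core • x + (2 * P.N * P.t * P.p) • y := by
  rw [Fintype.sum_sum_type, Fintype.sum_sum_type, ← add_assoc]
  simp only [two, Finset.sum_const, Finset.card_univ, Fintype.card_prod, Fintype.card_fin,
    ← add_smul]
  congr 2
  · unfold core; ring
  · ring

end sums

end Net

/-! ### The courses of the algorithm on a net -/

namespace Net

variable (P : Net)

/-- A family with one value on the rows, one on the columns and one on the cheap nodes. -/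
def tri {A : Type*} (x y z : A) : P.Steiner → A
  | .inl _ => x
  | .inr (.inl _) => y
  | .inr (.inr _) => z

/-- All rows, all columns, or all cheap nodes, or several of these together. -/
def sel (a b o : Bool) : Finset P.Steiner := Finset.univ.filter fun σ => P.tri a b o σ = true

@[simp] theorem row_mem_sel {a b o : Bool} {i : P.Row} : Sum.inl i ∈ P.sel a b o ↔ a = true := by
  rw [sel, Finset.mem_filter, and_iff_right (Finset.mem_univ _)]; rfl

@[simp] theorem col_mem_sel {a b o : Bool} {j : P.Col} :
    Sum.inr (Sum.inl j) ∈ P.sel a b o ↔ b = true := by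
  rw [sel, Finset.mem_filter, and_iff_right (Finset.mem_univ _)]; rfl

@[simp] theorem cheap_mem_sel {a b o : Bool} {l : Fin P.N} :
    Sum.inr (Sum.inr l) ∈ P.sel a b o ↔ o = true := by
  rw [sel, Finset.mem_filter, and_iff_right (Finset.mem_univ _)]; rfl

theorem sum_sel {A : Type*} [AddCommMonoid A] (a b o : Bool) (x y z : A) :
    ∑ σ ∈ P.sel a b o, P.tri x y z σ = (if a then (P.N * P.t) • x else 0) +
      ((if b then (2 * P.N * P.t) • y else 0) + if o then P.N • z else 0) := by
  rw [sel, Finset.sum_filter, Fintype.sum_sum_type, Fintype.sum_sum_type]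
  simp only [tri]
  have h : P.N * (2 * P.t) = 2 * P.N * P.t := by ring
  cases a <;> cases b <;> cases o <;> simp [h]

theorem card_sel (a b o : Bool) : (P.sel a b o).card = (if a then P.N * P.t else 0) +
    ((if b then 2 * P.N * P.t else 0) + if o then P.N else 0) := by
  rw [Finset.card_eq_sum_ones]
  have h := P.sum_sel a b o (1 : ℕ) 1 1
  simp only [smul_eq_mul, mul_one] at h
  rw [← h]
  exact Finset.sum_congr rfl fun σ _ => by rcases σ with i | j | l <;> rfl

theorem sum_sel_cost (a b o : Bool) (r lam : ℝ) :
    ∑ σ ∈ P.sel a b o, (P.lumpGraph.price σ - r * min (P.lumpGraph.price σ) lam) =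
      (if a then (P.N * P.t) • (P.cA - r * min P.cA lam) else 0) +
      ((if b then (2 * P.N * P.t) • (P.cB - r * min P.cB lam) else 0) +
        if o then P.N • (P.cO - r * min P.cO lam) else 0) := by
  rw [← P.sum_sel]
  exact Finset.sum_congr rfl fun σ _ => by rcases σ with i | j | l <;> rfl

/-- Some row, some column, and so on. -/
def row₀ : P.Row := (⟨0, P.N_pos⟩, ⟨0, P.t_pos⟩)

def col₀ : P.Col := (⟨0, P.N_pos⟩, ⟨0, Nat.mul_pos two_pos P.t_pos⟩)

def gridLump (i : P.Row) (j : P.Col) : P.Lump := .inl (i, j, ⟨0, P.m_pos⟩)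

def colLump (j : P.Col) : P.Lump := .inr (.inr (j, ⟨0, P.p_pos⟩))

variable {P}

/-- The algorithm has a single output, and this output meets the ratio `r` if the duals pay for
it. -/
structure Outcome (P : Net) (lam : ℝ) (R : Finset P.Steiner) (z : ℝ) : Prop where
  returns_iff : ∀ T, P.lumpGraph.rooted.Returns lam T ↔ T = P.lumpGraph.span R
  ratio : ∀ r, 0 ≤ r →
    ∑ σ ∈ R, (P.lumpGraph.price σ - r * min (P.lumpGraph.price σ) lam) ≤ r * z →
    ∀ T, P.lumpGraph.rooted.IsSolution T →
      P.lumpGraph.rooted.totalCost (P.lumpGraph.span R) +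
        r * (lam * ((Fintype.card (Fin P.card) : ℝ) - (P.lumpGraph.span R).card)) ≤
      r * (P.lumpGraph.rooted.totalCost T + lam * ((Fintype.card (Fin P.card) : ℝ) - T.card))

theorem Outcome.of_schedule {lam : ℝ} (hlam : 0 ≤ lam) {R : Finset P.Steiner} {z : ℝ}
    (sch : LumpGraph.Schedule P.lumpGraph lam) (hR : sch.IsKept R)
    (hz : ∀ q : P.Lump → Prop, [DecidablePred q] → (∀ ℓ, q ℓ ↔ ∃ σ ∈ R, P.inc ℓ σ) →
      z ≤ ∑ ℓ with q ℓ, sch.y ℓ) : Outcome P lam R z :=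
  ⟨fun T => sch.returns_iff hlam hR T, fun _ hr hcost _ hT => sch.ratio hr hR hz hcost hT⟩

section

open Classical in
theorem load_row (x y : ℝ) (i : P.Row) :
    ∑ ℓ with P.lumpGraph.inc ℓ (.inl i), P.two x y ℓ = P.dA * x := by
  rw [← nsmul_eq_mul]
  exact P.sum_inc_row x y i

open Classical in
theorem load_col (x y : ℝ) (j : P.Col) :
    ∑ ℓ with P.lumpGraph.inc ℓ (.inr (.inl j)), P.two x y ℓ = P.dB * x + P.p * y := by
  rw [← nsmul_eq_mul, ← nsmul_eq_mul]
  exact P.sum_inc_col x y j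

open Classical in
theorem load_cheap (x y : ℝ) (l : Fin P.N) :
    ∑ ℓ with P.lumpGraph.inc ℓ (.inr (.inr l)), P.two x y ℓ = P.dO * x + P.eO * y := by
  rw [← nsmul_eq_mul, ← nsmul_eq_mul]
  exact P.sum_inc_cheap x y l

end

theorem size_two (ℓ : P.Lump) (lam : ℝ) :
    P.lumpGraph.size ℓ * lam = P.two (P.s * lam) (P.g * lam) ℓ := by
  rw [P.size_eq]
  rcases ℓ with x | x | x <;> rfl

/-- If the penalty is small, then all lumps run out of potential before anything is bought. -/
theorem outcome_none {lam : ℝ} (hlam : 0 ≤ lam) (hgs : P.g ≤ P.s) (hltA : lam < P.cA)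
    (hA : P.dA * (P.s * lam) ≤ P.cA - lam)
    (hB : P.dB * (P.s * lam) + P.p * (P.g * lam) ≤ P.cB - lam)
    (hO : P.dO * (P.s * lam) + P.eO * (P.g * lam) ≤ P.cO - lam) :
    Outcome P lam (P.sel false false false) 0 := by
  have hltB := hltA.trans P.cA_lt
  have hltO := hltB.trans P.cB_lt
  have hprice : ∀ σ, lam < P.lumpGraph.price σ := by
    rintro (i | j | l)
    exacts [hltA, hltB, hltO]
  have hempty : ∀ σ, σ ∉ P.sel false false false := by
    rintro (i | j | l) <;> simp
  have hnn : ∀ ℓ, 0 ≤ P.two (P.s * lam) (P.g * lam) ℓ := by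
    rintro (x | x | x) <;> simp only [two] <;> positivity
  have hgs' : P.g * lam ≤ P.s * lam := by
    have : (P.g : ℝ) ≤ P.s := by exact_mod_cast hgs
    nlinarith
  -- Column lumps are no larger than core lumps, so the core lumps are the last to run out of
  -- potential, all at once. A node can go tight only at that moment.
  have hdom : ∀ ℓ', P.two (P.s * lam) (P.g * lam) ℓ' < P.s * lam ∨
      (P.two (P.s * lam) (P.g * lam) ℓ' = P.s * lam ∧
        P.two (P.s * lam) (P.g * lam) ℓ' = P.lumpGraph.size ℓ' * lam) := by
    intro ℓ'
    rw [size_two]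
    rcases ℓ' with x | x | x
    · exact Or.inr ⟨rfl, rfl⟩
    · exact Or.inr ⟨rfl, rfl⟩
    · exact (lt_or_eq_of_le hgs').imp id fun h => ⟨h, rfl⟩
  refine Outcome.of_schedule hlam
    { Buy := P.sel false false false
      time := fun _ => 0
      y := P.two (P.s * lam) (P.g * lam)
      terminal_mem := fun σ h => absurd h (not_le.2 (hprice σ))
      terminal_time := fun σ _ => rfl
      time_pos := fun σ h => absurd h (hempty σ)
      y_nonneg := hnn
      y_le_time := fun _ σ h => absurd h (hempty σ)
      lump_cases := fun ℓ => Or.inl ⟨(size_two ℓ lam).symm, fun σ h => absurd h (hempty σ)⟩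
      tight := fun σ h => absurd h (hempty σ)
      exists_witness := fun σ h => absurd h (hempty σ)
      load_le := ?_
      load_lt := ?_ } ?_ ?_
  · rintro (i | j | l) -
    · rw [load_row, min_eq_right (hprice _).le]; exact hA
    · rw [load_col, min_eq_right (hprice _).le]; exact hB
    · rw [load_cheap, min_eq_right (hprice _).le]; exact hO
  · rintro (i | j | l) -
    · exact Or.inr ⟨P.gridLump i P.col₀, rfl, hdom⟩
    · exact Or.inr ⟨P.gridLump P.row₀ j, rfl, hdom⟩
    · exact Or.inr ⟨P.gridLump (l, ⟨0, P.t_pos⟩) P.col₀, rfl, hdom⟩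
  · exact ⟨Finset.Subset.refl _, fun σ h => absurd h (not_le.2 (hprice σ)),
      fun _ σ h => absurd h (hempty σ), fun σ h => absurd h (hempty σ)⟩
  · intro q _ _
    exact Finset.sum_nonneg fun ℓ _ => hnn ℓ

/-- If the lumps of the columns run out of potential before the columns go tight, then only the rows
are bought. -/
theorem outcome_rows {lam x : ℝ} (hlam : 0 ≤ lam) (hltA : lam < P.cA) (hx : 0 < x)
    (hxs : x < P.s * lam) (hA : P.dA * x = P.cA - lam)
    (hB : P.dB * x + P.p * (P.g * lam) ≤ P.cB - lam)
    (hB' : P.dB * x + P.p * (P.g * lam) < P.cB - lam ∨ x < P.g * lam)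
    (hO : P.dO * x + P.eO * (P.g * lam) < P.cO - lam) :
    Outcome P lam (P.sel true false false) (P.core * x) := by
  have hltB := hltA.trans P.cA_lt
  have hltO := hltB.trans P.cB_lt
  have hprice : ∀ σ, lam < P.lumpGraph.price σ := by
    rintro (i | j | l)
    exacts [hltA, hltB, hltO]
  refine Outcome.of_schedule hlam
    { Buy := P.sel true false false
      time := fun _ => x
      y := P.two x (P.g * lam)
      terminal_mem := fun σ h => absurd h (not_le.2 (hprice σ))
      terminal_time := fun σ h => absurd h (not_le.2 (hprice σ))
      time_pos := fun _ _ _ => hx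
      y_nonneg := ?_
      y_le_time := ?_
      lump_cases := ?_
      tight := ?_
      exists_witness := ?_
      load_le := ?_
      load_lt := ?_ } ?_ ?_
  · rintro (a | a | a)
    · exact hx.le
    · exact hx.le
    · simp only [two]; positivity
  · rintro (a | a | a) (i | j | l) hσ hi
    · exact le_refl x
    · simp at hσ
    · simp at hσ
    · exact le_refl x
    · simp at hσ
    · simp at hσ
    · exact hi.elim
    · simp at hσ
    · simp at hσ
  · rintro (a | a | a)
    · right
      rw [size_two]
      exact ⟨hxs, .inl a.1, by simp, rfl, rfl⟩
    · right
      rw [size_two]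
      exact ⟨hxs, .inl P.row₀, by simp, trivial, rfl⟩
    · left
      rw [size_two]
      refine ⟨rfl, ?_⟩
      rintro (i | j | l) hσ hi
      · exact hi
      · simp at hσ
      · simp at hσ
  · rintro (i | j | l) hσ
    · rw [load_row, min_eq_right (hprice _).le]; exact hA
    · simp at hσ
    · simp at hσ
  · rintro (i | j | l) hσ -
    · refine ⟨P.gridLump i P.col₀, rfl, rfl, by rw [size_two]; exact hxs, ?_⟩
      rintro (i' | j' | l') hτ hi hne
      · exact absurd (congrArg Sum.inl (show i = i' from hi)).symm hne
      · simp at hτ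
      · simp at hτ
    · simp at hσ
    · simp at hσ
  · rintro (i | j | l) hσ
    · simp at hσ
    · rw [load_col, min_eq_right (hprice _).le]; exact hB
    · rw [load_cheap, min_eq_right (hprice _).le]; exact hO.le
  · rintro (i | j | l) hσ
    · simp at hσ
    · rw [load_col, min_eq_right (hprice _).le]
      -- In the tie case the core lumps have stopped at `x`, so the column lumps carry the largest
      -- dual, and all of them run out of potential together.
      refine hB'.imp id fun h => ⟨P.colLump j, rfl, ?_⟩
      rintro (a | a | a)
      · exact Or.inl h
      · exact Or.inl h
      · rw [size_two]; exact Or.inr ⟨rfl, rfl⟩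
    · left
      rw [load_cheap, min_eq_right (hprice _).le]; exact hO
  · refine ⟨Finset.Subset.refl _, fun σ h => absurd h (not_le.2 (hprice σ)),
      fun _ σ h hi => ⟨σ, h, hi⟩, ?_⟩
    rintro (i | j | l) hσ -
    · refine ⟨P.gridLump i P.col₀, rfl, ?_⟩
      rintro (i' | j' | l') hτ hi
      · exact (congrArg Sum.inl (show i = i' from hi)).symm
      · simp at hτ
      · simp at hτ
    · simp at hσ
    · simp at hσ
  · intro q _ hq
    have h := P.sum_two x (0 : ℝ)
    simp only [smul_zero, add_zero, nsmul_eq_mul] at h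
    rw [← h, Finset.sum_filter]
    refine Finset.sum_le_sum ?_
    rintro (a | a | a) -
    · rw [if_pos ((hq (.inl a)).2 ⟨.inl a.1, by simp, rfl⟩)]; exact le_refl _
    · rw [if_pos ((hq (.inr (.inl a))).2 ⟨.inl P.row₀, by simp, trivial⟩)]; exact le_refl _
    · rw [if_neg]
      · exact le_refl _
      · rw [hq]
        rintro ⟨i | j | l, hσ, hi⟩
        · exact hi
        · simp at hσ
        · simp at hσ

/-- The schedule in which first the rows and then the columns are bought. -/
theorem exists_schedule_rows_cols {lam x y : ℝ} (hltO : lam < P.cO) (hx : 0 ≤ x)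
    (hxy : x ≤ y) (hA : P.dA * x = P.cA - min P.cA lam)
    (hB : P.dB * x + P.p * y = P.cB - min P.cB lam)
    (hcA : P.cA ≤ lam → x = 0) (hcB : P.cB ≤ lam → y = 0)
    (hcA' : lam < P.cA → 0 < x ∧ x < y) (hcB' : lam < P.cB → 0 < y)
    (hxs : x < P.s * lam) (hyg : y < P.g * lam)
    (hO : P.dO * x + P.eO * y < P.cO - lam) :
    ∃ sch : LumpGraph.Schedule P.lumpGraph lam, sch.Buy = P.sel true true false ∧
      sch.y = P.two x y := by
  refine ⟨
    { Buy := P.sel true true false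
      -- The buying time `0` of the cheap nodes is a dummy: they are not bought.
      time := P.tri x y 0
      y := P.two x y
      terminal_mem := ?_
      terminal_time := ?_
      time_pos := ?_
      y_nonneg := ?_
      y_le_time := ?_
      lump_cases := ?_
      tight := ?_
      exists_witness := ?_
      load_le := ?_
      load_lt := ?_ }, rfl, rfl⟩
  · rintro (i | j | l) h
    · simp
    · simp
    · exact absurd h (not_le.2 hltO)
  · rintro (i | j | l) h
    · exact hcA h
    · exact hcB h
    · exact absurd h (not_le.2 hltO)
  · rintro (i | j | l) hσ h
    · exact (hcA' h).1
    · exact hcB' h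
    · simp at hσ
  · rintro (a | a | a)
    · exact hx
    · exact hx
    · exact hx.trans hxy
  · rintro (a | a | a) (i | j | l) hσ hi
    · exact le_refl x
    · exact hxy
    · simp at hσ
    · exact le_refl x
    · exact hxy
    · simp at hσ
    · exact hi.elim
    · exact le_refl y
    · simp at hσ
  · rintro (a | a | a)
    · right
      rw [size_two]
      exact ⟨hxs, .inl a.1, by simp, rfl, rfl⟩
    · right
      rw [size_two]
      exact ⟨hxs, .inl P.row₀, by simp, trivial, rfl⟩
    · right
      rw [size_two]
      exact ⟨hyg, .inr (.inl a.1), by simp, rfl, rfl⟩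
  · rintro (i | j | l) hσ
    · rw [load_row]; exact hA
    · rw [load_col]; exact hB
    · simp at hσ
  · rintro (i | j | l) hσ h
    · refine ⟨P.gridLump i P.col₀, rfl, rfl, by rw [size_two]; exact hxs, ?_⟩
      rintro (i' | j' | l') hτ hi hne
      · exact absurd (congrArg Sum.inl (show i = i' from hi)).symm hne
      · exact (hcA' h).2
      · simp at hτ
    · refine ⟨P.colLump j, rfl, rfl, by rw [size_two]; exact hyg, ?_⟩
      rintro (i' | j' | l') hτ hi hne
      · exact hi.elim
      · exact absurd (congrArg (Sum.inr ∘ Sum.inl) (show j = j' from hi)).symm hne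
      · simp at hτ
    · simp at hσ
  · rintro (i | j | l) hσ
    · simp at hσ
    · simp at hσ
    · rw [load_cheap, min_eq_right (show lam ≤ P.lumpGraph.price (.inr (.inr l)) from hltO.le)]
      exact hO.le
  · rintro (i | j | l) hσ
    · simp at hσ
    · simp at hσ
    · left
      rw [load_cheap, min_eq_right (show lam ≤ P.lumpGraph.price (.inr (.inr l)) from hltO.le)]
      exact hO

theorem sum_two_le {x y : ℝ} (R : Finset P.Steiner) (hR : ∀ ℓ, ∃ σ ∈ R, P.inc ℓ σ)
    (q : P.Lump → Prop) [DecidablePred q] (hq : ∀ ℓ, q ℓ ↔ ∃ σ ∈ R, P.inc ℓ σ) :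
    P.core * x + 2 * P.N * P.t * P.p * y ≤ ∑ ℓ with q ℓ, P.two x y ℓ := by
  have h := P.sum_two x y
  simp only [nsmul_eq_mul] at h
  push_cast at h
  rw [← h, Finset.filter_true_of_mem fun ℓ _ => (hq ℓ).2 (hR ℓ)]

theorem exists_col_inc {R : Finset P.Steiner} (hR : ∀ j : P.Col, Sum.inr (Sum.inl j) ∈ R)
    (ℓ : P.Lump) : ∃ σ ∈ R, P.inc ℓ σ := by
  rcases ℓ with a | a | a
  · exact ⟨_, hR a.2.1, rfl⟩
  · exact ⟨_, hR P.col₀, trivial⟩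
  · exact ⟨_, hR a.1, rfl⟩

/-- If the columns go tight, then the rows that have been bought before are deleted in the end. -/
theorem outcome_cols {lam x y : ℝ} (hlam : 0 ≤ lam) (hltA : lam < P.cA) (hx : 0 < x) (hxy : x < y)
    (hA : P.dA * x = P.cA - lam) (hB : P.dB * x + P.p * y = P.cB - lam)
    (hxs : x < P.s * lam) (hyg : y < P.g * lam)
    (hO : P.dO * x + P.eO * y < P.cO - lam) :
    Outcome P lam (P.sel false true false) (P.core * x + 2 * P.N * P.t * P.p * y) := by
  have hltB := hltA.trans P.cA_lt
  have hltO := hltB.trans P.cB_lt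
  obtain ⟨sch, hbuy, hy⟩ := exists_schedule_rows_cols (P := P) hltO hx.le hxy.le
    (by rw [min_eq_right hltA.le]; exact hA) (by rw [min_eq_right hltB.le]; exact hB)
    (fun h => absurd h (not_le.2 hltA)) (fun h => absurd h (not_le.2 hltB))
    (fun _ => ⟨hx, hxy⟩) (fun _ => hx.trans hxy) hxs hyg hO
  refine Outcome.of_schedule hlam sch ⟨?_, ?_, fun ℓ _ _ _ => exists_col_inc (by simp) ℓ, ?_⟩ ?_
  · rw [hbuy]
    rintro (i | j | l) hσ
    · simp
    · simp
    · simp at hσ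
  · rintro (i | j | l) h
    · exact absurd h (not_le.2 hltA)
    · simp
    · exact absurd h (not_le.2 hltO)
  · rw [hbuy]
    rintro (i | j | l) hσ -
    · simp at hσ
    · refine ⟨P.colLump j, rfl, ?_⟩
      rintro (i' | j' | l') hτ hi
      · exact hi.elim
      · exact (congrArg (Sum.inr ∘ Sum.inl) (show j = j' from hi)).symm
      · simp at hτ
    · simp at hσ
  · intro q _ hq
    rw [hy]
    exact sum_two_le _ (exists_col_inc (by simp)) q hq

/-- If the penalty is at least the weight of the rows, then rows and columns are returned. -/
theorem outcome_rows_cols {lam y : ℝ} (hlam : 0 ≤ lam) (hA : P.cA ≤ lam) (hltO : lam < P.cO)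
    (hy : 0 ≤ y) (hB : P.p * y = P.cB - min P.cB lam) (hcB : P.cB ≤ lam → y = 0)
    (hcB' : lam < P.cB → 0 < y) (hyg : y < P.g * lam) (hO : P.eO * y < P.cO - lam) :
    Outcome P lam (P.sel true true false) (2 * P.N * P.t * P.p * y) := by
  have hlam' : 0 < lam := P.cA_pos.trans_le hA
  obtain ⟨sch, hbuy, hy'⟩ := exists_schedule_rows_cols (P := P) hltO le_rfl hy
    (by rw [min_eq_left hA]; ring) (by rw [← hB]; ring) (fun _ => rfl) hcB
    (fun h => absurd h (not_lt.2 hA)) hcB'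
    (mul_pos (by exact_mod_cast P.s_pos) hlam') hyg (by linarith)
  refine Outcome.of_schedule hlam sch ⟨?_, ?_, fun ℓ _ _ _ => exists_col_inc (by simp) ℓ, ?_⟩ ?_
  · rw [hbuy]
  · rintro (i | j | l) h
    · simp
    · simp
    · exact absurd h (not_le.2 hltO)
  · rw [hbuy]
    rintro (i | j | l) hσ h
    · exact absurd hA (not_le.2 h)
    · refine ⟨P.colLump j, rfl, ?_⟩
      rintro (i' | j' | l') hτ hi
      · exact hi.elim
      · exact (congrArg (Sum.inr ∘ Sum.inl) (show j = j' from hi)).symm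
      · simp at hτ
    · simp at hσ
  · intro q _ hq
    rw [hy']
    have := sum_two_le (x := 0) (y := y) _ (exists_col_inc (R := P.sel true true false) (by simp)) q
      hq
    linarith

/-- If the penalty is at least the weight of all nodes, then all nodes are returned. -/
theorem outcome_all {lam : ℝ} (hlam : P.cO ≤ lam) :
    Outcome P lam (P.sel true true true) 0 := by
  have hlam' : 0 < lam := P.cO_pos.trans_le hlam
  have hprice : ∀ σ, P.lumpGraph.price σ ≤ lam := by
    rintro (i | j | l)
    exacts [((P.cA_lt.trans P.cB_lt).le).trans hlam, P.cB_lt.le.trans hlam, hlam]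
  have hall : ∀ σ, σ ∈ P.sel true true true := by
    rintro (i | j | l) <;> simp
  refine Outcome.of_schedule hlam'.le
    { Buy := P.sel true true true
      time := fun _ => 0
      y := fun _ => 0
      terminal_mem := fun σ _ => hall σ
      terminal_time := fun σ _ => rfl
      time_pos := fun σ _ h => absurd (hprice σ) (not_le.2 h)
      y_nonneg := fun _ => le_rfl
      y_le_time := fun _ _ _ _ => le_rfl
      lump_cases := fun ℓ => ?_
      tight := fun σ _ => by rw [min_eq_left (hprice σ)]; simp
      exists_witness := fun σ _ h => absurd (hprice σ) (not_le.2 h)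
      load_le := fun σ h => absurd (hall σ) h
      load_lt := fun σ h => absurd (hall σ) h } ?_ ?_
  · obtain ⟨σ, hσ, hi⟩ := exists_col_inc (R := P.sel true true true) (by simp) ℓ
    exact Or.inr ⟨mul_pos (P.lumpGraph.size_pos ℓ) hlam', σ, hσ, hi, rfl⟩
  · exact ⟨Finset.Subset.refl _, fun σ _ => hall σ, fun _ σ h hi => ⟨σ, h, hi⟩,
      fun σ _ h => absurd (hprice σ) (not_le.2 h)⟩
  · intro q _ _
    simp

end Net

/-! ### Nets whose prices make the rows go tight at penalty `1` -/

namespace Net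

/-- The number of rows, as a real number. -/
def rows (P : Net) : ℝ := P.N * P.t

/-- The target number of nodes. -/
def target (P : Net) : ℕ :=
  -- With the root, the core, all rows and `N * t - 1` columns with their lumps one is still one
  -- node short.
  1 + P.s * P.core + 2 * (P.N * P.t) + (P.N * P.t - 1) * (P.p * P.g)

/-- The relations between the parameters of a net that are used below. -/
structure IsTuned (P : Net) (r : ℝ) : Prop where
  one_le : 1 ≤ r
  -- At penalty `1` the rows go tight at time `g - 1` and the columns would go tight at time `g`,
  -- when their own lumps run out of potential.
  cA_eq : P.cA = 1 + P.dA * (P.g - 1)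
  cB_eq : P.cB = 1 + P.dB * (P.g - 1) + P.p * P.g
  -- Since no dual of a lump exceeds `g`, the summand `2` keeps the cheap nodes from going tight for
  -- penalties up to `1`.
  cO_eq : P.cO = P.dO * P.g + P.eO * P.g + 2
  -- This and the next condition make the load of a cheap node fall at least as fast as its reduced
  -- cost when the penalty grows beyond `1`, until the columns are terminals and nothing is loaded.
  dA_le : P.dA ≤ P.dO
  p_le : P.p ≤ P.eO
  -- This amounts to `dA ≤ dB + p` and lets the rows go tight before the columns for penalties
  -- beyond `1`.
  le_p : P.N * P.t * P.m ≤ P.p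
  ratio_row : P.rows * P.dA ≤ r * P.core
  ratio_col : 2 * P.rows * (P.dB + P.p) ≤ r * (P.core + 2 * P.rows * P.p)
  le_g : 2 * (P.N * P.t) ≤ P.g
  s_gt : 3 * (P.N * P.t) + P.N + 2 * (P.N * P.t) * (P.p * P.g) + 2 * P.g < P.s
  h_ge : (P.N * P.t - 1) * P.p + 1 ≤ 2 * (P.N * P.t) * P.h
  gap : 4 / 3 * r * (P.N * P.cO) ≤ P.rows * P.cA + P.rows * P.cB

variable {P : Net}

theorem one_le_rows_nat (P : Net) : 1 ≤ P.N * P.t := Nat.mul_pos P.N_pos P.t_pos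

theorem rows_pos (P : Net) : 0 < P.rows :=
  mul_pos (by exact_mod_cast P.N_pos) (by exact_mod_cast P.t_pos)

theorem dA_eq (P : Net) : P.dA = P.dB + P.N * P.t * P.m := by unfold dA dB; ring

theorem dA_pos (P : Net) : 0 < P.dA := by
  have := Nat.mul_pos (Nat.mul_pos P.N_pos P.t_pos) P.m_pos
  rw [dA_eq]; omega

theorem sel_ratio_iff (P : Net) (a b o : Bool) (r lam z : ℝ)
    (h : (if a then P.rows * (P.cA - r * min P.cA lam) else 0) +
      ((if b then 2 * P.rows * (P.cB - r * min P.cB lam) else 0) +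
        if o then P.N * (P.cO - r * min P.cO lam) else 0) ≤ r * z) :
    ∑ σ ∈ P.sel a b o, (P.lumpGraph.price σ - r * min (P.lumpGraph.price σ) lam) ≤ r * z := by
  rw [P.sum_sel_cost]
  refine le_of_eq_of_le ?_ h
  simp only [nsmul_eq_mul, rows]
  push_cast
  simp only [mul_assoc]

/-- Applied to the deviation of a dual from `g - 1`, whose sign is not known. -/
theorem mul_le_of_mul_le {a b w e : ℝ} (hb : 0 ≤ b) (hba : b ≤ a) (he : 0 ≤ e) (h : a * w ≤ e) :
    b * w ≤ e := by
  rcases le_total w 0 with hw | hw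
  · exact (mul_nonpos_of_nonneg_of_nonpos hb hw).trans he
  · exact (mul_le_mul_of_nonneg_right hba hw).trans h

namespace IsTuned

variable {r lam : ℝ}

theorem two_le_g (hP : P.IsTuned r) : (2 : ℝ) ≤ P.g := by
  have := P.one_le_rows_nat
  have := hP.le_g
  exact_mod_cast (by omega : 2 ≤ P.g)

theorem two_mul_g_lt (hP : P.IsTuned r) : (2 : ℝ) * P.g < P.s := by
  have := hP.s_gt
  exact_mod_cast (by omega : 2 * P.g < P.s)

theorem one_le_dA (P : Net) : (1 : ℝ) ≤ P.dA := by exact_mod_cast P.dA_pos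

theorem dB_le (P : Net) : (P.dB : ℝ) ≤ P.dA := by
  rw [dA_eq]; push_cast; exact le_add_of_nonneg_right (by positivity)

theorem dA_le_add (hP : P.IsTuned r) : (P.dA : ℝ) ≤ P.dB + P.p := by
  have := hP.le_p
  rw [dA_eq]; exact_mod_cast (by omega)

theorem dA_le_dO (hP : P.IsTuned r) : (P.dA : ℝ) ≤ P.dO := by exact_mod_cast hP.dA_le

theorem p_le_eO (hP : P.IsTuned r) : (P.p : ℝ) ≤ P.eO := by exact_mod_cast hP.p_le

theorem two_le_cA (hP : P.IsTuned r) : 2 ≤ P.cA := by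
  have := hP.two_le_g
  have := one_le_dA P
  rw [hP.cA_eq]; nlinarith

/-- The loads on columns and cheap nodes for penalties up to `1`. -/
theorem load_bounds (hP : P.IsTuned r) (hlam : 0 ≤ lam) (hlam1 : lam ≤ 1) {u : ℝ}
    (hu : P.dA * u ≤ P.cA - lam) :
    P.dB * u + P.p * (P.g * lam) ≤ P.cB - lam - P.p * P.g * (1 - lam) ∧
      P.dO * u + P.eO * (P.g * lam) < P.cO - lam ∧ u ≤ P.g := by
  have hA := one_le_dA P
  have hw : P.dA * (u - (P.g - 1)) ≤ 1 - lam := by rw [hP.cA_eq] at hu; linarith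
  have h1 := mul_le_of_mul_le (Nat.cast_nonneg P.dB) (dB_le P) (by linarith) hw
  have h2 := mul_le_of_mul_le zero_le_one hA (by linarith) hw
  have hug : u ≤ P.g := by linarith
  have h3 : P.dO * u ≤ P.dO * (P.g : ℝ) := mul_le_mul_of_nonneg_left hug (Nat.cast_nonneg _)
  have h4 : P.eO * (P.g * lam) ≤ P.eO * (P.g : ℝ) :=
    mul_le_mul_of_nonneg_left (mul_le_of_le_one_right (Nat.cast_nonneg _) hlam1)
      (Nat.cast_nonneg _)
  refine ⟨?_, ?_, hug⟩
  · rw [hP.cB_eq]; linarith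
  · rw [hP.cO_eq]; linarith

theorem outcome_low (hP : P.IsTuned r) (hlam : 0 ≤ lam) (hlam1 : lam ≤ 1)
    (h : P.dA * (P.s * lam) ≤ P.cA - lam) : Outcome P lam (P.sel false false false) 0 := by
  obtain ⟨h1, h2, -⟩ := hP.load_bounds hlam hlam1 h
  have h3 : 0 ≤ P.p * P.g * (1 - lam) := mul_nonneg (by positivity) (by linarith)
  have hgs : P.g ≤ P.s := by have := hP.s_gt; omega
  exact outcome_none hlam hgs (by linarith [hP.two_le_cA]) h (by linarith) h2.le

theorem exists_outcome_rows (hP : P.IsTuned r) (hlam : 0 ≤ lam) (hlam1 : lam ≤ 1)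
    (h : P.cA - lam < P.dA * (P.s * lam)) : ∃ z, Outcome P lam (P.sel true false false) z ∧
      ∑ σ ∈ P.sel true false false,
        (P.lumpGraph.price σ - r * min (P.lumpGraph.price σ) lam) ≤ r * z := by
  have hA := one_le_dA P
  have hA0 : (0 : ℝ) < P.dA := by linarith
  have hcA := hP.two_le_cA
  have hg := hP.two_le_g
  have hr := hP.one_le
  set x := (P.cA - lam) / P.dA with hxdef
  have hx : P.dA * x = P.cA - lam := by rw [hxdef]; field_simp
  have hx0 : 0 < x := div_pos (by linarith) hA0
  obtain ⟨h1, h2, hxg⟩ := hP.load_bounds hlam hlam1 hx.le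
  have hpg : (0 : ℝ) < P.p * P.g := by
    have : (0 : ℝ) < P.p := by exact_mod_cast P.p_pos
    positivity
  refine ⟨_, outcome_rows hlam (by linarith) hx0 ?_ hx ?_ ?_ h2, ?_⟩
  · rw [← hx] at h
    exact lt_of_mul_lt_mul_left h hA0.le
  · have : 0 ≤ P.p * P.g * (1 - lam) := mul_nonneg hpg.le (by linarith)
    linarith
  · rcases hlam1.lt_or_eq with hl | rfl
    · left
      have : 0 < P.p * P.g * (1 - lam) := mul_pos hpg (by linarith)
      linarith
    · right
      have : x = P.g - 1 := by
        apply mul_left_cancel₀ hA0.ne'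
        rw [hx, hP.cA_eq]; ring
      linarith
  · apply sel_ratio_iff
    have h3 := mul_le_mul_of_nonneg_right hP.ratio_row hx0.le
    have h4 : 0 ≤ P.rows * ((r - 1) * lam) :=
      mul_nonneg P.rows_pos.le (mul_nonneg (by linarith) hlam)
    rw [min_eq_right (by linarith)]
    simp only [if_true, if_false, Bool.false_eq_true, add_zero]
    have h5 : P.cA = lam + P.dA * x := by linarith
    rw [h5]
    linarith

theorem exists_outcome_cols (hP : P.IsTuned r) (hlam : 1 < lam) (hltA : lam < P.cA) :
    ∃ z, Outcome P lam (P.sel false true false) z ∧ ∑ σ ∈ P.sel false true false,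
        (P.lumpGraph.price σ - r * min (P.lumpGraph.price σ) lam) ≤ r * z := by
  have hA := one_le_dA P
  have hA0 : (0 : ℝ) < P.dA := by linarith
  have hg := hP.two_le_g
  have hgs := hP.two_mul_g_lt
  have hr := hP.one_le
  have hp0 : (0 : ℝ) < P.p := by exact_mod_cast P.p_pos
  have hltB := hltA.trans P.cA_lt
  set x := (P.cA - lam) / P.dA with hxdef
  have hx : P.dA * x = P.cA - lam := by rw [hxdef]; field_simp
  have hx0 : 0 < x := div_pos (by linarith) hA0
  set y := (P.cB - lam - P.dB * x) / P.p with hydef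
  have hy : P.dB * x + P.p * y = P.cB - lam := by rw [hydef]; field_simp; ring
  -- The rows are bought earlier than at penalty `1` by `g - 1 - x`; the remaining bounds compare
  -- multiples of this quantity.
  have hw : P.dA * (P.g - 1 - x) = lam - 1 := by
    have := hP.cA_eq
    linarith
  have hw0 : 0 < P.g - 1 - x := by
    by_contra! hc
    have := mul_nonpos_of_nonneg_of_nonpos hA0.le hc
    linarith
  have hBw := mul_le_mul_of_nonneg_right (dB_le P) hw0.le
  have hOw := mul_le_mul_of_nonneg_right hP.dA_le_dO hw0.le
  have hABw := mul_le_mul_of_nonneg_right hP.dA_le_add hw0.le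
  have hcB := hP.cB_eq
  have hyg : y ≤ P.g := by
    refine le_of_mul_le_mul_left ?_ hp0
    linarith
  have hxy : x < y := by
    refine lt_of_mul_lt_mul_left ?_ hp0.le
    linarith
  -- Since `1 < lam`, the column lumps still have potential when the columns go tight.
  have hylt : y < P.g * lam := by nlinarith
  refine ⟨_, outcome_cols (by linarith) hltA hx0 hxy hx hy ?_ hylt ?_, ?_⟩
  · nlinarith
  · have := mul_le_mul_of_nonneg_left hyg (Nat.cast_nonneg (α := ℝ) P.eO)
    rw [hP.cO_eq]
    have : (0 : ℝ) ≤ P.dO := Nat.cast_nonneg _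
    linarith
  · apply sel_ratio_iff
    -- `ratio_col` settles the case in which all lumps have dual `x`; the surplus `y - x` of the
    -- column lumps loads only their own column and is harmless as `1 ≤ r`.
    have h3 := mul_le_mul_of_nonneg_right hP.ratio_col hx0.le
    have h4 : 0 ≤ 2 * P.rows * ((r - 1) * lam) :=
      mul_nonneg (mul_nonneg two_pos.le P.rows_pos.le) (mul_nonneg (by linarith) (by linarith))
    have h5 : 0 ≤ (r - 1) * (2 * P.rows * P.p * (y - x)) :=
      mul_nonneg (by linarith) (mul_nonneg (mul_nonneg (mul_nonneg two_pos.le P.rows_pos.le) hp0.le)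
        (by linarith))
    rw [min_eq_right hltB.le]
    simp only [if_true, if_false, Bool.false_eq_true, add_zero, zero_add]
    have h6 : P.cB = lam + P.dB * x + P.p * y := by linarith
    have h7 : (2 : ℝ) * P.N * P.t = 2 * P.rows := by unfold rows; ring
    rw [h6, h7]
    linarith

/-- The rows are terminals, so they connect the core at time `0`, its duals vanish, and each column
is paid for by its own lumps alone. -/
theorem exists_outcome_rows_cols (hP : P.IsTuned r) (hA : P.cA ≤ lam) (hltO : lam < P.cO) :
    ∃ z, Outcome P lam (P.sel true true false) z ∧ ∑ σ ∈ P.sel true true false,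
        (P.lumpGraph.price σ - r * min (P.lumpGraph.price σ) lam) ≤ r * z := by
  have hg := hP.two_le_g
  have hr := hP.one_le
  have hcA := hP.two_le_cA
  have hp0 : (0 : ℝ) < P.p := by exact_mod_cast P.p_pos
  set y := (P.cB - min P.cB lam) / P.p with hydef
  have hy : P.p * y = P.cB - min P.cB lam := by rw [hydef]; field_simp
  have hy0 : 0 ≤ y := div_nonneg (sub_nonneg.2 (min_le_left _ _)) hp0.le
  have hBA := mul_le_mul_of_nonneg_right (dB_le P) (by linarith : 0 ≤ (P.g : ℝ) - 1)
  have hBO := mul_le_mul_of_nonneg_right hP.dA_le_dO (by linarith : 0 ≤ (P.g : ℝ) - 1)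
  have hcB := hP.cB_eq
  have hcA' := hP.cA_eq
  have hyg : y ≤ P.g := by
    refine le_of_mul_le_mul_left ?_ hp0
    have : P.cA ≤ min P.cB lam := le_min P.cA_lt.le hA
    linarith
  have hzero : P.cB ≤ lam → y = 0 := fun h => by rw [hydef, min_eq_left h]; simp
  refine ⟨_, outcome_rows_cols (by linarith) hA hltO hy0 hy hzero ?_ ?_ ?_, ?_⟩
  · intro h
    exact div_pos (by rw [min_eq_right h.le]; linarith) hp0
  · nlinarith
  · rcases le_or_gt P.cB lam with h | h
    · rw [hzero h]; linarith
    · rw [min_eq_right h.le] at hy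
      have h1 := mul_le_mul_of_nonneg_left hyg (sub_nonneg.2 hP.p_le_eO)
      have h2 : (0 : ℝ) ≤ P.dO := Nat.cast_nonneg _
      rw [hP.cO_eq]
      linarith
  · apply sel_ratio_iff
    rw [min_eq_left hA]
    simp only [if_true, if_false, Bool.false_eq_true, add_zero]
    have h1 : 0 ≤ P.rows * ((r - 1) * P.cA) :=
      mul_nonneg P.rows_pos.le (mul_nonneg (by linarith) (by linarith))
    have h2 : 0 ≤ 2 * P.rows * ((r - 1) * P.cB) :=
      mul_nonneg (mul_nonneg two_pos.le P.rows_pos.le)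
        (mul_nonneg (by linarith) P.cB_pos.le)
    have h7 : (2 : ℝ) * P.N * P.t * P.p * y = 2 * P.rows * (P.cB - min P.cB lam) := by
      rw [← hy]; unfold rows; ring
    rw [h7]
    linarith

theorem exists_outcome_all (hP : P.IsTuned r) (hO : P.cO ≤ lam) :
    ∃ z, Outcome P lam (P.sel true true true) z ∧ ∑ σ ∈ P.sel true true true,
        (P.lumpGraph.price σ - r * min (P.lumpGraph.price σ) lam) ≤ r * z := by
  refine ⟨0, outcome_all hO, ?_⟩
  rw [mul_zero]
  refine Finset.sum_nonpos fun σ _ => ?_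
  have hle : P.lumpGraph.price σ ≤ lam := by
    rcases σ with i | j | l
    exacts [((P.cA_lt.trans P.cB_lt).le).trans hO, P.cB_lt.le.trans hO, hO]
  rw [min_eq_left hle]
  have := mul_nonneg (sub_nonneg.2 hP.one_le) (P.lumpGraph.price_pos σ).le
  linarith

end IsTuned

/-! ### Counting nodes -/

section counting

theorem card_span_eq (R : Finset P.Steiner) (q : P.Lump → Prop) [DecidablePred q]
    (hq : ∀ ℓ, q ℓ ↔ ∃ σ ∈ R, P.inc ℓ σ) :
    (P.lumpGraph.span R).card = 1 + R.card + ∑ ℓ with q ℓ, P.two P.s P.g ℓ := by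
  classical
  rw [LumpGraph.card_span]
  congr 1
  rw [Finset.sum_filter, Finset.sum_filter]
  refine Finset.sum_congr rfl fun ℓ _ => ?_
  rw [P.card_lumpSet]
  refine if_congr (hq ℓ).symm ?_ rfl
  rcases ℓ with a | a | a <;> rfl

theorem card_span_of_cols {a o : Bool} : (P.lumpGraph.span (P.sel a true o)).card =
    1 + (P.sel a true o).card + (P.core * P.s + 2 * (P.N * P.t) * (P.p * P.g)) := by
  classical
  rw [card_span_eq _ (fun _ => True) fun ℓ =>
    ⟨fun _ => exists_col_inc (by simp) ℓ, fun _ => trivial⟩, Finset.filter_true, P.sum_two, smul_eq_mul, smul_eq_mul]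
  ring

theorem card_span_none : (P.lumpGraph.span (P.sel false false false)).card = 1 := by
  classical
  rw [card_span_eq _ (fun _ => False) fun ℓ => ⟨False.elim, ?_⟩, P.card_sel]
  · simp
  · rintro ⟨i | j | l, hσ, -⟩ <;> simp at hσ

theorem card_span_rows : (P.lumpGraph.span (P.sel true false false)).card =
    1 + P.N * P.t + P.core * P.s := by
  classical
  rw [card_span_eq _ (fun ℓ => P.two True False ℓ) fun ℓ => ?_, P.card_sel]
  · have h := P.sum_two P.s (0 : ℕ)
    rw [smul_zero, add_zero, smul_eq_mul] at h
    rw [← h, Finset.sum_filter]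
    simp only [if_true, Bool.false_eq_true, if_false, add_zero]
    congr 1
    refine Finset.sum_congr rfl fun ℓ _ => ?_
    rcases ℓ with a | a | a
    · exact if_pos trivial
    · exact if_pos trivial
    · exact if_neg id
  · rcases ℓ with a | a | a
    · exact ⟨fun _ => ⟨.inl a.1, by simp, rfl⟩, fun _ => trivial⟩
    · exact ⟨fun _ => ⟨.inl P.row₀, by simp, trivial⟩, fun _ => trivial⟩
    · refine ⟨False.elim, ?_⟩
      rintro ⟨i | j | l, hσ, hi⟩
      · exact hi
      · simp at hσ
      · simp at hσ

theorem card_span_cheap : (P.lumpGraph.span (P.sel false false true)).card =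
    1 + P.N + (P.core * P.s + 2 * (P.N * P.t) * (P.h * P.g)) := by
  classical
  rw [card_span_eq _ (fun ℓ => ∃ σ ∈ P.sel false false true, P.inc ℓ σ) fun ℓ => Iff.rfl,
    P.card_sel]
  have h1 : ∀ a : P.Row × P.Col × Fin P.m,
      ∃ σ ∈ P.sel false false true, P.inc (.inl a) σ := fun a =>
    ⟨.inr (.inr a.1.1), by simp, rfl⟩
  have h2 : ∀ a : Fin P.N × Fin P.v,
      ∃ σ ∈ P.sel false false true, P.inc (.inr (.inl a)) σ := fun a =>
    ⟨.inr (.inr a.1), by simp, rfl⟩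
  have h3 : ∀ a : P.Col × Fin P.p,
      (∃ σ ∈ P.sel false false true, P.inc (.inr (.inr a)) σ) ↔ a.2.1 < P.h := by
    intro a
    constructor
    · rintro ⟨i | j | l, hσ, hi⟩
      · simp at hσ
      · simp at hσ
      · exact hi.2
    · exact fun h => ⟨.inr (.inr a.1.1), by simp, rfl, h⟩
  have hsum : (∑ ℓ with (∃ σ ∈ P.sel false false true, P.inc ℓ σ), P.two P.s P.g ℓ) =
      (∑ _a : P.Row × P.Col × Fin P.m, P.s) + ((∑ _a : Fin P.N × Fin P.v, P.s) +
        ∑ a : P.Col × Fin P.p, if a.2.1 < P.h then P.g else 0) := by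
    rw [Finset.sum_filter, Fintype.sum_sum_type, Fintype.sum_sum_type]
    exact congrArg₂ _ (Finset.sum_congr rfl fun a _ => if_pos (h1 a))
      (congrArg₂ _ (Finset.sum_congr rfl fun a _ => if_pos (h2 a))
        (Finset.sum_congr rfl fun a _ => if_congr (h3 a) rfl rfl))
  rw [hsum, Fintype.sum_prod_type_right (α₁ := P.Col)]
  have h4 : (∑ k : Fin P.p, ∑ _j : P.Col, if k.1 < P.h then P.g else 0) =
      P.h * (P.N * (2 * P.t) * P.g) := by
    have h5 : ∀ k : Fin P.p, (∑ _j : P.Col, if k.1 < P.h then P.g else 0) =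
        if k.1 < P.h then P.N * (2 * P.t) * P.g else 0 := by
      intro k
      by_cases hk : k.1 < P.h
      · simp [hk]
      · simp [hk]
    rw [Finset.sum_congr rfl fun k _ => h5 k, ← Finset.sum_filter, Finset.sum_const, smul_eq_mul,
      Fin.card_filter_val_lt, min_eq_right P.h_le]
  rw [h4]
  simp only [Finset.sum_const, Finset.card_univ, Fintype.card_prod, Fintype.card_fin, if_true,
    Bool.false_eq_true, if_false, smul_eq_mul]
  unfold core
  ring

end counting

end Net

/-! ### The optimum and the cost of sets without cheap nodes -/

namespace Net

variable {P : Net}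

theorem card_le_of_isSolution {T : Finset (Fin P.card)} (hT : P.lumpGraph.rooted.IsSolution T)
    (A : Finset P.Steiner) (hA : ∀ σ, P.lumpGraph.st σ ∈ T → σ ∈ A)
    (q : P.Lump → Prop) [DecidablePred q]
    (hq : ∀ ℓ σ, P.inc ℓ σ → P.lumpGraph.st σ ∈ T → q ℓ) :
    T.card ≤ 1 + A.card + ∑ ℓ with q ℓ, P.two P.s P.g ℓ := by
  obtain ⟨-, hconn⟩ := LumpGraph.isSolution_iff.1 hT
  rw [Finset.card_eq_sum_ones, P.lumpGraph.sum_eq, Finset.sum_filter q]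
  refine add_le_add (add_le_add ?_ ?_) (Finset.sum_le_sum fun ℓ _ => ?_)
  · split_ifs <;> simp
  · rw [← Finset.card_eq_sum_ones]
    exact Finset.card_le_card fun σ hσ => hA σ (by simpa using hσ)
  · split_ifs with h
    · refine (Finset.sum_le_card_nsmul _ _ 1 fun v _ => ?_).trans ?_
      · split_ifs <;> simp
      · rw [P.card_lumpSet, smul_eq_mul, mul_one]
        rcases ℓ with a | a | a <;> exact le_rfl
    · refine (Finset.sum_eq_zero fun v hv => if_neg fun hvT => h ?_).le
      obtain ⟨σ, hi, hσ⟩ :=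
        P.lumpGraph.exists_steiner_of_connectedToRoot (P.lumpGraph.mem_lumpSet.1 hv) (hconn v hvT)
      exact hq ℓ σ hi hσ

theorem card_steiner (P : Net) : (Finset.univ : Finset P.Steiner).card = 3 * (P.N * P.t) + P.N := by
  rw [Finset.card_univ]
  simp only [Fintype.card_sum, Fintype.card_prod, Fintype.card_fin]
  ring

/-- A missed core lump costs `s` nodes, more than all Steiner nodes and column lumps together can
make up. -/
theorem IsTuned.exists_inc {r : ℝ} (hP : P.IsTuned r) {T : Finset (Fin P.card)}
    (hT : P.lumpGraph.rooted.IsFeasible P.target T) {ℓ : P.Lump} (hℓ : P.two True False ℓ) :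
    ∃ σ, P.inc ℓ σ ∧ P.lumpGraph.st σ ∈ T := by
  classical
  by_contra! hne
  have h := card_le_of_isSolution hT.1 Finset.univ (fun _ _ => Finset.mem_univ _) (fun ℓ' => ℓ' ≠ ℓ)
    fun ℓ' σ hi hσ he => hne σ (he ▸ hi) hσ
  have h1 : P.two P.s P.g ℓ = P.s := by
    rcases ℓ with a | a | a
    · rfl
    · rfl
    · exact hℓ.elim
  have h2 := P.sum_two P.s P.g
  rw [← Finset.add_sum_erase _ _ (Finset.mem_univ ℓ), h1, smul_eq_mul, smul_eq_mul] at h2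
  rw [Finset.filter_ne', card_steiner] at h
  have h3 := hP.s_gt
  have h4 := hT.2
  unfold target at h4
  have h5 : 2 * P.N * P.t * P.p * P.g = 2 * (P.N * P.t) * (P.p * P.g) := by ring
  have h6 : P.core * P.s = P.s * P.core := mul_comm _ _
  omega

theorem totalCost_span_sel (a b o : Bool) :
    P.lumpGraph.rooted.totalCost (P.lumpGraph.span (P.sel a b o)) =
      (if a then P.rows * P.cA else 0) +
        ((if b then 2 * P.rows * P.cB else 0) + if o then P.N * P.cO else 0) := by
  have h := P.sum_sel a b o P.cA P.cB P.cO
  simp only [nsmul_eq_mul] at h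
  push_cast at h
  rw [LumpGraph.totalCost_span, rows]
  simp only [← mul_assoc]
  rw [← h]
  exact Finset.sum_congr rfl fun σ _ => by rcases σ with i | j | l <;> rfl

/-- By `h_ge` the cheap nodes cover at least one column lump more than the target asks for, and its
`g ≥ 2 * (N * t)` nodes replace the Steiner nodes counted in the target. -/
theorem IsTuned.isFeasible_cheap {r : ℝ} (hP : P.IsTuned r) :
    P.lumpGraph.rooted.IsFeasible P.target (P.lumpGraph.span (P.sel false false true)) := by
  refine ⟨LumpGraph.isSolution_span _ _, ?_⟩
  rw [card_span_cheap]
  have h1 := Nat.mul_le_mul_right P.g hP.h_ge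
  have h2 := hP.le_g
  have h3 : ((P.N * P.t - 1) * P.p + 1) * P.g = (P.N * P.t - 1) * (P.p * P.g) + P.g := by ring
  have h4 : 2 * (P.N * P.t) * P.h * P.g = 2 * (P.N * P.t) * (P.h * P.g) := by ring
  have h6 : P.core * P.s = P.s * P.core := mul_comm _ _
  unfold target
  omega

/-- The cheap nodes give the upper bound. For the lower bound, the dual `g - 1` on every core lump
respects all prices, and a feasible set meets all these lumps. -/
theorem IsTuned.exists_isOptimum {r : ℝ} (hP : P.IsTuned r) :
    ∃ opt, P.lumpGraph.rooted.IsOptimum P.target opt ∧ opt ≤ P.N * P.cO ∧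
      P.core * (P.g - 1) ≤ opt := by
  obtain ⟨T, hT, hmin⟩ := Set.exists_min_image {T | P.lumpGraph.rooted.IsFeasible P.target T}
    P.lumpGraph.rooted.totalCost (Set.toFinite _) ⟨_, hP.isFeasible_cheap⟩
  refine ⟨_, ⟨⟨T, hT, rfl⟩, ?_⟩, ?_, ?_⟩
  · rintro x ⟨T', hT', rfl⟩
    exact hmin T' hT'
  · refine (hmin _ hP.isFeasible_cheap).trans_eq ?_
    rw [totalCost_span_sel]
    simp
  · have hg := hP.two_le_g
    have h := P.sum_two ((P.g : ℝ) - 1) 0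
    rw [smul_zero, add_zero, nsmul_eq_mul] at h
    rw [← h]
    refine LumpGraph.sum_le_totalCost _ ?_ ?_ ?_
    · rintro (a | a | a)
      · exact (by linarith : (0 : ℝ) ≤ P.g - 1)
      · exact (by linarith : (0 : ℝ) ≤ P.g - 1)
      · exact le_rfl
    · have hpg : (0 : ℝ) ≤ P.p * P.g := by positivity
      have hO : (P.dO : ℝ) * (P.g - 1) ≤ P.dO * P.g :=
        mul_le_mul_of_nonneg_left (by linarith) (Nat.cast_nonneg _)
      have heg : (0 : ℝ) ≤ P.eO * P.g := by positivity
      rintro (i | j | l)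
      · refine (load_row _ _ _).trans_le (?_ : _ ≤ P.cA)
        rw [hP.cA_eq]; linarith
      · refine (load_col _ _ _).trans_le (?_ : _ ≤ P.cB)
        rw [hP.cB_eq]; linarith
      · refine (load_cheap _ _ _).trans_le (?_ : _ ≤ P.cO)
        rw [hP.cO_eq]; linarith
    · rintro (a | a | a) hℓ
      · exact hP.exists_inc hT trivial
      · exact hP.exists_inc hT trivial
      · exact absurd rfl hℓ

/-- A missing column `j` forces row `i` through the grid lump at `(i, j)`, for every `i`; the node
count then forces `N * t` columns. If no column is missing, `cA < cB` gives the same bound. -/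
theorem IsTuned.gap_le_totalCost {r opt : ℝ} (hP : P.IsTuned r) (hopt : opt ≤ P.N * P.cO)
    {T : Finset (Fin P.card)} (hT : P.lumpGraph.rooted.IsFeasible P.target T)
    (hcheap : ∀ l, P.lumpGraph.st (.inr (.inr l)) ∉ T) :
    4 / 3 * r * opt ≤ P.lumpGraph.rooted.totalCost T := by
  classical
  have hr := hP.one_le
  refine (mul_le_mul_of_nonneg_left hopt (by linarith)).trans (hP.gap.trans ?_)
  set I := Finset.univ.filter fun i : P.Row => P.lumpGraph.st (.inl i) ∈ T with hI
  set J := Finset.univ.filter fun j : P.Col => P.lumpGraph.st (.inr (.inl j)) ∈ T with hJ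
  have hcost : P.lumpGraph.rooted.totalCost T = I.card * P.cA + J.card * P.cB := by
    rw [← nsmul_eq_mul, ← nsmul_eq_mul, ← Finset.sum_const, ← Finset.sum_const, hI, hJ,
      Finset.sum_filter, Finset.sum_filter, LumpGraph.totalCost_eq, Finset.sum_filter,
      Fintype.sum_sum_type, Fintype.sum_sum_type]
    refine congrArg₂ _ (Finset.sum_congr rfl fun i _ => by congr)
      ((congrArg₂ _ (Finset.sum_congr rfl fun j _ => by congr)
        (Finset.sum_eq_zero fun l _ => if_neg (hcheap l))).trans (add_zero _))
  rw [hcost]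
  have hA0 := P.cA_pos
  have hAB := P.cA_lt
  have hq := P.rows_pos
  by_cases hcol : ∀ j : P.Col, P.lumpGraph.st (.inr (.inl j)) ∈ T
  · have hJ2 : (J.card : ℝ) = 2 * P.rows := by
      rw [hJ, Finset.filter_true_of_mem fun j _ => hcol j, Finset.card_univ]
      simp only [Fintype.card_prod, Fintype.card_fin, rows]
      push_cast
      ring
    rw [hJ2]
    have : 0 ≤ (I.card : ℝ) * P.cA := by positivity
    nlinarith
  · push Not at hcol
    obtain ⟨j, hj⟩ := hcol
    have hrow : ∀ i : P.Row, P.lumpGraph.st (.inl i) ∈ T := by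
      intro i
      obtain ⟨i' | j' | l, hi, hσ⟩ := hP.exists_inc hT (ℓ := P.gridLump i j) trivial
      · rwa [show i = i' from hi]
      · rw [show j = j' from hi] at hj
        exact absurd hσ hj
      · exact absurd hσ (hcheap l)
    have hI2 : I.card = P.N * P.t := by
      rw [hI, Finset.filter_true_of_mem fun i _ => hrow i, Finset.card_univ]
      simp only [Fintype.card_prod, Fintype.card_fin]
    have hJ2 : P.N * P.t ≤ J.card := by
      have h := card_le_of_isSolution hT.1 (I.disjSum (J.disjSum ∅)) (fun σ hσ => ?_)
        (fun ℓ => Sum.elim (fun _ => True) (Sum.elim (fun _ => True) fun a => a.1 ∈ J) ℓ) ?_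
      · have hsum : (∑ ℓ with
            Sum.elim (fun _ => True) (Sum.elim (fun _ => True) fun a => a.1 ∈ J) ℓ, P.two P.s P.g ℓ) = P.core * P.s + J.card * (P.p * P.g) := by
          have h1 := P.sum_two P.s (0 : ℕ)
          rw [smul_zero, add_zero, smul_eq_mul, Fintype.sum_sum_type, Fintype.sum_sum_type,
            Finset.sum_eq_zero (f := fun a => P.two P.s 0 (.inr (.inr a))) fun _ _ => rfl,
            add_zero] at h1
          have h2 : (∑ a : P.Col × Fin P.p, if a.1 ∈ J then P.g else 0) =
              J.card * (P.p * P.g) := by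
            rw [Fintype.sum_prod_type_right]
            simp only [Finset.sum_ite_mem, Finset.univ_inter, Finset.sum_const, Finset.card_univ,
              Fintype.card_fin, smul_eq_mul]
            ring
          rw [← h1, ← h2, Finset.sum_filter, Fintype.sum_sum_type, Fintype.sum_sum_type, add_assoc]
          exact congrArg₂ _ (Finset.sum_congr rfl fun a _ => if_pos trivial)
            (congrArg₂ _ (Finset.sum_congr rfl fun a _ => if_pos trivial)
              (Finset.sum_congr rfl fun a _ => by congr))
        rw [hsum, Finset.card_disjSum, Finset.card_disjSum, Finset.card_empty, hI2] at h
        have h2 := hT.2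
        unfold target at h2
        by_contra! hlt
        have h3 : J.card ≤ P.N * P.t - 1 := by omega
        have h4 := Nat.mul_le_mul_right (P.p * P.g) h3
        have h5 : P.core * P.s = P.s * P.core := mul_comm _ _
        omega
      · rcases σ with i | j | l
        · simp [hI, hσ]
        · simp [hJ, hσ]
        · exact absurd hσ (hcheap l)
      · rintro (a | a | a) (i | j | l) hi hσ
        · trivial
        · trivial
        · trivial
        · trivial
        · trivial
        · trivial
        · exact hi.elim
        · show a.1 ∈ J
          rw [show a.1 = j from hi]
          simp [hJ, hσ]
        · exact absurd hσ (hcheap l)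
    have hJ3 : P.rows ≤ J.card := by
      unfold rows; exact_mod_cast hJ2
    have hI3 : (I.card : ℝ) = P.rows := by
      rw [hI2]; unfold rows; push_cast; ring
    rw [hI3]
    nlinarith

theorem isWithin {P : Net} {d : ℝ} (hd : P.cO ≤ d) (v : Fin P.card) :
    P.lumpGraph.rooted.IsWithin d v := by
  have hprice : ∀ σ, P.lumpGraph.price σ ≤ d := by
    have h1 := P.cA_lt
    have h2 := P.cB_lt
    rintro (i | j | l)
    exacts [(h1.trans h2).le.trans hd, h2.le.trans hd, hd]
  have hlump : ∀ ℓ, ∃ σ, P.inc ℓ σ := by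
    rintro (a | a | a)
    exacts [⟨.inl a.1, rfl⟩, ⟨.inl P.row₀, trivial⟩, ⟨.inr (.inl a.1), rfl⟩]
  rcases P.lumpGraph.node_cases v with rfl | ⟨ℓ, hℓ⟩ | ⟨σ, rfl⟩
  · exact ⟨.nil, SimpleGraph.Walk.IsPath.nil, by simpa using P.cO_pos.le.trans hd⟩
  · obtain ⟨σ, hσ⟩ := hlump ℓ
    refine ⟨.cons ((P.lumpGraph.adj_lump_st hℓ σ).2 hσ) (.cons (P.lumpGraph.adj_st_rt σ) .nil),
      ?_, ?_⟩
    · have h1 : v ≠ P.lumpGraph.st σ := by rintro rfl; simp at hℓ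
      have h2 : v ≠ P.lumpGraph.rt := by rintro rfl; simp at hℓ
      have h3 := P.lumpGraph.st_ne_rt σ
      rw [SimpleGraph.Walk.isPath_def]
      change [v, P.lumpGraph.st σ, P.lumpGraph.rt].Nodup
      simp [h1, h2, h3]
    · change ([v, P.lumpGraph.st σ].map _).sum ≤ d
      simp [P.lumpGraph.cost_lump hℓ, hprice]
  · refine ⟨.cons (P.lumpGraph.adj_st_rt σ) .nil, ?_, ?_⟩
    · rw [SimpleGraph.Walk.isPath_def]
      change [P.lumpGraph.st σ, P.lumpGraph.rt].Nodup
      simp [P.lumpGraph.st_ne_rt σ]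
    · change ([P.lumpGraph.st σ].map _).sum ≤ d
      simp [hprice]

end Net

/-! ### The jump at penalty `1` -/

namespace Net

variable {P : Net}

theorem card_span_rows_lt (P : Net) :
    (P.lumpGraph.span (P.sel true false false)).card < P.target := by
  have h1 := P.one_le_rows_nat
  have h2 : P.core * P.s = P.s * P.core := mul_comm _ _
  rw [card_span_rows, target]
  omega

theorem lt_card_span_cols (P : Net) (a o : Bool) :
    P.target < (P.lumpGraph.span (P.sel a true o)).card := by
  have h1 := P.one_le_rows_nat
  have h2 : P.core * P.s = P.s * P.core := mul_comm _ _
  have h3 : 2 * (P.N * P.t) ≤ (P.sel a true o).card := by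
    have h4 : 2 * P.N * P.t = 2 * (P.N * P.t) := by ring
    rw [P.card_sel, if_pos rfl]
    omega
  have h5 : (P.N * P.t - 1) * (P.p * P.g) < 2 * (P.N * P.t) * (P.p * P.g) :=
    Nat.mul_lt_mul_of_pos_right (by omega) (Nat.mul_pos P.p_pos P.g_pos)
  rw [card_span_of_cols, target]
  omega

namespace IsTuned

variable {r lam : ℝ}

/-- As the penalty grows, the output passes through the root alone, the rows (up to penalty `1`),
the columns (below `cA`), rows and columns (below `cO`), and everything. -/
theorem exists_outcome (hP : P.IsTuned r) (hlam : 0 ≤ lam) : ∃ R z, Outcome P lam R z ∧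
    ∑ σ ∈ R, (P.lumpGraph.price σ - r * min (P.lumpGraph.price σ) lam) ≤ r * z ∧
    (lam ≤ 1 → (P.lumpGraph.span R).card < P.target) ∧
    (1 < lam → P.target < (P.lumpGraph.span R).card) := by
  rcases le_or_gt lam 1 with h1 | h1
  · rcases le_or_gt (P.dA * (P.s * lam)) (P.cA - lam) with h | h
    · refine ⟨_, 0, hP.outcome_low hlam h1 h, ?_, fun _ => ?_, fun h => absurd h1 (not_le.2 h)⟩
      · apply sel_ratio_iff
        simp
      · have := P.one_le_rows_nat
        rw [card_span_none, target]
        omega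
    · obtain ⟨z, hz, hz'⟩ := hP.exists_outcome_rows hlam h1 h
      exact ⟨_, z, hz, hz', fun _ => P.card_span_rows_lt, fun h => absurd h1 (not_le.2 h)⟩
  · rcases lt_or_ge lam P.cA with hA | hA
    · obtain ⟨z, hz, hz'⟩ := hP.exists_outcome_cols h1 hA
      exact ⟨_, z, hz, hz', fun h => absurd h1 (not_lt.2 h), fun _ => P.lt_card_span_cols _ _⟩
    rcases lt_or_ge lam P.cO with hO | hO
    · obtain ⟨z, hz, hz'⟩ := hP.exists_outcome_rows_cols hA hO
      exact ⟨_, z, hz, hz', fun h => absurd h1 (not_lt.2 h), fun _ => P.lt_card_span_cols _ _⟩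
    · obtain ⟨z, hz, hz'⟩ := hP.exists_outcome_all hO
      exact ⟨_, z, hz, hz', fun h => absurd h1 (not_lt.2 h), fun _ => P.lt_card_span_cols _ _⟩

theorem moatGrowingHasRatio (hP : P.IsTuned r) : P.lumpGraph.rooted.MoatGrowingHasRatio r := by
  intro lam hlam
  obtain ⟨R, z, hR, hcost, -⟩ := hP.exists_outcome hlam
  refine ⟨⟨_, (hR.returns_iff _).2 rfl⟩, fun T hT => ?_⟩
  rw [(hR.returns_iff T).1 hT]
  exact ⟨LumpGraph.isSolution_span _ _, hR.ratio r (zero_le_one.trans hP.one_le) hcost⟩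

theorem jump (hP : P.IsTuned r) {opt : ℝ} (hopt : opt ≤ P.N * P.cO) :
    ∃ (lam₀ δ : ℝ) (T_A T_B : Finset (Fin P.card)), 0 < lam₀ ∧ 0 < δ ∧ T_A.card < P.target ∧
      P.target < T_B.card ∧
      (∀ lam, 0 ≤ lam → ∀ T, P.lumpGraph.rooted.Returns lam T →
        (lam ≤ lam₀ → T.card < P.target) ∧ (lam₀ < lam → P.target < T.card)) ∧
      (∀ lam, 0 ≤ lam → lam₀ - δ ≤ lam → lam ≤ lam₀ →
        ∀ T, P.lumpGraph.rooted.Returns lam T ↔ T = T_A) ∧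
      (∀ lam, lam₀ < lam → lam ≤ lam₀ + δ → ∀ T, P.lumpGraph.rooted.Returns lam T ↔ T = T_B) ∧
      ∀ T, P.lumpGraph.rooted.IsFeasible P.target T → (∀ v ∈ T, v ∈ T_A ∨ v ∈ T_B) →
        4 / 3 * r * opt ≤ P.lumpGraph.rooted.totalCost T := by
  refine ⟨1, 1 / 2, P.lumpGraph.span (P.sel true false false),
    P.lumpGraph.span (P.sel false true false), one_pos, by norm_num, P.card_span_rows_lt,
    P.lt_card_span_cols _ _, fun lam hlam T hT => ?_, fun lam hlam h1 h2 => ?_,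
    fun lam h1 h2 => ?_, fun T hT hsub => hP.gap_le_totalCost hopt hT fun l hl => ?_⟩
  · obtain ⟨R, z, hR, -, h⟩ := hP.exists_outcome hlam
    rw [(hR.returns_iff T).1 hT]
    exact h
  -- From penalty `1/2` on, `2 * g < s` leaves the core lumps enough potential to make the rows
  -- tight.
  · obtain ⟨z, hz, -⟩ := hP.exists_outcome_rows hlam h2 (by
      have hA := one_le_dA P
      have hgs := hP.two_mul_g_lt
      have h3 : (P.g : ℝ) ≤ P.s * lam := by nlinarith
      have h4 := mul_le_mul_of_nonneg_left h3 (by linarith : (0 : ℝ) ≤ P.dA)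
      rw [hP.cA_eq]
      linarith)
    exact hz.returns_iff
  · obtain ⟨z, hz, -⟩ := hP.exists_outcome_cols h1 (by linarith [hP.two_le_cA])
    exact hz.returns_iff
  · rcases hsub _ hl with h | h <;> simp [P.lumpGraph.st_mem_span] at h

end IsTuned

end Net

/-! ### The choice of the parameters -/

namespace Net

/-- The parameters of a net whose prices are tuned to penalty `1`. -/
structure Params (r : ℝ) where
  (n m p v h g : ℕ)
  one_lt : 1 < r
  le_n : 8 ≤ n
  r_le : 6 * r ≤ n
  -- The slack in the gap is about `r * n^2 * m`; the factor `8 * n` lets it absorb the rounding of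
  -- `p`, `v` and `h`.
  m_eq : m = 8 * n
  -- The correction `r` to `n * n` has lower order. It keeps both ratios at most `r` and makes the
  -- second-order term of the gap positive.
  le_p : (n * n + r) * m ≤ p
  p_le : p ≤ (n * n + r) * m + 1
  v_le : n * v ≤ 2 * (r - 1) * ((n * n + r) * m)
  le_v : 2 * (r - 1) * ((n * n + r) * m) - n ≤ n * v
  le_h : (n * n - 1) * p + 1 ≤ 2 * (n * n) * h
  h_le : 2 * (n * n) * h ≤ (n * n - 1) * p + 1 + 2 * (n * n)
  -- The last bracket is `dA + dB`, the loss caused by `g - 1` in place of `g` in `cA + cB`; a large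
  -- `g` makes it negligible.
  g_eq : g = 2 * (n * n) + 2 * (3 * n * n * m + 2 * (n * v))

theorem exists_params {r : ℝ} (hr : 1 < r) (b : ℝ) : ∃ A : Params r, b ≤ A.n := by
  obtain ⟨n, hn⟩ := exists_nat_ge (max b (max 8 (6 * r)))
  have hn8 : (8 : ℝ) ≤ n := (le_max_left _ _).trans ((le_max_right _ _).trans hn)
  have hn8' : 8 ≤ n := by exact_mod_cast hn8
  have hnr : 6 * r ≤ n := (le_max_right _ _).trans ((le_max_right _ _).trans hn)
  have hn0 : (0 : ℝ) < n := by linarith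
  set Y : ℝ := (n * n + r) * (8 * n : ℕ) with hY
  have hY0 : 0 ≤ Y := by positivity
  have hZ0 : 0 ≤ 2 * (r - 1) * Y := mul_nonneg (by linarith) hY0
  set p := ⌈Y⌉₊
  set c := (n * n - 1) * p + 1
  have hq : 0 < 2 * (n * n) := by positivity
  have h1 := Nat.div_add_mod c (2 * (n * n))
  have h2 := Nat.mod_lt c hq
  -- The number `v` is rounded down for the sake of the ratio; `p` and `h` are rounded up, `h` to
  -- one more than the integer quotient.
  refine ⟨⟨n, 8 * n, p, ⌊2 * (r - 1) * Y / n⌋₊, c / (2 * (n * n)) + 1, _, hr, hn8', hnr, rfl,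
    Nat.le_ceil Y, (Nat.ceil_lt_add_one hY0).le, ?_, ?_, ?_, ?_, rfl⟩, (le_max_left _ _).trans hn⟩
  · have := Nat.floor_le (div_nonneg hZ0 hn0.le)
    rw [le_div_iff₀ hn0] at this
    linarith
  · have := Nat.lt_floor_add_one (2 * (r - 1) * Y / n)
    rw [div_lt_iff₀ hn0] at this
    linarith
  · rw [mul_add]; omega
  · rw [mul_add]; omega

namespace Params

variable {r : ℝ} (A : Params r)

theorem n_pos : 0 < A.n := by have := A.le_n; omega

theorem mul_m_le : A.n * A.n * A.m ≤ A.p := by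
  have h1 := A.le_p
  have h2 : 0 ≤ r * A.m := mul_nonneg (zero_le_one.trans A.one_lt.le) (Nat.cast_nonneg _)
  have : (A.n : ℝ) * A.n * A.m ≤ A.p := by linarith
  exact_mod_cast this

theorem m_pos : 0 < A.m := by have := A.m_eq; have := A.n_pos; omega

theorem p_pos : 0 < A.p :=
  (Nat.mul_pos (Nat.mul_pos A.n_pos A.n_pos) A.m_pos).trans_le A.mul_m_le

theorem one_lt_p : 1 < A.p := by
  have h1 := A.mul_m_le
  have h2 := A.m_eq
  have h3 := A.n_pos
  have h4 : A.m ≤ A.n * A.n * A.m := Nat.le_mul_of_pos_left _ (Nat.mul_pos h3 h3)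
  omega

theorem h_le_p : A.h ≤ A.p := by
  have h1 := A.h_le
  have h2 := A.one_lt_p
  have h3 := Nat.mul_pos A.n_pos A.n_pos
  by_contra! hlt
  have h4 : 2 * (A.n * A.n) * (A.p + 1) ≤ 2 * (A.n * A.n) * A.h := Nat.mul_le_mul_left _ hlt
  have h5 : (A.n * A.n - 1) * A.p ≤ A.n * A.n * A.p := Nat.mul_le_mul_right _ (Nat.sub_le _ _)
  have h6 : A.p ≤ A.n * A.n * A.p := Nat.le_mul_of_pos_left _ h3
  have h7 : 2 * (A.n * A.n) * (A.p + 1) = 2 * (A.n * A.n * A.p) + 2 * (A.n * A.n) := by ring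
  omega

theorem p_le_eO : A.p ≤ 2 * A.n * A.h := by
  have h1 := A.le_h
  have h2 : A.n * A.p ≤ (A.n * A.n - 1) * A.p := by
    refine Nat.mul_le_mul_right _ ?_
    have := Nat.mul_le_mul_left A.n A.le_n
    have := A.n_pos
    omega
  refine Nat.le_of_mul_le_mul_left (?_ : A.n * A.p ≤ A.n * (2 * A.n * A.h)) A.n_pos
  have h3 : 2 * (A.n * A.n) * A.h = A.n * (2 * A.n * A.h) := by ring
  omega

theorem v_le_mul : (A.v : ℝ) ≤ 2 * (A.n * A.n) * A.m := by
  have h0 : (0 : ℝ) < A.n := by exact_mod_cast A.n_pos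
  have h1 := A.v_le
  have h2 := A.r_le
  have h3 := A.one_lt
  have hm : (0 : ℝ) ≤ A.m := Nat.cast_nonneg _
  refine le_of_mul_le_mul_left (h1.trans ?_) h0
  have h4 : (r - 1) * ((A.n : ℝ) * A.n + r) ≤ A.n * (A.n * A.n) := by
    have h5 : (r - 1) * ((A.n : ℝ) * A.n + r) ≤ A.n / 2 * (A.n * A.n + A.n * A.n) := by
      gcongr
      · linarith
      · nlinarith
    linarith
  have := mul_le_mul_of_nonneg_right h4 hm
  linarith

/-- The difference of the two sides is `(n - 1) * (2 * n * n * m - v)`. -/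
theorem dA_le_dO : 2 * A.n * A.n * A.m + A.n * A.v ≤ A.n * (2 * A.n * A.n) * A.m + A.v := by
  have h1 : A.v ≤ 2 * (A.n * A.n) * A.m := by exact_mod_cast A.v_le_mul
  obtain ⟨k, hk⟩ := Nat.exists_eq_succ_of_ne_zero A.n_pos.ne'
  have h2 := Nat.mul_le_mul_left k h1
  generalize A.n = n at *
  subst hk
  simp only [Nat.succ_eq_add_one] at *
  linarith

theorem one_le_g : (1 : ℝ) ≤ A.g := by
  have h1 := A.g_eq
  have h2 := Nat.mul_pos A.n_pos A.n_pos
  exact_mod_cast (by omega : 1 ≤ A.g)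

/-- The net with given parameters. -/
noncomputable def net : Net where
  N := A.n
  t := A.n
  m := A.m
  v := A.v
  p := A.p
  h := A.h
  s := 3 * (A.n * A.n) + A.n + 2 * (A.n * A.n) * (A.p * A.g) + 2 * A.g + 1
  g := A.g
  cA := 1 + (2 * A.n * A.n * A.m + A.n * A.v : ℕ) * ((A.g : ℝ) - 1)
  cB := 1 + (A.n * A.n * A.m + A.n * A.v : ℕ) * ((A.g : ℝ) - 1) + A.p * A.g
  cO := (A.n * (2 * A.n * A.n) * A.m + A.v : ℕ) * (A.g : ℝ) + (2 * A.n * A.h : ℕ) * A.g + 2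
  N_pos := A.n_pos
  t_pos := A.n_pos
  m_pos := A.m_pos
  p_pos := A.p_pos
  h_le := A.h_le_p
  s_pos := Nat.succ_pos _
  g_pos := by exact_mod_cast A.one_le_g
  cA_pos := by
    have := mul_nonneg (Nat.cast_nonneg (α := ℝ) (2 * A.n * A.n * A.m + A.n * A.v))
      (sub_nonneg.2 A.one_le_g)
    linarith
  cA_lt := by
    have h1 : ((A.n * A.n * A.m : ℕ) : ℝ) ≤ A.p := by exact_mod_cast A.mul_m_le
    have h2 : (0 : ℝ) < A.p := by exact_mod_cast A.p_pos
    have h3 := mul_le_mul_of_nonneg_right h1 (sub_nonneg.2 A.one_le_g)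
    push_cast at *
    linarith
  cB_lt := by
    have h1 : ((2 * A.n * A.n * A.m + A.n * A.v : ℕ) : ℝ) ≤
      (A.n * (2 * A.n * A.n) * A.m + A.v : ℕ) := by exact_mod_cast A.dA_le_dO
    have h2 : (A.p : ℝ) ≤ (2 * A.n * A.h : ℕ) := by exact_mod_cast A.p_le_eO
    have h3 := mul_le_mul_of_nonneg_right h1 (sub_nonneg.2 A.one_le_g)
    have h4 := mul_le_mul_of_nonneg_right h2 (Nat.cast_nonneg (α := ℝ) A.g)
    have h5 : (0 : ℝ) ≤ (A.n * A.n * A.m : ℕ) * ((A.g : ℝ) - 1) :=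
      mul_nonneg (Nat.cast_nonneg _) (sub_nonneg.2 A.one_le_g)
    have h6 : (0 : ℝ) ≤ (A.n * (2 * A.n * A.n) * A.m + A.v : ℕ) := Nat.cast_nonneg _
    push_cast at *
    linarith

/-- With `q = n * n` and `F = n * v` this is `(q - r) * F ≤ 2 * (r - 1) * q^2 * m`, and `(q - r) *
(q + r) ≤ q^2`. -/
theorem ratio_row : (A.n * A.n : ℝ) * (2 * A.n * A.n * A.m + A.n * A.v) ≤
    r * (A.n * A.n * (2 * A.n * A.n) * A.m + A.n * A.v) := by
  have h1 := A.v_le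
  have h2 := A.r_le
  have h3 := A.one_lt
  have hn : (8 : ℝ) ≤ A.n := by exact_mod_cast A.le_n
  have hm : (0 : ℝ) ≤ A.m := Nat.cast_nonneg _
  have h4 : 0 ≤ (A.n * A.n : ℝ) - r := by nlinarith
  have h5 := mul_le_mul_of_nonneg_left h1 h4
  have h6 : 0 ≤ 2 * (r - 1) * (r * r) * A.m :=
    mul_nonneg (mul_nonneg (by linarith) (mul_self_nonneg r)) hm
  linarith

/-- Similarly this is `(2 * q - r) * F ≤ 2 * (r - 1) * q * (q * m + p)`, and `(2 * q - r) * (q + r)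
≤ q * (2 * q + r)`. -/
theorem ratio_col : 2 * (A.n * A.n : ℝ) * (A.n * A.n * A.m + A.n * A.v + A.p) ≤
    r * (A.n * A.n * (2 * A.n * A.n) * A.m + A.n * A.v + 2 * (A.n * A.n) * A.p) := by
  have h1 := A.v_le
  have h2 := A.r_le
  have h3 := A.one_lt
  have hn : (8 : ℝ) ≤ A.n := by exact_mod_cast A.le_n
  have hm : (0 : ℝ) ≤ A.m := Nat.cast_nonneg _
  have h4 : 0 ≤ 2 * (A.n * A.n : ℝ) - r := by nlinarith
  have h5 := mul_le_mul_of_nonneg_left h1 h4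
  have h6 : 0 ≤ 2 * (r - 1) * (r * r) * A.m :=
    mul_nonneg (mul_nonneg (by linarith) (mul_self_nonneg r)) hm
  have h7 : 0 ≤ 2 * (r - 1) * (A.n * A.n : ℝ) := by
    have : 0 ≤ r - 1 := by linarith
    positivity
  have h8 := mul_le_mul_of_nonneg_left A.le_p h7
  linarith

/-- Here `q = n^2`, `F = n * v` and `H = 2 * q * h`. Without rounding, the terms `4 * r * q^2 * m`
cancel and the right-hand side exceeds the `4/3 * r` multiple by `r * q * m - 4/3 * r^2 * (2 * r -
3) * m`. The subtracted term is small as `36 * r^2 ≤ q`. Of the remaining `8 * r * n * q` the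
rounding uses a part, and `r * n * q` is kept in reserve. -/
theorem gap_coeff {r n q m F H p : ℝ} (hr : 1 ≤ r) (hn : 8 ≤ n) (hq : 36 * r ^ 2 ≤ q)
    (hm : m = 8 * n) (hF : 2 * (r - 1) * ((q + r) * m) - n ≤ F)
    (hp : (q + r) * m ≤ p) (hp' : p ≤ (q + r) * m + 1) (hH : H ≤ (q - 1) * p + 1 + 2 * q) :
    4 / 3 * r * (2 * q ^ 2 * m + F + H) + r * n * q ≤ q * (3 * q * m + 2 * F + p) := by
  have hq1 : 36 * r ≤ q := by nlinarith
  have hq0 : 36 ≤ q := by linarith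
  have hr0 : 0 ≤ 4 / 3 * r := by linarith
  have h1 : 4 / 3 * r * H ≤ 4 / 3 * r * ((q - 1) * ((q + r) * m + 1) + 1 + 2 * q) := by
    refine mul_le_mul_of_nonneg_left (hH.trans ?_) hr0
    have := mul_le_mul_of_nonneg_left hp' (by linarith : 0 ≤ q - 1)
    linarith
  have h2 := mul_le_mul_of_nonneg_left hp (by linarith : 0 ≤ q)
  have h3 := mul_le_mul_of_nonneg_left hF (by linarith : 0 ≤ 2 * q - 4 / 3 * r)
  have h4 : 0 ≤ n * r * (q - 36 * r ^ 2) := mul_nonneg (by positivity) (by linarith)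
  have h5 : 0 ≤ (r - 1) * (n * q) := mul_nonneg (by linarith) (by positivity)
  have h6 : 0 ≤ (n - 8) * (r * q) := mul_nonneg (by linarith) (by positivity)
  have h7 : 0 ≤ n * r ^ 2 := by positivity
  have h8 : 0 ≤ n * r * q := by positivity
  have h9 : 0 ≤ r * n := by positivity
  subst hm
  nlinarith

theorem sq_r_le : 36 * r ^ 2 ≤ (A.n * A.n : ℝ) := by
  have h2 := A.r_le
  have h3 := A.one_lt
  nlinarith

/-- The reserve of `gap_coeff`, multiplied by `g`, pays for the summand `2` in `cO` and for the loss
through `g - 1` in `cA` and `cB`. -/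
theorem gap : 4 / 3 * r * (A.n * A.net.cO) ≤ A.n * A.n * A.net.cA + A.n * A.n * A.net.cB := by
  have hr := A.one_lt.le
  have hn : (8 : ℝ) ≤ A.n := by exact_mod_cast A.le_n
  have hq : (64 : ℝ) ≤ A.n * A.n := by nlinarith
  have hm : (A.m : ℝ) = 8 * A.n := by rw [A.m_eq]; push_cast; ring
  have hH : (2 * (A.n * A.n) * A.h : ℝ) ≤ (A.n * A.n - 1) * A.p + 1 + 2 * (A.n * A.n) := by
    have h := (Nat.cast_le (α := ℝ)).2 A.h_le
    have h1 : 1 ≤ A.n * A.n := Nat.mul_pos A.n_pos A.n_pos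
    push_cast [Nat.cast_sub h1] at h
    exact h
  have hg : (A.g : ℝ) = 2 * (A.n * A.n) + 2 * (3 * (A.n * A.n) * A.m + 2 * (A.n * A.v)) := by
    rw [A.g_eq]; push_cast; ring
  have key := gap_coeff hr hn A.sq_r_le hm A.le_v A.le_p A.p_le hH
  have h1 := mul_le_mul_of_nonneg_right key (Nat.cast_nonneg (α := ℝ) A.g)
  have hrn : 1 ≤ r * A.n := by nlinarith
  have h2 : (8 / 3 * r * A.n : ℝ) + A.n * A.n * (3 * (A.n * A.n) * A.m + 2 * (A.n * A.v)) ≤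
      r * A.n * (A.n * A.n) * A.g := by
    rw [hg]
    set q : ℝ := A.n * A.n with hqdef
    set D : ℝ := 3 * q * A.m + 2 * (A.n * A.v)
    have hD : 0 ≤ D := by positivity
    have h3 := mul_le_mul_of_nonneg_right hrn (by positivity : 0 ≤ q * D)
    have h4 : (8 / 3 : ℝ) ≤ 2 * (q * q) := by nlinarith
    have h5 := mul_le_mul_of_nonneg_left h4 (by linarith : 0 ≤ r * (A.n : ℝ))
    have h6 : 0 ≤ q * D := by positivity
    linarith
  simp only [net]
  push_cast
  linarith

/-- Compares the cheap nodes with the lower bound for the optimum: each price is at most `10 / n`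
times the optimum. -/
theorem cO_le : A.n * A.net.cO ≤ 10 * (A.net.core * ((A.g : ℝ) - 1)) := by
  have hr := A.one_lt.le
  have hn : (8 : ℝ) ≤ A.n := by exact_mod_cast A.le_n
  have hq : (64 : ℝ) ≤ A.n * A.n := by nlinarith
  have hm : (A.m : ℝ) = 8 * A.n := by rw [A.m_eq]; push_cast; ring
  have hm1 : (64 : ℝ) ≤ A.m := by linarith
  set q : ℝ := A.n * A.n with hqdef
  have hg2 : (2 : ℝ) ≤ A.g := by
    have h1 := A.g_eq
    have h2 := Nat.mul_pos A.n_pos A.n_pos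
    exact_mod_cast (by omega : 2 ≤ A.g)
  have hH : (2 * q * A.h : ℝ) ≤ (q - 1) * A.p + 1 + 2 * q := by
    have h := (Nat.cast_le (α := ℝ)).2 A.h_le
    have h1 : 1 ≤ A.n * A.n := Nat.mul_pos A.n_pos A.n_pos
    push_cast [Nat.cast_sub h1] at h
    exact h
  have hrq : r ≤ q := by
    have := A.sq_r_le
    nlinarith
  have hp : (A.p : ℝ) ≤ 3 * q * A.m := by
    have h1 := A.p_le
    have h2 := mul_le_mul_of_nonneg_right hrq (by linarith : (0 : ℝ) ≤ A.m)
    nlinarith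
  have hp1 : (1 : ℝ) ≤ A.p := by exact_mod_cast A.p_pos
  have hH2 : (2 * q * A.h : ℝ) ≤ 5 * (q * q) * A.m := by
    have h1 := mul_le_mul_of_nonneg_left hp (by linarith : (0 : ℝ) ≤ q)
    have h2 : q * 1 ≤ q * (q * A.m) := by gcongr; nlinarith
    linarith
  have hcore : (A.net.core : ℝ) = 2 * (q * q) * A.m + A.n * A.v := by
    simp only [core, net]
    push_cast
    ring
  have hF : (0 : ℝ) ≤ A.n * A.v := by positivity
  have hcore1 : (A.n : ℝ) ≤ A.net.core := by
    rw [hcore]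
    have : (A.n : ℝ) * 1 ≤ q * (q * A.m) := by
      gcongr
      · nlinarith
      · nlinarith
    linarith
  have hcO : (A.n : ℝ) * A.net.cO = A.net.core * A.g + 2 * q * A.h * A.g + 2 * A.n := by
    rw [hcore]
    simp only [net]
    push_cast
    ring
  have h1 : 2 * q * A.h * A.g ≤ 3 * A.net.core * A.g := by
    refine mul_le_mul_of_nonneg_right ?_ (by linarith)
    rw [hcore]
    have : 0 ≤ q * q * A.m := by positivity
    linarith
  have h2 : (2 : ℝ) * A.n ≤ A.g * A.net.core := by gcongr
  have h3 : 0 ≤ (A.net.core : ℝ) * (A.g - 2) := mul_nonneg (Nat.cast_nonneg _) (by linarith)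
  rw [hcO]
  linarith

theorem isTuned : A.net.IsTuned r where
  one_le := A.one_lt.le
  cA_eq := rfl
  cB_eq := rfl
  cO_eq := rfl
  dA_le := A.dA_le_dO
  p_le := A.p_le_eO
  le_p := A.mul_m_le
  ratio_row := by
    have h := A.ratio_row
    simp only [rows, dA, core, net]
    push_cast
    linarith
  ratio_col := by
    have h := A.ratio_col
    simp only [rows, dB, core, net]
    push_cast
    linarith
  le_g := by
    have h := A.g_eq
    show 2 * (A.n * A.n) ≤ A.g
    omega
  s_gt := Nat.lt_succ_self _
  h_ge := A.le_h
  gap := A.gap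

theorem n_lt_card : A.n < A.net.card := by
  have h : A.net.card = 1 + ((A.n * A.n + (A.n * (2 * A.n) + A.n)) +
      Fintype.card (Σ ℓ : A.net.Lump, Fin (A.net.sz ℓ))) := by
    simp only [card, Fintype.card_sum, Fintype.card_unit, Fintype.card_prod, Fintype.card_fin]
    rfl
  omega

end Params

end Net

/-! ### The sequence of graphs -/

/-- Tuned nets with many nodes in which all nodes are close to the root. -/
theorem exists_tuned_net {r : ℝ} (hr : 1 < r) {ε : ℝ} (hε : 0 < ε) (b : ℕ) :
    ∃ P : Net, P.IsTuned r ∧ b < P.card ∧ P.cO ≤ ε * (P.core * (P.g - 1)) := by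
  obtain ⟨A, hA⟩ := Net.exists_params hr (max b (10 / ε))
  refine ⟨A.net, A.isTuned, lt_of_le_of_lt ?_ A.n_lt_card, ?_⟩
  · exact_mod_cast (le_max_left _ _).trans hA
  · have h1 : 10 ≤ A.n * ε := by
      rw [← div_le_iff₀ hε]
      exact (le_max_right _ _).trans hA
    have hn : (0 : ℝ) < A.n := by exact_mod_cast A.n_pos
    have h2 : (0 : ℝ) ≤ A.net.core * (A.g - 1) :=
      mul_nonneg (Nat.cast_nonneg _) (sub_nonneg.2 A.one_le_g)
    refine le_of_mul_le_mul_left (A.cO_le.trans ?_) hn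
    have := mul_le_mul_of_nonneg_right h1 h2
    show _ ≤ (A.n : ℝ) * (ε * (A.net.core * ((A.g : ℝ) - 1)))
    linarith

theorem mainTheorem3 (r : ℝ) (hr : 1 < r) :
    ∃ (n k : ℕ → ℕ) (I : ∀ i : ℕ, RootedGraph (Fin (n i))) (opt : ℕ → ℝ),
      StrictMono n ∧
      (∀ ε : ℝ, 0 < ε → ∃ i₀, ∀ i, i₀ ≤ i → ∀ v, (I i).IsWithin (ε * opt i) v) ∧
      ∀ i, (I i).IsOptimum (k i) (opt i) ∧ 0 < opt i ∧
        (I i).MoatGrowingHasRatio r ∧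
        ∃ (lam₀ δ : ℝ) (T_A T_B : Finset (Fin (n i))),
          0 < lam₀ ∧ 0 < δ ∧ T_A.card < k i ∧ k i < T_B.card ∧
          (∀ lam, 0 ≤ lam → ∀ T, (I i).Returns lam T →
            (lam ≤ lam₀ → T.card < k i) ∧ (lam₀ < lam → k i < T.card)) ∧
          (∀ lam, 0 ≤ lam → lam₀ - δ ≤ lam → lam ≤ lam₀ →
            ∀ T, (I i).Returns lam T ↔ T = T_A) ∧
          (∀ lam, lam₀ < lam → lam ≤ lam₀ + δ → ∀ T, (I i).Returns lam T ↔ T = T_B) ∧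
          ∀ T, (I i).IsFeasible (k i) T → (∀ v ∈ T, v ∈ T_A ∨ v ∈ T_B) →
            4 / 3 * r * opt i ≤ (I i).totalCost T := by
  choose F hF using fun (i : ℕ) (b : ℕ) =>
    exists_tuned_net hr (ε := 1 / ((i : ℝ) + 1)) (by positivity) b
  -- Each net is chosen with more nodes than its predecessor, and net `i` with `ε = 1 / (i + 1)`.
  let P : ℕ → Net := fun i => Nat.rec (F 0 0) (fun j Q => F (j + 1) Q.card) i
  have hP : ∀ i, ∃ b, P i = F i b := fun i => by
    cases i with
    | zero => exact ⟨0, rfl⟩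
    | succ j => exact ⟨(P j).card, rfl⟩
  have htuned : ∀ i, (P i).IsTuned r := fun i => by
    obtain ⟨b, hb⟩ := hP i
    rw [hb]
    exact (hF i b).1
  choose opt hopt hle hge using fun i => (htuned i).exists_isOptimum
  have hcO : ∀ i : ℕ, (P i).cO ≤ 1 / ((i : ℝ) + 1) * opt i := fun i => by
    refine le_trans ?_ (mul_le_mul_of_nonneg_left (hge i) (by positivity))
    obtain ⟨b, hb⟩ := hP i
    rw [hb]
    exact (hF i b).2.2
  have hpos : ∀ i, 0 < opt i := fun i => by
    have h := (P i).cO_pos.trans_le (hcO i)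
    exact (mul_pos_iff_of_pos_left (by positivity)).1 h
  refine ⟨fun i => (P i).card, fun i => (P i).target, fun i => (P i).lumpGraph.rooted, opt,
    strictMono_nat_of_lt_succ fun i => (hF (i + 1) (P i).card).2.1, fun ε hε => ?_, fun i =>
      ⟨hopt i, hpos i, (htuned i).moatGrowingHasRatio, (htuned i).jump (hle i)⟩⟩
  obtain ⟨i₀, hi₀⟩ := exists_nat_one_div_lt hε
  refine ⟨i₀, fun i hi v => Net.isWithin ((hcO i).trans ?_) v⟩
  refine mul_le_mul_of_nonneg_right (le_trans ?_ hi₀.le) (hpos i).le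
  gcongr
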